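/- **Setting.** Let $M$ be a closed connected smooth manifold with fundamental group $\Gamma$ and let $\pi:\tilde M\to M$ be its universal covering, on which $\Gamma$ acts from the right by deck transformations; write $R_g(y)=yg$. Let $\{U_i\}_{i\in I}$ be a finite open covering of $M$ such that all intersections $U_i\cap U_j$ are connected (or empty), let $U_i'\subset\pi^{-1}U_i$ be open subsets such that $\pi:U_i'\to U_i$ is a diffeomorphism, and let $\chi_i\in C^\infty(M,\mathbb R)$ be such that $\{\chi_i^2\}_{i\in I}$ is a partition of unity subordinate to $\{U_i\}$. Let $g_{ij}\in\Gamma$ be the deck transformation with $(U_i'\cap\pi^{-1}U_j)\,g_{ij}=U_j'\cap\pi^{-1}U_i$ (arbitrary if $U_i\cap U_j=\emptyset$), and let $$P=(\chi_i\chi_j\,g_{ij})_{i,j\in I}\in C^\infty(M)\otimes M_{|I|}(\mathbb C\Gamma),$$ the projection onto the image of the Mishchenko--Fomenko bundle $\tilde M\times_\Gamma C_r^*\Gamma$ in the trivial bundle $M\times (C^*_r\Gamma)^{|I|}$. Let $\Omega_*\mathbb C\Gamma=\bigoplus_k \mathbb C\Gamma\otimes(\mathbb C\Gamma/\mathbb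 C)^{\otimes k}$ be the algebraic differential graded algebra of noncommutative forms, with $a_0\otimes\dots\otimes a_k=a_0\,\mathrm d a_1\cdots \mathrm d a_k$ and $\mathrm d (a_0\otimes\dots\otimes a_k)=1\otimes a_0\otimes\dots\otimes a_k$, and let $d_{tot}=d_M+\mathrm d$ be the total differential on the graded tensor product $\Omega^*(M)\otimes\Omega_*\mathbb C\Gamma$. Put $$\mathrm{ch}^M_{\mathbb C\Gamma}(P)=\sum_{k\ge0}\frac{(-1)^k}{(2\pi i)^kk!}\,\mathrm{tr}\,P(d_{tot}P)^{2k}.$$ Let $n\ge1$ and let $\tau:\Gamma^{n+1}\to\mathbb C$ be a left invariant alternating function with $d_\Gamma\tau=0$, where $d_\Gamma\tau(g_0,\dots,g_{n+1})=\sum_j(-1)^j\tau(g_0,\dots,\widehat{g_j},\dots,g_{n+1})$. Let $c_\tau$ be the normalized cyclic cochain on $\mathbb C\Gamma$ with $c_\tau(g_0,\dots,g_n)=\tau(e,g_1,g_1g_2,\dots,g_1\cdots g_n)$ if $g_0g_1\cdots g_n=e$ and $c_\tau(g_0,\dots,g_n)=0$ otherwise. It is applied to forms by $c_\tau(\alpha\otimes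 g_0\,\mathrm dg_1\cdots \mathrm dg_n)=c_\tau(g_0,\dots,g_n)\,\alpha$, and by zero on $\Omega^*(M)\otimes\Omega_k\mathbb C\Gamma$ for $k\neq n$. Let $\chi_i'$ be the lift of $\chi_i$ to $U_i'$, extended by zero to $\tilde M$, let $h=\sum_i\chi_i'^2$, and let $$\tilde\omega_\tau=\sum_{g_1,\dots,g_n\in\Gamma}\tau(e,g_1,\dots,g_n)\,R_{g_1}^*dh\wedge\dots\wedge R_{g_n}^*dh .$$ **Statement.** There is a unique form $\omega_\tau$ on $M$ with $\pi^*\omega_\tau=\tilde\omega_\tau$; it is smooth and closed, and on the level of differential forms $$c_\tau\bigl(\mathrm{ch}^M_{\mathbb C\Gamma}(P)\bigr)=(-1)^{\frac{n(n-1)}2}\bigl((2\pi i)^n\,n!\bigr)^{-1}\,\omega_\tau .$$ Moreover, let $E\Gamma\to B\Gamma$ be a principal $\Gamma$-covering with contractible total space, and let $\nu:M\to B\Gamma$ be a classifying map of $\tilde M\to M$, i.e. a continuous map that is covered by a continuous $\Gamma$-equivariant map $\tilde M\to E\Gamma$. Then the class of this closed $n$-form in $H^n(M)$ (complex coefficients)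 is $$\bigl[c_\tau(\mathrm{ch}^M_{\mathbb C\Gamma}(P))\bigr]=(-1)^{\frac{n(n-1)}2}\bigl((2\pi i)^n\,n!\bigr)^{-1}\,\nu^*[\tau],$$ where $[\tau]\in H^n(\Gamma)\cong H^n(B\Gamma)$, and where de Rham cohomology is identified with singular cohomology by integration over smooth singular simplices. -/

import Mathlib

open scoped TensorProduct Manifold ContDiff DirectSum

noncomputable section

/-! ### The differential graded algebra of noncommutative differential forms -/

section NCForms

variable (A : Type*) [Ring A] [Algebra ℂ A]

/-- The algebra of (algebraic) differential forms `Ω_* A = ⨁ₖ A ⊗ (A/ℂ)^{⊗ k}`; the direct sum over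
`k` of the tensor powers of `A/ℂ` is the tensor algebra of `A/ℂ`. -/
def NCForm : Type _ := A ⊗[ℂ] TensorAlgebra ℂ (A ⧸ Submodule.span ℂ {(1 : A)})

instance : AddCommGroup (NCForm A) :=
  inferInstanceAs (AddCommGroup (A ⊗[ℂ] TensorAlgebra ℂ (A ⧸ Submodule.span ℂ {(1 : A)})))

instance : Module ℂ (NCForm A) :=
  inferInstanceAs (Module ℂ (A ⊗[ℂ] TensorAlgebra ℂ (A ⧸ Submodule.span ℂ {(1 : A)})))

namespace NCForm

/-- The quotient space `A/ℂ`. -/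
abbrev Bar : Type _ := A ⧸ Submodule.span ℂ {(1 : A)}

variable {A}

/-- The element `a ⊗ t` of `Ω_* A`. -/
def mk (a : A) (t : TensorAlgebra ℂ (Bar A)) : NCForm A := a ⊗ₜ[ℂ] t

/-- Linear maps out of `Ω_* A` from bilinear maps on `A × T(A/ℂ)`. -/
def liftLin {V : Type*} [AddCommGroup V] [Module ℂ V]
    (f : A →ₗ[ℂ] TensorAlgebra ℂ (Bar A) →ₗ[ℂ] V) : NCForm A →ₗ[ℂ] V :=
  TensorProduct.lift f

@[simp] lemma liftLin_mk {V : Type*} [AddCommGroup V] [Module ℂ V]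
    (f : A →ₗ[ℂ] TensorAlgebra ℂ (Bar A) →ₗ[ℂ] V) (a : A) (t) :
    liftLin f (mk a t) = f a t := TensorProduct.lift.tmul _ _

/-- The bilinear map `(a, t) ↦ a ⊗ t`. -/
def mkLin : A →ₗ[ℂ] TensorAlgebra ℂ (Bar A) →ₗ[ℂ] NCForm A := TensorProduct.mk ℂ _ _

@[simp] lemma mkLin_apply (a : A) (t : TensorAlgebra ℂ (Bar A)) : mkLin a t = mk a t := rfl

lemma lin_ext {V : Type*} [AddCommGroup V] [Module ℂ V] {f g : NCForm A →ₗ[ℂ] V}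
    (h : ∀ a t, f (mk a t) = g (mk a t)) : f = g :=
  TensorProduct.ext' h

variable (A) in
/-- The class of `a` in `A/ℂ`, as an element of degree one of the tensor algebra. -/
def bar : A →ₗ[ℂ] TensorAlgebra ℂ (Bar A) :=
  TensorAlgebra.ι ℂ ∘ₗ Submodule.mkQ _

@[simp] lemma bar_one : bar A 1 = 0 := by
  have : (Submodule.mkQ (Submodule.span ℂ {(1 : A)})) 1 = 0 := by
    simp
  simp [bar, this]

variable (A) in
/-- The differential `d (a₀ ⊗ a₁ ⊗ ⋯ ⊗ aₖ) = 1 ⊗ a₀ ⊗ a₁ ⊗ ⋯ ⊗ aₖ`. -/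
def d : NCForm A →ₗ[ℂ] NCForm A :=
  liftLin (((mkLin (1 : A)).compRight ℂ) ∘ₗ (LinearMap.mul ℂ (TensorAlgebra ℂ (Bar A))) ∘ₗ bar A)

@[simp] lemma d_mk (a : A) (t) : d A (mk a t) = mk 1 (bar A a * t) := by
  simp [d]

/-- Left multiplication by an element of `A`. -/
def leftMul : A →ₗ[ℂ] Module.End ℂ (NCForm A) where
  toFun a := liftLin (mkLin ∘ₗ LinearMap.mulLeft ℂ a)
  map_add' a b := lin_ext fun x t => by simp [add_mul]
  map_smul' c a := lin_ext fun x t => by simp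

@[simp] lemma leftMul_mk (a b : A) (t) : leftMul a (mk b t) = mk (a * b) t := by
  simp [leftMul]

lemma leftMul_mul (a b : A) : leftMul (a * b) = leftMul a * leftMul b :=
  lin_ext fun x t => by simp [mul_assoc]

lemma leftMul_one : leftMul (1 : A) = 1 := lin_ext fun x t => by simp

/-- Left multiplication by `d a`. The Leibniz rule forces `(d a) w = d (a w) - a (d w)`. -/
def leftMulD : Bar A →ₗ[ℂ] Module.End ℂ (NCForm A) :=
  Submodule.liftQ _ (LinearMap.mulLeft ℂ (d A) ∘ₗ leftMul - LinearMap.mulRight ℂ (d A) ∘ₗ leftMul)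
    (by
      rw [Submodule.span_singleton_le_iff_mem]
      simp [leftMul_one])

@[simp] lemma leftMulD_mkQ (a : A) :
    leftMulD (Submodule.mkQ _ a) = d A * leftMul a - leftMul a * d A := rfl

variable (A) in
/-- The product: `(a₀ d a₁ ⋯ d aₖ) w = a₀ (d a₁ (⋯ (d aₖ w)))`. -/
def mulHom : NCForm A →ₗ[ℂ] Module.End ℂ (NCForm A) :=
  liftLin ((LinearMap.mul ℂ (Module.End ℂ (NCForm A))).compl₂
    (TensorAlgebra.lift ℂ leftMulD).toLinearMap ∘ₗ leftMul)

@[simp] lemma mulHom_mk (a : A) (t) :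
    mulHom A (mk a t) = leftMul a * TensorAlgebra.lift ℂ leftMulD t := by
  simp [mulHom]

instance : Mul (NCForm A) := ⟨fun α β => mulHom A α β⟩
instance : One (NCForm A) := ⟨mk 1 1⟩

lemma mul_def (α β : NCForm A) : α * β = mulHom A α β := rfl
lemma one_def : (1 : NCForm A) = mk 1 1 := rfl

lemma lift_bar (a : A) :
    TensorAlgebra.lift ℂ leftMulD (bar A a) = d A * leftMul a - leftMul a * d A := by
  simp only [bar, LinearMap.comp_apply, TensorAlgebra.lift_ι_apply, leftMulD_mkQ]

lemma bar_surj (v : Bar A) : ∃ a, TensorAlgebra.ι ℂ v = bar A a := by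
  obtain ⟨a, rfl⟩ := Submodule.mkQ_surjective _ v
  exact ⟨a, rfl⟩

lemma lift_apply_mk_one (t s : TensorAlgebra ℂ (Bar A)) :
    TensorAlgebra.lift ℂ leftMulD t (mk 1 s) = mk 1 (t * s) := by
  induction t using TensorAlgebra.induction generalizing s with
  | algebraMap r =>
      rw [AlgHom.commutes, Algebra.algebraMap_eq_smul_one, Algebra.algebraMap_eq_smul_one]
      simp only [LinearMap.smul_apply, Module.End.one_apply, smul_mul_assoc, one_mul]
      exact (map_smul (mkLin (1 : A)) r s).symm
  | ι v =>
      obtain ⟨a, ha⟩ := bar_surj v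
      rw [ha, lift_bar]
      have h0 : mk a (0 : TensorAlgebra ℂ (Bar A)) = 0 := map_zero (mkLin a)
      simp [h0]
  | mul a b ha hb => rw [map_mul, Module.End.mul_apply, hb, ha, mul_assoc]
  | add a b ha hb =>
      rw [map_add, LinearMap.add_apply, ha, hb, add_mul]
      exact (map_add (mkLin (1 : A)) _ _).symm

lemma mulHom_leftMul (a : A) (β : NCForm A) : mulHom A (leftMul a β) = leftMul a * mulHom A β := by
  have : (mulHom A) ∘ₗ leftMul a = LinearMap.mulLeft ℂ (leftMul a) ∘ₗ mulHom A :=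
    lin_ext fun x t => by simp [leftMul_mul, mul_assoc]
  exact LinearMap.congr_fun this β

lemma mulHom_d (β : NCForm A) : 
    ∀ a, mulHom A (d A (leftMul a β)) - leftMul a * mulHom A (d A β)
      = (d A * leftMul a - leftMul a * d A) * mulHom A β := by
  intro a
  have : mulHom A ∘ₗ d A ∘ₗ leftMul a - LinearMap.mulLeft ℂ (leftMul a) ∘ₗ mulHom A ∘ₗ d A
      = LinearMap.mulLeft ℂ (d A * leftMul a - leftMul a * d A) ∘ₗ mulHom A :=
    lin_ext fun x t => by
      simp only [LinearMap.sub_apply, LinearMap.comp_apply, leftMul_mk, d_mk, mulHom_mk,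
        leftMul_one, one_mul, map_mul, lift_bar, leftMul_mul, LinearMap.mulLeft_apply]
      noncomm_ring
  exact LinearMap.congr_fun this β

lemma mulHom_mul (α β : NCForm A) : mulHom A (mulHom A α β) = mulHom A α * mulHom A β := by
  have key : ∀ (t : TensorAlgebra ℂ (Bar A)) (β : NCForm A),
      mulHom A (TensorAlgebra.lift ℂ leftMulD t β)
        = TensorAlgebra.lift ℂ leftMulD t * mulHom A β := by
    intro t
    induction t using TensorAlgebra.induction with
    | algebraMap r =>
        intro β
        rw [AlgHom.commutes, Algebra.algebraMap_eq_smul_one]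
        simp
    | ι v =>
        intro β
        obtain ⟨a, ha⟩ := bar_surj v
        rw [ha, lift_bar, ← mulHom_d]
        simp [mulHom_leftMul]
    | mul a b ha hb => intro β; rw [map_mul, Module.End.mul_apply, ha, hb, mul_assoc]
    | add a b ha hb =>
        intro β; rw [map_add, LinearMap.add_apply, map_add, ha, hb, add_mul]
  have : mulHom A ∘ₗ (mulHom A).flip β = LinearMap.mulRight ℂ (mulHom A β) ∘ₗ mulHom A :=
    lin_ext fun x t => by
      simp only [LinearMap.comp_apply, LinearMap.flip_apply, mulHom_mk, Module.End.mul_apply,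
        mulHom_leftMul, key, LinearMap.mulRight_apply, mul_assoc]
  exact LinearMap.congr_fun this α

instance : Ring (NCForm A) :=
  { (inferInstance : AddCommGroup (NCForm A)) with
    mul := (· * ·)
    one := 1
    mul_assoc := fun a b c => by
      simp only [mul_def, mulHom_mul, Module.End.mul_apply]
    one_mul := fun a => by
      simp [mul_def, one_def, leftMul_one]
    mul_one := fun a => by
      have : (mulHom A).flip 1 = LinearMap.id := lin_ext fun x t => by
        simp only [LinearMap.flip_apply, mulHom_mk, Module.End.mul_apply, one_def,
          lift_apply_mk_one, leftMul_mk, mul_one, LinearMap.id_apply]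
      exact LinearMap.congr_fun this a
    left_distrib := fun a b c => by simp [mul_def]
    right_distrib := fun a b c => by simp [mul_def]
    zero_mul := fun a => by simp [mul_def]
    mul_zero := fun a => by simp [mul_def] }

instance : Algebra ℂ (NCForm A) :=
  Algebra.ofModule (fun r x y => by simp [mul_def]) (fun r x y => by simp [mul_def])

variable (A) in
/-- The forms of degree `k`, i.e. the subspace `A ⊗ (A/ℂ)^{⊗ k}`. -/
def degree (k : ℕ) : Submodule ℂ (NCForm A) :=
  Submodule.span ℂ {w | ∃ (a : A), ∃ t ∈ LinearMap.range (TensorAlgebra.ι ℂ (M := Bar A)) ^ k,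
    w = mk a t}

lemma mk_mem_degree {k : ℕ} (a : A) {t : TensorAlgebra ℂ (Bar A)}
    (ht : t ∈ LinearMap.range (TensorAlgebra.ι ℂ (M := Bar A)) ^ k) : mk a t ∈ degree A k :=
  Submodule.subset_span ⟨a, t, ht, rfl⟩

lemma bar_mem (a : A) : bar A a ∈ LinearMap.range (TensorAlgebra.ι ℂ (M := Bar A)) := ⟨_, rfl⟩

lemma d_mem {k : ℕ} {w : NCForm A} (h : w ∈ degree A k) : d A w ∈ degree A (k + 1) := by
  induction h using Submodule.span_induction with
  | mem x hx =>
      obtain ⟨a, t, ht, rfl⟩ := hx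
      rw [d_mk]
      exact mk_mem_degree _ (by rw [pow_succ']; exact Submodule.mul_mem_mul (bar_mem a) ht)
  | zero => simp
  | add x y _ _ hx hy => rw [map_add]; exact add_mem hx hy
  | smul r x _ hx => rw [map_smul]; exact Submodule.smul_mem _ _ hx

lemma leftMul_mem {k : ℕ} (a : A) {w : NCForm A} (h : w ∈ degree A k) :
    leftMul a w ∈ degree A k := by
  induction h using Submodule.span_induction with
  | mem x hx =>
      obtain ⟨b, t, ht, rfl⟩ := hx
      rw [leftMul_mk]
      exact mk_mem_degree _ ht
  | zero => simp
  | add x y _ _ hx hy => rw [map_add]; exact add_mem hx hy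
  | smul r x _ hx => rw [map_smul]; exact Submodule.smul_mem _ _ hx

lemma lift_mem {k : ℕ} {t : TensorAlgebra ℂ (Bar A)}
    (ht : t ∈ LinearMap.range (TensorAlgebra.ι ℂ (M := Bar A)) ^ k) :
    ∀ {l : ℕ} {w : NCForm A}, w ∈ degree A l →
      TensorAlgebra.lift ℂ leftMulD t w ∈ degree A (k + l) := by
  induction ht using Submodule.pow_induction_on_left' with
  | algebraMap r =>
      intro l w h
      rw [AlgHom.commutes, Algebra.algebraMap_eq_smul_one, zero_add]
      exact Submodule.smul_mem _ _ h
  | add x y i hx hy h1 h2 =>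
      intro l w h
      rw [map_add, LinearMap.add_apply]
      exact add_mem (h1 h) (h2 h)
  | mem_mul m hm i x hx ih =>
      intro l w h
      obtain ⟨v, rfl⟩ := hm
      obtain ⟨a, ha⟩ := bar_surj v
      rw [ha, map_mul, lift_bar, Module.End.mul_apply, LinearMap.sub_apply, Module.End.mul_apply,
        Module.End.mul_apply]
      have h' := ih h
      have e : i.succ + l = i + l + 1 := by omega
      rw [e]
      exact sub_mem (d_mem (leftMul_mem _ h')) (leftMul_mem _ (d_mem h'))

instance : SetLike.GradedMonoid (degree A) where
  one_mem := mk_mem_degree 1 (by rw [pow_zero]; exact Submodule.one_le.mp le_rfl)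
  mul_mem := by
    intro k l α β hα hβ
    rw [mul_def]
    induction hα using Submodule.span_induction with
    | mem x hx =>
        obtain ⟨a, t, ht, rfl⟩ := hx
        rw [mulHom_mk]
        exact leftMul_mem _ (lift_mem ht hβ)
    | zero => simp
    | add x y _ _ hx hy => rw [map_add]; exact add_mem hx hy
    | smul r x _ hx => rw [map_smul]; exact Submodule.smul_mem _ _ hx

variable (A) in
/-- The projections onto the homogeneous components. -/
def decomposeAux : NCForm A →ₗ[ℂ] ⨁ k, degree A k :=
  liftLin
    { toFun := fun a =>
        (DirectSum.toModule ℂ ℕ _ fun k =>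
          DirectSum.lof ℂ ℕ (fun k => degree A k) k ∘ₗ
            (((mkLin a).comp (Submodule.subtype
              (LinearMap.range (TensorAlgebra.ι ℂ (M := Bar A)) ^ k))).codRestrict (degree A k)
                fun t => mk_mem_degree a t.2)) ∘ₗ
        (DirectSum.decomposeLinearEquiv
          (fun k : ℕ => LinearMap.range (TensorAlgebra.ι ℂ (M := Bar A)) ^ k)).toLinearMap
      map_add' := fun a b => by
        rw [← LinearMap.add_comp]
        congr 1
        ext k x : 2
        simp only [LinearMap.comp_apply, LinearMap.add_apply, DirectSum.toModule_lof, ← map_add]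
        congr 1
        ext
        exact LinearMap.congr_fun (map_add mkLin a b) x.1
      map_smul' := fun r a => by
        rw [RingHom.id_apply, ← LinearMap.smul_comp]
        congr 1
        ext k x : 2
        simp only [LinearMap.comp_apply, LinearMap.smul_apply, DirectSum.toModule_lof, ← map_smul]
        congr 1
        ext
        exact (LinearMap.congr_fun (map_smul mkLin r a) x.1).trans
          (map_smul (mkLin a) r x.1).symm }

lemma decomposeAux_mk (k : ℕ) (a : A) (t : TensorAlgebra ℂ (Bar A))
    (ht : t ∈ LinearMap.range (TensorAlgebra.ι ℂ (M := Bar A)) ^ k) :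
    decomposeAux A (mk a t) = DirectSum.lof ℂ ℕ (fun k => degree A k) k
      ⟨mk a t, mk_mem_degree a ht⟩ := by
  simp only [decomposeAux, liftLin_mk, LinearMap.coe_mk, AddHom.coe_mk, LinearMap.comp_apply,
    LinearEquiv.coe_coe, DirectSum.decomposeLinearEquiv_apply]
  rw [DirectSum.decompose_of_mem _ ht]
  erw [DirectSum.toModule_lof]
  rfl

instance : GradedAlgebra (degree A) where
  toDecomposition := DirectSum.Decomposition.ofLinearMap _ (decomposeAux A)
    (by
      refine lin_ext fun a t => ?_
      induction t using DirectSum.Decomposition.inductionOn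
        (fun k : ℕ => LinearMap.range (TensorAlgebra.ι ℂ (M := Bar A)) ^ k) with
      | zero =>
          have h0 : mk a (0 : TensorAlgebra ℂ (Bar A)) = 0 := map_zero (mkLin a)
          rw [h0, map_zero, map_zero]
      | homogeneous t =>
          rw [LinearMap.comp_apply, decomposeAux_mk _ _ _ t.2]
          simp
      | add s t hs ht =>
          simp only [← mkLin_apply, map_add] at hs ht ⊢
          rw [hs, ht])
    (by
      ext k x : 2
      obtain ⟨x, hx⟩ := x
      simp only [LinearMap.comp_apply, DirectSum.coeLinearMap_lof, LinearMap.id_apply]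
      induction hx using Submodule.span_induction with
      | mem x hx =>
          obtain ⟨a, t, ht, rfl⟩ := hx
          exact decomposeAux_mk k a t ht
      | zero => rw [map_zero]; exact (map_zero _).symm
      | add x y hx' hy' hx hy => rw [map_add, hx, hy, ← map_add]; rfl
      | smul r x hx' hx => rw [map_smul, hx, ← map_smul]; rfl)

/-- The inclusion `A → Ω_* A` in degree zero. -/
def incl : A →ₗ[ℂ] NCForm A := mkLin.flip 1

lemma leibniz_incl (a : A) (w : NCForm A) : d A (incl a * w) = d A (incl a) * w + incl a * d A w := by
  simp [incl, mul_def, leftMul_one, lift_bar]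

end NCForm

end NCForms

/-! ### Group cochains and the associated cyclic cochains -/

section GroupCochains

variable (Γ : Type*) [Group Γ]

/-- The space `C^n_al(Γ)` of left invariant alternating functions `Γ^{n+1} → ℂ`. -/
def altCochains (n : ℕ) : Submodule ℂ ((Fin (n + 1) → Γ) → ℂ) where
  carrier := {τ | (∀ (g : Γ) (v : Fin (n + 1) → Γ), τ (fun i => g * v i) = τ v) ∧
    ∀ (s : Equiv.Perm (Fin (n + 1))) (v : Fin (n + 1) → Γ),
      τ (v ∘ s) = ((Equiv.Perm.sign s : ℤ) : ℂ) * τ v}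
  add_mem' := by
    rintro a b ⟨ha, ha'⟩ ⟨hb, hb'⟩
    exact ⟨fun g v => by simp [ha, hb], fun s v => by simp [ha', hb', mul_add]⟩
  zero_mem' := ⟨fun _ _ => rfl, fun _ _ => by simp⟩
  smul_mem' := by
    rintro c a ⟨ha, ha'⟩
    exact ⟨fun g v => by simp [ha], fun s v => by simp [ha', mul_left_comm]⟩

variable {Γ}

/-- The coboundary `(d_Γ τ)(g₀, …, g_{n+1}) = ∑ⱼ (-1)ʲ τ(g₀, …, ĝⱼ, …, g_{n+1})`. -/
def groupCoboundary {n : ℕ} (τ : (Fin (n + 1) → Γ) → ℂ) : (Fin (n + 2) → Γ) → ℂ :=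
  fun g => ∑ j : Fin (n + 2), (-1) ^ (j : ℕ) * τ (fun i => g (j.succAbove i))

/-- The value of `c_τ` on `(g₀, g₁, …, gₖ)`, where `w = [g₁, …, gₖ]`: it is
`τ(e, g₁, g₁g₂, …, g₁⋯gₙ)` if `k = n` and `g₀g₁⋯gₙ = e`, and zero otherwise. -/
def cyclicCochainAux {n : ℕ} (τ : (Fin (n + 1) → Γ) → ℂ) (g₀ : Γ) (w : List Γ) : ℂ :=
  open Classical in
  if w.length = n ∧ g₀ * w.prod = 1 then τ (fun i => (w.take i).prod) else 0

open NCForm in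
/-- The linear map `ℂΓ/ℂ → ℂΓ` which sends the class of `g ≠ e` to `g` and the class of `e` to `0`,
for the computation of normalized cochains. -/
def barSection : Bar (MonoidAlgebra ℂ Γ) →ₗ[ℂ] MonoidAlgebra ℂ Γ :=
  Submodule.liftQ _
    (LinearMap.id - LinearMap.toSpanSingleton ℂ (MonoidAlgebra ℂ Γ) 1 ∘ₗ
      (MonoidAlgebra.basis Γ ℂ).coord 1)
    (by
      rw [Submodule.span_singleton_le_iff_mem, LinearMap.mem_ker, MonoidAlgebra.one_def]
      have h := (MonoidAlgebra.basis Γ ℂ).repr_self 1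
      rw [MonoidAlgebra.basis_apply] at h
      simp [h])

/-- The normalized cyclic cochain `c_τ`, as a linear functional on `Ω_* ℂΓ`. It vanishes on forms
of degree `≠ n`; in degree `n` it is the composition of the quotient map
`ℂΓ ⊗ (ℂΓ/ℂ)^{⊗ n} → (ℂΓ/ℂ)^{⊗ n+1}` with the cochain `c_τ`. -/
def cyclicCochain {n : ℕ} (τ : (Fin (n + 1) → Γ) → ℂ) : NCForm (MonoidAlgebra ℂ Γ) →ₗ[ℂ] ℂ :=
  NCForm.liftLin
    (((MonoidAlgebra.basis Γ ℂ).constr ℂ fun g₀ =>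
        (MonoidAlgebra.basis Γ ℂ).tensorAlgebra.constr ℂ fun w =>
          cyclicCochainAux τ g₀ w.toList).compl₂
      (TensorAlgebra.lift ℂ (TensorAlgebra.ι ℂ ∘ₗ barSection)).toLinearMap)

open Classical in
lemma barSection_single (g : Γ) : barSection (Submodule.mkQ _ (MonoidAlgebra.single g (1 : ℂ))) =
    MonoidAlgebra.single g 1 - (if g = 1 then 1 else 0) := by
  have h := (MonoidAlgebra.basis Γ ℂ).repr_self g
  rw [MonoidAlgebra.basis_apply] at h
  simp [barSection, h, Finsupp.single_apply]

open Classical in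
/-- The value of `c_τ` on `g₀ dg₁ ⋯ dgₖ`. -/
lemma cyclicCochain_word {n : ℕ} {τ : (Fin (n + 1) → Γ) → ℂ} (hτ : τ ∈ altCochains Γ n) (g₀ : Γ)
    (w : List Γ) : cyclicCochain τ (NCForm.mk (MonoidAlgebra.single g₀ 1)
      (w.map fun g => NCForm.bar _ (MonoidAlgebra.single g (1 : ℂ))).prod) = cyclicCochainAux τ g₀ w := by
  have hb : ∀ w : List Γ, (MonoidAlgebra.basis Γ ℂ).tensorAlgebra (FreeMonoid.ofList w) =
      (w.map fun g => TensorAlgebra.ι ℂ (MonoidAlgebra.single g (1 : ℂ))).prod := by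
    intro w
    have hw : FreeAlgebra.basisFreeMonoid ℂ Γ (FreeMonoid.ofList w) =
        (w.map fun g => FreeAlgebra.ι ℂ g).prod := by
      change (FreeAlgebra.equivMonoidAlgebraFreeMonoid (R := ℂ)).symm
        (MonoidAlgebra.single (FreeMonoid.ofList w) 1) = _
      change MonoidAlgebra.lift ℂ (FreeAlgebra ℂ Γ) (FreeMonoid Γ) (FreeMonoid.lift (FreeAlgebra.ι ℂ)) _ = _
      rw [MonoidAlgebra.lift_single, one_smul, FreeMonoid.lift_apply]; rfl
    change (TensorAlgebra.equivFreeAlgebra (MonoidAlgebra.basis Γ ℂ)).symm (FreeAlgebra.basisFreeMonoid ℂ Γ (FreeMonoid.ofList w)) = _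
    rw [hw, map_list_prod, List.map_map]
    congr 1
    refine List.map_congr_left fun g _ => ?_
    rw [Function.comp_apply, TensorAlgebra.equivFreeAlgebra_symm_ι, MonoidAlgebra.basis_apply]
  have hl : ∀ w : List Γ, TensorAlgebra.lift ℂ (TensorAlgebra.ι ℂ ∘ₗ barSection)
      (w.map fun g => NCForm.bar _ (MonoidAlgebra.single g (1 : ℂ))).prod =
      if (1 : Γ) ∈ w then 0 else (MonoidAlgebra.basis Γ ℂ).tensorAlgebra (FreeMonoid.ofList w) := by
    intro w
    rw [hb]
    induction w with
    | nil => simp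
    | cons a w ih =>
      rw [List.map_cons, List.prod_cons, map_mul, ih, List.map_cons, List.prod_cons]
      rw [show NCForm.bar _ (MonoidAlgebra.single a (1 : ℂ)) =
        TensorAlgebra.ι ℂ (Submodule.mkQ _ (MonoidAlgebra.single a (1 : ℂ))) from rfl,
        TensorAlgebra.lift_ι_apply, LinearMap.comp_apply, barSection_single]
      by_cases ha : a = 1
      · subst ha; simp [MonoidAlgebra.one_def]
      · by_cases hw : (1 : Γ) ∈ w
        · simp [hw]
        · have : ¬ (1 = a) := fun h => ha h.symm
          simp [hw, ha, this]
  have h2 : ∀ t, cyclicCochain τ (NCForm.mk (MonoidAlgebra.single g₀ 1) t) =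
     ((MonoidAlgebra.basis Γ ℂ).tensorAlgebra.constr ℂ fun w =>
          cyclicCochainAux τ g₀ w.toList) (TensorAlgebra.lift ℂ (TensorAlgebra.ι ℂ ∘ₗ barSection) t) := by
    intro t
    rw [cyclicCochain, NCForm.liftLin_mk, ← MonoidAlgebra.basis_apply, LinearMap.compl₂_apply,
      Module.Basis.constr_basis]
    rfl
  rw [h2, hl]
  split_ifs with h1
  · rw [map_zero]
    symm
    unfold cyclicCochainAux
    split_ifs with hc
    swap
    · rfl
    obtain ⟨k, hk, hk1⟩ := List.getElem_of_mem h1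
    have hkn : k < n := hc.1 ▸ hk
    have hs := hτ.2 (Equiv.swap ⟨k, by omega⟩ ⟨k + 1, by omega⟩) (fun i => (w.take i).prod)
    rw [Equiv.Perm.sign_swap (by simp)] at hs
    have : (fun i : Fin (n + 1) => (w.take i).prod) ∘ Equiv.swap ⟨k, by omega⟩ ⟨k + 1, by omega⟩ = fun i : Fin (n + 1) => (w.take i).prod := by
      have e : (w.take (k+1)).prod = (w.take k).prod := by
        rw [List.take_succ_eq_append_getElem hk, hk1]; simp
      funext i
      simp only [Function.comp_apply]
      rcases eq_or_ne i ⟨k, by omega⟩ with rfl | h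
      · rw [Equiv.swap_apply_left]; exact e
      rcases eq_or_ne i ⟨k + 1, by omega⟩ with rfl | h'
      · rw [Equiv.swap_apply_right]; exact e.symm
      rw [Equiv.swap_apply_of_ne_of_ne h h']
    rw [this] at hs
    push_cast at hs
    linear_combination hs / 2
  · rw [Module.Basis.constr_basis]; rfl

end GroupCochains

/-! ### Differential forms on manifolds -/

section Forms

/-- The exterior algebra over `ℂ` of the complexified dual of a real vector space. -/
abbrev CotangentAlg (V : Type*) [AddCommGroup V] [Module ℝ V] [TopologicalSpace V] : Type _ :=
  ExteriorAlgebra ℂ (V →L[ℝ] ℂ)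

/-- The graded tensor product `Λ^*(V^* ⊗ ℂ) ⊗ Ω_* A`. -/
abbrev VForm (V : Type*) [AddCommGroup V] [Module ℝ V] [TopologicalSpace V]
    (A : Type*) [Ring A] [Algebra ℂ A] : Type _ :=
  (fun i : ℕ => ⋀[ℂ]^i (V →L[ℝ] ℂ)) ᵍ⊗[ℂ] (NCForm.degree A)

section Alt

variable {V : Type*} [AddCommGroup V] [Module ℝ V] [TopologicalSpace V]

/-- `φ₁ ∧ ⋯ ∧ φₙ` as an alternating form: `(v₁, …, vₙ) ↦ det (φᵢ (vⱼ))`. -/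
def wedgeEval (n : ℕ) : (V →L[ℝ] ℂ) [⋀^Fin n]→ₗ[ℂ] (V [⋀^Fin n]→L[ℝ] ℂ) :=
  let byCols (φ : Fin n → V →L[ℝ] ℂ) : V [⋀^Fin n]→ₗ[ℝ] ℂ :=
    { ((Matrix.detRowAlternating (n := Fin n) (R := ℂ)).toMultilinearMap.restrictScalars
        ℝ).compLinearMap (fun _ => LinearMap.pi fun i => (φ i).toLinearMap) with
      map_eq_zero_of_eq' := fun v i j hv hij =>
        Matrix.det_zero_of_row_eq hij (by ext k; simp [hv]) }
  let byRows (v : Fin n → V) : (V →L[ℝ] ℂ) [⋀^Fin n]→ₗ[ℂ] ℂ :=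
    (Matrix.detRowAlternating (n := Fin n) (R := ℂ)).compLinearMap
      (LinearMap.pi fun j =>
        { toFun := fun f => f (v j), map_add' := fun _ _ => rfl, map_smul' := fun _ _ => rfl })
  have hc : ∀ φ v, byCols φ v = Matrix.det (Matrix.of fun i j => φ i (v j)) :=
    fun φ v => by rw [← Matrix.det_transpose]; rfl
  { toFun := fun φ =>
      { toFun := fun v => Matrix.det (Matrix.of fun i j => φ i (v j))
        map_update_add' := fun v j x y => by
          simp only [← hc]; exact (byCols φ).map_update_add v j x y
        map_update_smul' := fun v j c x => by
          simp only [← hc]; exact (byCols φ).map_update_smul v j c x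
        map_eq_zero_of_eq' := fun v i j hv hij => by
          simp only [← hc]; exact (byCols φ).map_eq_zero_of_eq v hv hij
        cont := Continuous.matrix_det <| continuous_pi fun i => continuous_pi fun j =>
          (φ i).continuous.comp (continuous_apply j) }
    map_update_add' := fun φ i x y => by
      ext v; exact (byRows v).map_update_add φ i x y
    map_update_smul' := fun φ i c x => by
      ext v; exact (byRows v).map_update_smul φ i c x
    map_eq_zero_of_eq' := fun φ i j hφ hij => by
      ext v; exact (byRows v).map_eq_zero_of_eq φ hφ hij }

/-- The component of degree `n` of an element of `Λ^*(V^* ⊗ ℂ)`, as an alternating form. -/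
def CotangentAlg.alt (n : ℕ) : CotangentAlg V →ₗ[ℂ] (V [⋀^Fin n]→L[ℝ] ℂ) :=
  ExteriorAlgebra.liftAlternating (Pi.single n (wedgeEval n))

/-- Pullback of elements of `Λ^*(W^* ⊗ ℂ)` along a linear map `V → W`. -/
def CotangentAlg.comap {W : Type*} [AddCommGroup W] [Module ℝ W] [TopologicalSpace W]
    (L : V →L[ℝ] W) : CotangentAlg W →ₐ[ℂ] CotangentAlg V :=
  ExteriorAlgebra.map
    { toFun := fun φ => φ.comp L
      map_add' := fun _ _ => rfl
      map_smul' := fun _ _ => rfl }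

/-- The elements `α ⊗ β` of `Λ^*(V^* ⊗ ℂ) ⊗ Ω_* A`, as a bilinear map. -/
def VForm.mk {A : Type*} [Ring A] [Algebra ℂ A] :
    CotangentAlg V →ₗ[ℂ] NCForm A →ₗ[ℂ] VForm V A :=
  (TensorProduct.mk ℂ _ _).compr₂
    (GradedTensorProduct.of ℂ (fun i : ℕ => ⋀[ℂ]^i (V →L[ℝ] ℂ)) (NCForm.degree A)).toLinearMap

/-- The map `Λ^*(V^* ⊗ ℂ) ⊗ Ω_* A → Λ^*(V^* ⊗ ℂ)`, `α ⊗ β ↦ f(β) α`, for a functional `f`. -/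
def VForm.pair {A : Type*} [Ring A] [Algebra ℂ A] (f : NCForm A →ₗ[ℂ] ℂ) :
    VForm V A →ₗ[ℂ] CotangentAlg V :=
  (TensorProduct.rid ℂ _).toLinearMap ∘ₗ (LinearMap.lTensor _ f) ∘ₗ
    (GradedTensorProduct.of ℂ (fun i : ℕ => ⋀[ℂ]^i (V →L[ℝ] ℂ)) (NCForm.degree A)).symm.toLinearMap

end Alt

variable {E : Type*} [NormedAddCommGroup E] [NormedSpace ℝ E]

section Manifold

variable (E) (M : Type*) [TopologicalSpace M] [ChartedSpace E M]

/-- Complex valued (inhomogeneous) differential forms on `M`, without regularity assumption. -/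
abbrev MForm : Type _ := ∀ x : M, CotangentAlg (TangentSpace 𝓘(ℝ, E) x)

/-- Differential forms on `M` with values in `Ω_* A`, without regularity assumption. -/
abbrev MVForm (A : Type*) [Ring A] [Algebra ℂ A] : Type _ :=
  ∀ x : M, VForm (TangentSpace 𝓘(ℝ, E) x) A

/-- The algebra `C^∞(M)` of smooth complex valued functions. -/
def smoothFunctions : Subalgebra ℂ (M → ℂ) where
  carrier := {f | ContMDiff 𝓘(ℝ, E) 𝓘(ℝ, ℂ) ∞ f}
  mul_mem' := fun ha hb => by
    have : ContDiff ℝ ∞ (fun p : ℂ × ℂ => p.1 * p.2) := contDiff_fst.mul contDiff_snd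
    exact this.contMDiff.comp (ha.prodMk_space hb)
  add_mem' := fun ha hb => ContMDiff.add ha hb
  algebraMap_mem' := fun c => contMDiff_const

variable {M}

/-- The differential of a complex valued function. -/
def MForm.dFun (f : M → ℂ) : MForm E M :=
  fun x => ExteriorAlgebra.ι ℂ (mvfderiv 𝓘(ℝ, E) f x)

variable {E}

lemma mvfderiv_add_smooth (f g : smoothFunctions E M) (x : M) :
    mvfderiv 𝓘(ℝ, E) (f.1 + g.1) x
      = mvfderiv 𝓘(ℝ, E) f.1 x + mvfderiv 𝓘(ℝ, E) g.1 x :=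
  mvfderiv_add (f.2.mdifferentiableAt (by simp)) (g.2.mdifferentiableAt (by simp))

lemma mvfderiv_smul_smooth (c : ℂ) (f : smoothFunctions E M) (x : M) :
    mvfderiv 𝓘(ℝ, E) (c • f.1) x = c • mvfderiv 𝓘(ℝ, E) f.1 x := by
  have hf : MDifferentiableAt 𝓘(ℝ, E) 𝓘(ℝ, ℂ) f.1 x := f.2.mdifferentiableAt (by simp)
  let L : ℂ →L[ℝ] ℂ := c • ContinuousLinearMap.id ℝ ℂ
  have h1 : HasMFDerivAt 𝓘(ℝ, E) 𝓘(ℝ, ℂ) (L ∘ f.1) x (L.comp (mfderiv 𝓘(ℝ, E) 𝓘(ℝ, ℂ) f.1 x)) :=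
    HasMFDerivAt.comp x L.hasMFDerivAt hf.hasMFDerivAt
  have h2 : c • f.1 = L ∘ f.1 := by ext; simp [L]
  rw [mvfderiv, mvfderiv, h2, h1.mfderiv]
  ext v
  rfl

variable {A : Type*} [Ring A] [Algebra ℂ A]

/-- The inclusion `C^∞(M) ⊗ A → Ω^*(M) ⊗ Ω_* A` in bidegree `(0, 0)`. -/
def inclTot : smoothFunctions E M ⊗[ℂ] A →ₗ[ℂ] MVForm E M A :=
  TensorProduct.lift
    { toFun := fun f =>
        { toFun := fun a x => f.1 x • VForm.mk 1 (NCForm.incl a)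
          map_add' := fun a b => by funext x; simp
          map_smul' := fun c a => by funext x; simp [smul_comm (f.1 x) c] }
      map_add' := fun f g => by ext a x; simp [add_smul]
      map_smul' := fun c f => by ext a x; simp [mul_smul] }

/-- The total differential `d_tot = d_M + d` on `C^∞(M) ⊗ A`:
`d_tot (f ⊗ a) = d_M f ⊗ a + f ⊗ d a`. -/
def dTot : smoothFunctions E M ⊗[ℂ] A →ₗ[ℂ] MVForm E M A :=
  TensorProduct.lift
    { toFun := fun f =>
        { toFun := fun a x => VForm.mk (MForm.dFun E f.1 x) (NCForm.incl a)
            + f.1 x • VForm.mk 1 (NCForm.d A (NCForm.incl a))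
          map_add' := fun a b => by funext x; simp; abel
          map_smul' := fun c a => by funext x; simp [smul_comm (f.1 x) c] }
      map_add' := fun f g => by
        ext a x
        simp [add_smul, MForm.dFun, mvfderiv_add_smooth]; abel
      map_smul' := fun c f => by
        ext a x
        simp [mul_smul, MForm.dFun, mvfderiv_smul_smooth] }

/-- The Chern character form
`ch(P) = ∑ₖ (-1)ᵏ / ((2πi)ᵏ k!) tr P (d_tot P)²ᵏ` of a matrix `P` over `C^∞(M) ⊗ A`. It is an element
of the product over all total degrees; the `k`-th entry is the component of total degree `2k`. -/
def chernForm {κ : Type*} [Fintype κ] [DecidableEq κ]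
    (P : Matrix κ κ (smoothFunctions E M ⊗[ℂ] A)) : ℕ → MVForm E M A :=
  fun k => ((-1) ^ k / ((2 * Real.pi * Complex.I) ^ k * k.factorial) : ℂ) •
    Matrix.trace (P.map inclTot * (P.map dTot) ^ (2 * k))

/-- Application of a linear functional on `Ω_* A` to an element of the product over all total
degrees of the spaces of `Ω_* A`-valued forms on `M`. The functionals of interest vanish outside
of a single degree of `Ω_* A`, and then the sum at each point is finite. -/
def pairForm (f : NCForm A →ₗ[ℂ] ℂ) (c : ℕ → MVForm E M A) : MForm E M :=
  fun x => ∑ᶠ k : ℕ, VForm.pair f (c k x)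

/-- Pullback of differential forms. -/
def MForm.pullback {N : Type*} [TopologicalSpace N] [ChartedSpace E N] (F : N → M)
    (w : MForm E M) : MForm E N :=
  fun y => CotangentAlg.comap (mfderiv 𝓘(ℝ, E) 𝓘(ℝ, E) F y) (w (F y))

/-- The component of degree `n` of a form, in the chart around `x₀`. -/
def MForm.inChart (n : ℕ) (w : MForm E M) (x₀ : M) : E → E [⋀^Fin n]→L[ℝ] ℂ :=
  fun z => (CotangentAlg.alt n (w ((extChartAt 𝓘(ℝ, E) x₀).symm z))).compContinuousLinearMap
    (mfderiv 𝓘(ℝ, E) 𝓘(ℝ, E) (extChartAt 𝓘(ℝ, E) x₀).symm z)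

/-- Smoothness of a form. -/
def MForm.IsSmooth (w : MForm E M) : Prop :=
  ∀ (n : ℕ) (x₀ : M), ContDiffOn ℝ ∞ (w.inChart n x₀) (extChartAt 𝓘(ℝ, E) x₀).target

/-- Closedness of a form: its exterior derivative vanishes in all charts. -/
def MForm.IsClosed (w : MForm E M) : Prop :=
  ∀ (n : ℕ) (x₀ : M), ∀ z ∈ (extChartAt 𝓘(ℝ, E) x₀).target, extDeriv (w.inChart n x₀) z = 0

end Manifold

end Forms

/-! ### Cohomology of families of sets with face maps -/

/-- A graded family of sets with face maps `∂ᵢ : Xₙ₊₁ → Xₙ`, `0 ≤ i ≤ n + 1`. -/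
structure FaceFamily where
  obj : ℕ → Type*
  face : ∀ n, Fin (n + 2) → obj (n + 1) → obj n

namespace FaceFamily

/-- The coboundary `(δ c)(σ) = ∑ᵢ (-1)ⁱ c(∂ᵢ σ)` of complex valued cochains. -/
def coboundary (X : FaceFamily) (n : ℕ) : (X.obj n → ℂ) →ₗ[ℂ] (X.obj (n + 1) → ℂ) where
  toFun c := fun s => ∑ i : Fin (n + 2), (-1) ^ (i : ℕ) * c (X.face n i s)
  map_add' a b := by funext s; simp [mul_add, Finset.sum_add_distrib]
  map_smul' r a := by funext s; simp [Finset.mul_sum, mul_left_comm]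

/-- The cocycles of degree `n`. -/
def cocycles (X : FaceFamily) (n : ℕ) : Submodule ℂ (X.obj n → ℂ) :=
  LinearMap.ker (X.coboundary n)

/-- The coboundaries of degree `n`. -/
def coboundaries (X : FaceFamily) : ∀ n : ℕ, Submodule ℂ (X.obj n → ℂ)
  | 0 => ⊥
  | n + 1 => LinearMap.range (X.coboundary n)

/-- The cohomology of degree `n` with complex coefficients. -/
abbrev Cohomology (X : FaceFamily) (n : ℕ) : Type _ :=
  X.cocycles n ⧸ (X.coboundaries n).submoduleOf (X.cocycles n)

/-- The cohomology class of a cocycle. -/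
def toClass (X : FaceFamily) {n : ℕ} (c : X.obj n → ℂ) (hc : c ∈ X.cocycles n) :
    X.Cohomology n :=
  Submodule.Quotient.mk ⟨c, hc⟩

/-- The map induced in cohomology by maps which are compatible with the face maps. -/
def pullback {X Y : FaceFamily} (f : ∀ n, X.obj n → Y.obj n)
    (hf : ∀ n i s, f n (X.face n i s) = Y.face n i (f (n + 1) s)) (n : ℕ) :
    Y.Cohomology n →ₗ[ℂ] X.Cohomology n :=
  have key : ∀ (m : ℕ) (c : Y.obj m → ℂ),
      X.coboundary m (c ∘ f m) = Y.coboundary m c ∘ f (m + 1) := fun m c => by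
    funext s; simp [coboundary, hf]
  Submodule.mapQ _ _
    ((LinearMap.funLeft ℂ ℂ (f n)).restrict (p := Y.cocycles n) (q := X.cocycles n)
      (fun c hc => by
        have hc' : Y.coboundary n c = 0 := hc
        change X.coboundary n (c ∘ f n) = 0
        rw [key, hc']; rfl))
    (by
      rintro ⟨c, hc⟩ h
      change c ∘ f n ∈ X.coboundaries n
      have h' : c ∈ Y.coboundaries n := h
      cases n with
      | zero =>
          have : c = 0 := h'
          subst this
          exact Submodule.zero_mem _
      | succ m =>
          obtain ⟨b, rfl⟩ := h'
          exact ⟨b ∘ f m, key m b⟩)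

end FaceFamily

/-! ### Singular cohomology and smooth singular cohomology -/

section Singular

/-- The `i`-th face inclusion `Δⁿ → Δⁿ⁺¹`. -/
def simplexFace (n : ℕ) (i : Fin (n + 2)) :
    C(stdSimplex ℝ (Fin (n + 1)), stdSimplex ℝ (Fin (n + 2))) :=
  ⟨stdSimplex.map i.succAbove, stdSimplex.continuous_map _⟩

/-- The singular simplices of a topological space. -/
def singularSimplices (X : Type*) [TopologicalSpace X] : FaceFamily where
  obj n := C(stdSimplex ℝ (Fin (n + 1)), X)
  face n i s := s.comp (simplexFace n i)

/-- The singular cohomology `H^n(X; ℂ)`. -/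
abbrev SingularCohomology (X : Type*) [TopologicalSpace X] (n : ℕ) : Type _ :=
  (singularSimplices X).Cohomology n

/-- The map `f^* : H^n(Y; ℂ) → H^n(X; ℂ)` induced by a continuous map `f : X → Y`. -/
def SingularCohomology.map {X Y : Type*} [TopologicalSpace X] [TopologicalSpace Y] (f : C(X, Y))
    (n : ℕ) : SingularCohomology Y n →ₗ[ℂ] SingularCohomology X n :=
  FaceFamily.pullback (X := singularSimplices X) (Y := singularSimplices Y)
    (fun _ s => f.comp s) (fun _ _ _ => rfl) n

section Smooth

variable {E : Type*} [NormedAddCommGroup E] [NormedSpace ℝ E]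

variable (E) in
/-- A singular simplex is smooth if it extends to a smooth map on an open neighbourhood of the
standard simplex `Δⁿ ⊆ ℝⁿ⁺¹`. -/
def IsSmoothSimplex {M : Type*} [TopologicalSpace M] [ChartedSpace E M] {n : ℕ}
    (s : C(stdSimplex ℝ (Fin (n + 1)), M)) : Prop :=
  ∃ (W : Set (Fin (n + 1) → ℝ)) (F : (Fin (n + 1) → ℝ) → M), IsOpen W ∧
    stdSimplex ℝ (Fin (n + 1)) ⊆ W ∧ ContMDiffOn 𝓘(ℝ, Fin (n + 1) → ℝ) 𝓘(ℝ, E) ∞ F W ∧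
    ∀ t : stdSimplex ℝ (Fin (n + 1)), F t.1 = s t

lemma IsSmoothSimplex.face {M : Type*} [TopologicalSpace M] [ChartedSpace E M] {n : ℕ}
    {s : C(stdSimplex ℝ (Fin (n + 2)), M)} (hs : IsSmoothSimplex E s) (i : Fin (n + 2)) :
    IsSmoothSimplex E (s.comp (simplexFace n i)) := by
  obtain ⟨W, F, hW, hsub, hF, hFs⟩ := hs
  let L : (Fin (n + 1) → ℝ) →L[ℝ] (Fin (n + 2) → ℝ) :=
    (FunOnFinite.linearMap ℝ ℝ i.succAbove).toContinuousLinearMap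
  have hL : ∀ t : stdSimplex ℝ (Fin (n + 1)), L t.1 = (simplexFace n i t).1 := fun t => rfl
  refine ⟨L ⁻¹' W, F ∘ L, hW.preimage L.continuous, fun t ht => ?_, ?_, fun t => ?_⟩
  · change L t ∈ W
    rw [show L t = (simplexFace n i ⟨t, ht⟩).1 from hL ⟨t, ht⟩]
    exact hsub (simplexFace n i ⟨t, ht⟩).2
  · exact hF.comp L.contDiff.contMDiff.contMDiffOn (fun _ h => h)
  · change F (L t.1) = s (simplexFace n i t)
    rw [hL, hFs]

variable (E) in
/-- The smooth singular simplices of a manifold. -/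
def smoothSimplices (M : Type*) [TopologicalSpace M] [ChartedSpace E M] : FaceFamily where
  obj n := {s : C(stdSimplex ℝ (Fin (n + 1)), M) // IsSmoothSimplex E s}
  face n i s := ⟨s.1.comp (simplexFace n i), s.2.face i⟩

variable (E) in
/-- The restriction of singular cochains to smooth singular simplices, in cohomology. -/
def restrictToSmooth (M : Type*) [TopologicalSpace M] [ChartedSpace E M] (n : ℕ) :
    SingularCohomology M n →ₗ[ℂ] (smoothSimplices E M).Cohomology n :=
  FaceFamily.pullback (X := smoothSimplices E M) (Y := singularSimplices M)
    (fun _ s => s.1) (fun _ _ _ => rfl) n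

/-- The simplex `{t ∈ ℝⁿ | tᵢ ≥ 0, ∑ tᵢ ≤ 1}`. -/
def cornerSimplex (n : ℕ) : Set (Fin n → ℝ) := {t | (∀ i, 0 ≤ t i) ∧ ∑ i, t i ≤ 1}

open Classical in
/-- The parametrization `(t₁, …, tₙ) ↦ (1 - ∑ tᵢ, t₁, …, tₙ)` of `Δⁿ` (extended by a constant
outside of the simplex). -/
def cornerToStd {n : ℕ} (t : Fin n → ℝ) : stdSimplex ℝ (Fin (n + 1)) :=
  if h : t ∈ cornerSimplex n then
    ⟨Fin.cons (1 - ∑ i, t i) t, by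
      refine ⟨fun i => ?_, ?_⟩
      · refine Fin.cases ?_ (fun j => ?_) i
        · simpa using h.2
        · simpa using h.1 j
      · rw [Fin.sum_univ_succ]; simp⟩
  else stdSimplex.vertex 0

/-- The integral `∫_s w` of (the component of degree `n` of) a form over a singular simplex. -/
def MForm.integral {M : Type*} [TopologicalSpace M] [ChartedSpace E M] (w : MForm E M) {n : ℕ}
    (s : C(stdSimplex ℝ (Fin (n + 1)), M)) : ℂ :=
  ∫ t in cornerSimplex n, CotangentAlg.alt n (w (s (cornerToStd t))) fun j =>
    mfderivWithin 𝓘(ℝ, Fin n → ℝ) 𝓘(ℝ, E) (fun u => s (cornerToStd u)) (cornerSimplex n) t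
      (Pi.single j (1 : ℝ) : Fin n → ℝ)

/-- The smooth singular cochain `s ↦ ∫_s w`. -/
def MForm.integralCochain {M : Type*} [TopologicalSpace M] [ChartedSpace E M] (w : MForm E M)
    (n : ℕ) : (smoothSimplices E M).obj n → ℂ :=
  fun s => w.integral s.1

/-- `w` is a smooth closed form of degree `n`, and the isomorphism of de Rham cohomology and singular
cohomology maps its class to the class `c`. The isomorphism is given by integration of forms over
smooth simplices and by the isomorphism of singular and smooth singular cohomology. -/
def MForm.HasClass {M : Type*} [TopologicalSpace M] [ChartedSpace E M] {n : ℕ} (w : MForm E M)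
    (c : SingularCohomology M n) : Prop :=
  w.IsSmooth ∧ w.IsClosed ∧ (∀ x, w x ∈ ⋀[ℂ]^n (TangentSpace 𝓘(ℝ, E) x →L[ℝ] ℂ)) ∧
  ∃ h : w.integralCochain n ∈ (smoothSimplices E M).cocycles n,
    (smoothSimplices E M).toClass (w.integralCochain n) h = restrictToSmooth E M n c

end Smooth

end Singular

/-! ### Classifying spaces and classifying maps -/

section Classifying

open MulOpposite

variable {Γ : Type*} [Group Γ] {T B : Type*} [TopologicalSpace T] [TopologicalSpace B]
  [MulAction Γᵐᵒᵖ T] {p : T → B}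

/-- A set theoretic trivialization of a covering `p : T → B` with right action of `Γ`: after the
choice of a point in each fiber, `y · orbitCoord y` is the chosen point in the fiber of `y`. -/
def orbitCoord (hp : IsQuotientCoveringMap p Γᵐᵒᵖ) (y : T) : Γ :=
  unop (hp.apply_eq_iff_mem_orbit.mp (Function.surjInv_eq hp.surjective (p y))).choose

lemma orbitCoord_spec (hp : IsQuotientCoveringMap p Γᵐᵒᵖ) (y : T) :
    op (orbitCoord hp y) • y = Function.surjInv hp.surjective (p y) :=
  (hp.apply_eq_iff_mem_orbit.mp (Function.surjInv_eq hp.surjective (p y))).choose_spec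

lemma orbitCoord_smul (hp : IsQuotientCoveringMap p Γᵐᵒᵖ) (g : Γ) (y : T) :
    orbitCoord hp (op g • y) = g⁻¹ * orbitCoord hp y := by
  have := hp.isCancelSMul
  have h1 := orbitCoord_spec hp (op g • y)
  rw [hp.map_smul, ← orbitCoord_spec hp y, smul_smul, ← op_mul] at h1
  have h2 := op_injective (IsCancelSMul.right_cancel _ _ _ h1)
  rw [← h2, inv_mul_cancel_left]

lemma exists_lift_simplex (hp : IsQuotientCoveringMap p Γᵐᵒᵖ) {n : ℕ}
    (s : C(stdSimplex ℝ (Fin (n + 1)), B)) :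
    ∃ s' : C(stdSimplex ℝ (Fin (n + 1)), T), ∀ t, p (s' t) = s t := by
  have cov := hp.isCoveringMap
  let v : stdSimplex ℝ (Fin (n + 1)) := stdSimplex.vertex 0
  let K : C(unitInterval × stdSimplex ℝ (Fin (n + 1)), stdSimplex ℝ (Fin (n + 1))) :=
    { toFun := fun q => ⟨(1 - q.1.1) • v.1 + q.1.1 • q.2.1,
        convex_stdSimplex ℝ _ v.2 q.2.2 (by linarith [q.1.2.2]) q.1.2.1 (by ring)⟩
      continuous_toFun := by
        refine Continuous.subtype_mk ?_ _
        fun_prop }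
  obtain ⟨e, he⟩ := hp.surjective (s v)
  have h0 : ∀ a, (s.comp K) (0, a) = p ((ContinuousMap.const _ e) a) := by
    intro a
    have : K (0, a) = v := by apply Subtype.ext; simp [K]
    simp [this, he]
  refine ⟨(cov.liftHomotopy (s.comp K) (ContinuousMap.const _ e) h0).comp
    ⟨fun a => ((1 : unitInterval), a), by fun_prop⟩, fun t => ?_⟩
  have h1 := congr_fun (cov.liftHomotopy_lifts (s.comp K) (ContinuousMap.const _ e) h0) (1, t)
  have h2 : K (1, t) = t := by apply Subtype.ext; simp [K]
  simp only [Function.comp_apply, ContinuousMap.comp_apply, h2] at h1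
  exact h1

/-- A lift to `T` of a singular simplex of `B`. -/
def liftSimplex (hp : IsQuotientCoveringMap p Γᵐᵒᵖ) {n : ℕ}
    (s : C(stdSimplex ℝ (Fin (n + 1)), B)) : C(stdSimplex ℝ (Fin (n + 1)), T) :=
  (exists_lift_simplex hp s).choose

lemma liftSimplex_spec (hp : IsQuotientCoveringMap p Γᵐᵒᵖ) {n : ℕ}
    (s : C(stdSimplex ℝ (Fin (n + 1)), B)) (t) : p (liftSimplex hp s t) = s t :=
  (exists_lift_simplex hp s).choose_spec t

/-- The singular cochain on `B` defined by a group cochain `τ`, namely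
`s ↦ τ(r(s'(e₀)), …, r(s'(eₙ)))`, where `s'` is a lift of `s` to `T`, where `e₀, …, eₙ` are the
vertices of `Δⁿ`, and where `r : T → Γ` satisfies `r(y · g) = g⁻¹ r(y)`. -/
def groupToSingular (hp : IsQuotientCoveringMap p Γᵐᵒᵖ) {n : ℕ} (τ : (Fin (n + 1) → Γ) → ℂ) :
    (singularSimplices B).obj n → ℂ :=
  fun s => τ fun i => orbitCoord hp (liftSimplex hp s (stdSimplex.vertex i))

lemma groupToSingular_eq (hp : IsQuotientCoveringMap p Γᵐᵒᵖ) {n : ℕ}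
    {τ : (Fin (n + 1) → Γ) → ℂ} (hτ : τ ∈ altCochains Γ n)
    (s : C(stdSimplex ℝ (Fin (n + 1)), B)) (s' : C(stdSimplex ℝ (Fin (n + 1)), T))
    (hs : ∀ t, p (s' t) = s t) :
    groupToSingular hp τ s = τ fun i => orbitCoord hp (s' (stdSimplex.vertex i)) := by
  have := hp.toContinuousConstSMul
  obtain ⟨g, hg⟩ := hp.apply_eq_iff_mem_orbit.mp
    ((liftSimplex_spec hp s (stdSimplex.vertex 0)).trans (hs (stdSimplex.vertex 0)).symm)
  have h : ⇑(liftSimplex hp s) = fun t => g • s' t := by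
    refine hp.isCoveringMap.eq_of_comp_eq (liftSimplex hp s).continuous
      (s'.continuous.const_smul g) ?_ (stdSimplex.vertex 0) hg.symm
    funext t
    simp only [Function.comp_apply, hp.map_smul, liftSimplex_spec, hs]
  unfold groupToSingular
  rw [h]
  have h2 : ∀ y, orbitCoord hp (g • y) = (unop g)⁻¹ * orbitCoord hp y :=
    fun y => orbitCoord_smul hp (unop g) y
  simp only [h2]
  exact hτ.1 _ _

lemma groupToSingular_mem (hp : IsQuotientCoveringMap p Γᵐᵒᵖ) {n : ℕ}
    {τ : (Fin (n + 1) → Γ) → ℂ} (hτ : τ ∈ altCochains Γ n) (hd : groupCoboundary τ = 0) :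
    groupToSingular hp τ ∈ (singularSimplices B).cocycles n := by
  change (singularSimplices B).coboundary n _ = 0
  funext s
  have h := congr_fun hd fun i => orbitCoord hp (liftSimplex hp s (stdSimplex.vertex i))
  change ∑ i : Fin (n + 2), (-1) ^ (i : ℕ) *
    groupToSingular hp τ (ContinuousMap.comp s (simplexFace n i)) = 0
  refine Eq.trans (Finset.sum_congr rfl fun j _ => ?_) h
  rw [groupToSingular_eq hp hτ (ContinuousMap.comp s (simplexFace n j))
    ((liftSimplex hp s).comp (simplexFace n j))
    (fun t => liftSimplex_spec hp s (simplexFace n j t))]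
  congr 2
  funext i
  simp only [ContinuousMap.comp_apply, simplexFace, ContinuousMap.coe_mk, stdSimplex.map_vertex]

/-- The class in `H^n(B; ℂ)` of a group cocycle `τ`. For contractible `T` (i.e. `T = EΓ`, `B = BΓ`)
this is the image of `[τ]` under the isomorphism `H^n(Γ) ≅ H^n(BΓ)`: it is induced by
a `Γ`-equivariant augmentation preserving chain map from the singular complex of `EΓ` to the
standard resolution with `n`-th term spanned by `Γ^{n+1}`. -/
def groupClass (hp : IsQuotientCoveringMap p Γᵐᵒᵖ) {n : ℕ} {τ : (Fin (n + 1) → Γ) → ℂ}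
    (hτ : τ ∈ altCochains Γ n) (hd : groupCoboundary τ = 0) : SingularCohomology B n :=
  (singularSimplices B).toClass (groupToSingular hp τ) (groupToSingular_mem hp hτ hd)

/-- `ν : M → B` is a classifying map of the covering `π : M' → M` with respect to the principal
covering `p : T → B`: it is covered by a continuous `Γ`-equivariant map `M' → T`. -/
def IsClassifyingMap {M M' : Type*} [TopologicalSpace M] [TopologicalSpace M'] [MulAction Γᵐᵒᵖ M']
    (π : M' → M) (p : T → B) (ν : C(M, B)) : Prop :=
  ∃ F : C(M', T), (∀ (g : Γᵐᵒᵖ) (y : M'), F (g • y) = g • F y) ∧ ∀ y, p (F y) = ν (π y)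

end Classifying

/-! ### The projection defining the Mishchenko-Fomenko bundle and the forms of Lott -/

section Covering

open MulOpposite

variable (E : Type*) [NormedAddCommGroup E] [NormedSpace ℝ E]
  {M M' : Type*} [TopologicalSpace M] [ChartedSpace E M] [TopologicalSpace M'] [ChartedSpace E M']

/-- The data which enter the embedding of the Mishchenko-Fomenko bundle into a trivial bundle:
a finite open cover `(Uᵢ)` of `M` with connected (or empty) intersections `Uᵢ ∩ Uⱼ`,
open sets `Vᵢ ⊆ π⁻¹(Uᵢ)` which are mapped bijectively to `Uᵢ` by (the local diffeomorphism) `π`,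
and smooth functions `χᵢ` such that `(χᵢ²)` is a subordinate partition of unity. -/
structure CoverData (π : M' → M) (κ : Type*) [Fintype κ] where
  U : κ → Set M
  isOpen_U : ∀ i, IsOpen (U i)
  iUnion_U : ⋃ i, U i = Set.univ
  isPreconnected_inter : ∀ i j, IsPreconnected (U i ∩ U j)
  V : κ → Set M'
  isOpen_V : ∀ i, IsOpen (V i)
  bijOn : ∀ i, Set.BijOn π (V i) (U i)
  χ : κ → M → ℝ
  contMDiff_χ : ∀ i, ContMDiff 𝓘(ℝ, E) 𝓘(ℝ, ℝ) ∞ (χ i)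
  tsupport_χ : ∀ i, tsupport (χ i) ⊆ U i
  sum_sq_χ : ∀ x, ∑ i, χ i x ^ 2 = 1

namespace CoverData

variable {E} {π : M' → M} {κ : Type*} [Fintype κ] (D : CoverData E π κ)

/-- The deck transformation `g_{ij} ∈ Γ` which maps `Vᵢ ∩ π⁻¹(Uⱼ)` to `Vⱼ ∩ π⁻¹(Uᵢ)` (an arbitrary
element if these sets are empty). -/
def deck (Γ : Type*) [Group Γ] [MulAction Γᵐᵒᵖ M'] (i j : κ) : Γ :=
  Classical.epsilon fun g : Γ => ∀ y ∈ D.V i, π y ∈ D.U j → op g • y ∈ D.V j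

/-- The function `χᵢ χⱼ`. -/
def prodχ (i j : κ) : smoothFunctions E M :=
  ⟨fun x => ((D.χ i x * D.χ j x : ℝ) : ℂ), by
    have h : ContMDiff 𝓘(ℝ, E) 𝓘(ℝ, ℝ) ∞ fun x => D.χ i x * D.χ j x := by
      have : ContDiff ℝ ∞ (fun p : ℝ × ℝ => p.1 * p.2) := contDiff_fst.mul contDiff_snd
      exact this.contMDiff.comp ((D.contMDiff_χ i).prodMk_space (D.contMDiff_χ j))
    exact Complex.ofRealCLM.contDiff.contMDiff.comp h⟩

/-- The projection `P = (χᵢ χⱼ g_{ij})_{ij}`. -/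
def proj (Γ : Type*) [Group Γ] [MulAction Γᵐᵒᵖ M'] :
    Matrix κ κ (smoothFunctions E M ⊗[ℂ] MonoidAlgebra ℂ Γ) :=
  Matrix.of fun i j => D.prodχ i j ⊗ₜ[ℂ] MonoidAlgebra.single (D.deck Γ i j) 1

/-- The function `h = ∑ᵢ χ'ᵢ²` on `M'`, where `χ'ᵢ` is the lift of `χᵢ` to `Vᵢ`, extended by zero. -/
def h : M' → ℂ := fun y => ∑ i, (((D.V i).indicator (fun z => D.χ i (π z)) y ^ 2 : ℝ) : ℂ)

/-- The form
`∑_{g₁, …, gₙ} τ(e, g₁, …, gₙ) R_{g₁}^* dh ∧ ⋯ ∧ R_{gₙ}^* dh` on `M'`, a locally finite sum. -/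
def liftedForm {Γ : Type*} [Group Γ] [MulAction Γᵐᵒᵖ M'] {n : ℕ} (τ : (Fin (n + 1) → Γ) → ℂ) :
    MForm E M' :=
  fun y => ∑ᶠ g : Fin n → Γ, τ (Fin.cons 1 g) •
    (List.ofFn fun k => MForm.pullback (fun z : M' => op (g k) • z) (MForm.dFun E D.h) y).prod

end CoverData

end Covering

end

/-! Fix a point y of the covering and let g_j be the element with y·g_j ∈ U_j'. Over π(y) one has
g_ij = g_i⁻¹ g_j, so P = v w is the product of the column v_i = χ_i g_i⁻¹ and the row w_j = χ_j g_j,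
with w v = ∑ χ_j² = 1. For such a projection P (dP)^{2k} = v Ω^k w, where Ω = (dw)(dv) + θ² and θ =
w dv (`rankOne_mul_pow`). With λ_g = g d(g⁻¹) one finds θ = ∑ χ_j² λ_{g_j} and Ω = X + Z, where X =
∑ d(χ_j²) λ_{g_j} and Z = θ² - ∑ χ_j² λ_{g_j}² is a combination of anticommutators of the λ's.

The key evaluation is c_τ(λ_{g_1} ⋯ λ_{g_k}) = τ(g_1, …, g_k, e) for k = n and 0 otherwise
(`cyclicCochain_logForm`). As τ is alternating, anticommutators are invisible to c_τ, and only Xⁿ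
contributes. Separating the forms on M from the λ's costs (-1)^{n(n-1)/2}; moving e to the front
costs (-1)ⁿ, which cancels the sign in the Chern character (`pair_trace_eq`,
`CoverData.pairForm_chernForm`). The outcome is a multiple of ∑ τ(e, g_{j_1}, …, g_{j_n})
d(χ_{j_1}²) ∧ ⋯ ∧ d(χ_{j_n}²). Since h(yg) is the sum of the χ_j² with g_j = g, the pullback of this
sum to the covering is the lifted form (`CoverData.liftedForm_eq`). Wherever they matter the g_j are
locally constant, so the form is locally a combination, with constant coefficients, of products of
exact forms: it is smooth and closed.

For the cohomology class, let s be a smooth simplex with a lift s'. The functions f_g = h(s'·g)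
satisfy ∑ f_g = 1 and ∑ df_g = 0. Consider the integrals of ∑ τ(a_0, …, a_p, g_0, …, g_q) f_{g_0}
df_{g_1} ⋯ df_{g_q} over the back face of s' that starts at its vertex p, where a_i is the value at
the vertex i of an equivariant map r to Γ. Stokes' theorem controls the faces of the back part
(`closedTerm_succ`), the cocycle identity controls the deletion of an a_i
(`sum_primitiveTerm_eraseIdx`), and the alternating sum over p telescopes
(`sum_transgression_face`). Hence the integral of the form and the value of τ at the vertices differ
by a coboundary. Taking r from the map covering ν turns the second cochain into the pullback of the
cocycle that represents [τ] on BΓ. -/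

/-! ### Evaluation of c_τ on products of the forms g d(g⁻¹). -/

section CyclicEvaluation

variable {Γ : Type*} [Group Γ]

/-- The value of a function of `n + 1` arguments on a list of arguments, zero for lists of a
different length. -/
noncomputable def listEval {n : ℕ} (τ : (Fin (n + 1) → Γ) → ℂ) (l : List Γ) : ℂ :=
  if h : l.length = n + 1 then τ fun i => l.get (i.cast h.symm) else 0

lemma altCochains_eq_zero {n : ℕ} {τ : (Fin (n + 1) → Γ) → ℂ} (hτ : τ ∈ altCochains Γ n)
    {v : Fin (n + 1) → Γ} {i j : Fin (n + 1)} (hij : i ≠ j) (hv : v i = v j) : τ v = 0 := by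
  have hs := hτ.2 (Equiv.swap i j) v
  have : v ∘ Equiv.swap i j = v := by
    funext k
    simp only [Function.comp_apply]
    rcases eq_or_ne k i with rfl | h
    · rw [Equiv.swap_apply_left, hv]
    rcases eq_or_ne k j with rfl | h'
    · rw [Equiv.swap_apply_right, hv]
    rw [Equiv.swap_apply_of_ne_of_ne h h']
  rw [this, Equiv.Perm.sign_swap hij] at hs
  push_cast at hs
  linear_combination hs / 2

lemma listEval_eq_zero {n : ℕ} {τ : (Fin (n + 1) → Γ) → ℂ} (hτ : τ ∈ altCochains Γ n)
    {l : List Γ} (hl : ¬ l.Nodup) : listEval τ l = 0 := by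
  unfold listEval
  split_ifs with h
  · rw [List.nodup_iff_injective_get] at hl
    simp only [Function.Injective, not_forall] at hl
    obtain ⟨a, b, hab, hne⟩ := hl
    refine altCochains_eq_zero hτ (i := a.cast h) (j := b.cast h) ?_ ?_
    · simpa [Fin.ext_iff] using hne
    · simpa using hab
  · rfl

lemma listEval_swap {n : ℕ} {τ : (Fin (n + 1) → Γ) → ℂ} (hτ : τ ∈ altCochains Γ n)
    (p q : List Γ) (a b : Γ) :
    listEval τ (p ++ a :: b :: q) = - listEval τ (p ++ b :: a :: q) := by
  unfold listEval
  have hlen : (p ++ a :: b :: q).length = (p ++ b :: a :: q).length := by simp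
  by_cases h : (p ++ a :: b :: q).length = n + 1
  · rw [dif_pos h, dif_pos (hlen ▸ h)]
    have hp : p.length + 1 < n + 1 := by simp at h; omega
    have hs := hτ.2 (Equiv.swap ⟨p.length, by omega⟩ ⟨p.length + 1, hp⟩)
      (fun i => (p ++ b :: a :: q).get (i.cast (hlen ▸ h).symm))
    rw [Equiv.Perm.sign_swap (by simp)] at hs
    push_cast at hs
    rw [neg_one_mul] at hs
    rw [← hs]
    congr 1
    funext i
    simp only [Function.comp_apply]
    rcases eq_or_ne i ⟨p.length, by omega⟩ with rfl | h1
    · rw [Equiv.swap_apply_left]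
      simp [List.getElem_append_right]
    rcases eq_or_ne i ⟨p.length + 1, hp⟩ with rfl | h2
    · rw [Equiv.swap_apply_right]
      simp [List.getElem_append_right]
    rw [Equiv.swap_apply_of_ne_of_ne h1 h2]
    obtain ⟨i, hi⟩ := i
    simp only [ne_eq, Fin.mk.injEq] at h1 h2
    simp only [List.get_eq_getElem, Fin.val_cast]
    rcases lt_or_gt_of_ne h1 with h3 | h3
    · rw [List.getElem_append_left h3, List.getElem_append_left h3]
    · obtain ⟨k, rfl⟩ : ∃ k, i = p.length + (k + 2) := ⟨i - p.length - 2, by omega⟩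
      rw [List.getElem_append_right (by omega), List.getElem_append_right (by omega)]
      simp
  · rw [dif_neg h, dif_neg (hlen ▸ h), neg_zero]

lemma listEval_ofFn {Γ : Type*} {n : ℕ} {τ : (Fin (n + 1) → Γ) → ℂ} (v : Fin (n + 1) → Γ) :
    listEval τ (List.ofFn v) = τ v := by
  unfold listEval
  rw [dif_pos (List.length_ofFn)]
  congr 1
  funext i
  rw [List.get_ofFn]
  rfl

/-- The cyclic permutation of n + 1 letters has sign (-1)ⁿ. -/
lemma altCochains_snoc {n : ℕ} {τ : (Fin (n + 1) → Γ) → ℂ} (hτ : τ ∈ altCochains Γ n)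
    (g : Fin n → Γ) (a : Γ) :
    τ (Fin.snoc g a : Fin (n + 1) → Γ) = (-1) ^ n * τ (Fin.cons a g) := by
  have hs := hτ.2 (finRotate (n + 1)) (Fin.cons a g)
  rw [sign_finRotate] at hs
  push_cast at hs
  rw [← hs]
  congr 1
  funext i
  refine Fin.lastCases ?_ (fun j => ?_) i
  · rw [Function.comp_apply, finRotate_last, Fin.snoc_last, Fin.cons_zero]
  · rw [Function.comp_apply, finRotate_apply, Fin.snoc_castSucc, Fin.coeSucc_eq_succ,
      Fin.cons_succ]

namespace NCForm

/-- The form `g d(g⁻¹)` of degree one. -/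
noncomputable def logForm (g : Γ) : NCForm (MonoidAlgebra ℂ Γ) :=
  incl (MonoidAlgebra.single g 1) * d _ (incl (MonoidAlgebra.single g⁻¹ 1))

/-- Leibniz rule: g d(g⁻¹) a = g d(g⁻¹a) - da. This recursion evaluates products of logarithmic
forms one factor at a time. -/
lemma logForm_mul_mk (g a : Γ) (t : TensorAlgebra ℂ (Bar (MonoidAlgebra ℂ Γ))) :
    logForm g * mk (MonoidAlgebra.single a 1) t =
      mk (MonoidAlgebra.single g 1) (bar _ (MonoidAlgebra.single (g⁻¹ * a) (1 : ℂ)) * t) -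
      mk (MonoidAlgebra.single 1 1) (bar _ (MonoidAlgebra.single a (1 : ℂ)) * t) := by
  simp only [logForm, incl, LinearMap.flip_apply, mkLin_apply, d_mk, mul_one, mul_def, mulHom_mk,
    Module.End.mul_apply, map_one, lift_bar, LinearMap.sub_apply, leftMul_mk, map_sub,
    MonoidAlgebra.single_mul_single, mul_inv_cancel]

lemma logForm_mem (g : Γ) : logForm g ∈ degree (MonoidAlgebra ℂ Γ) 1 := by
  have h0 : ∀ a, incl a ∈ degree (MonoidAlgebra ℂ Γ) 0 := fun a =>
    mk_mem_degree a (by rw [pow_zero]; exact Submodule.one_le.mp le_rfl)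
  have h := SetLike.mul_mem_graded (A := degree (MonoidAlgebra ℂ Γ))
    (h0 (MonoidAlgebra.single g 1)) (d_mem (h0 (MonoidAlgebra.single g⁻¹ 1)))
  rwa [zero_add, zero_add] at h

end NCForm

open NCForm

-- Partial products turn the inhomogeneous arguments of c_τ into homogeneous arguments of τ.
-- Absorbing the last factor of `p` by `logForm_mul_mk` prepends its letter to these arguments; the
-- correction term -da repeats an argument and is killed by alternation.
open Classical in
lemma cyclicCochain_logForm_mul {n : ℕ} {τ : (Fin (n + 1) → Γ) → ℂ} (hτ : τ ∈ altCochains Γ n)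
    (p w : List Γ) (a : Γ) :
    cyclicCochain τ ((p.map logForm).prod * mk (MonoidAlgebra.single a 1)
      (w.map fun g => bar _ (MonoidAlgebra.single g (1 : ℂ))).prod) =
    if a * w.prod = 1 then listEval τ (p ++ w.scanl (· * ·) a) else 0 := by
  induction p using List.reverseRecOn generalizing a w with
  | nil =>
    rw [List.map_nil, List.prod_nil, one_mul, cyclicCochain_word hτ, cyclicCochainAux]
    by_cases h : a * w.prod = 1
    · by_cases h' : w.length = n
      -- Left translation by `a` carries (e, w₁, w₁w₂, …) to (a, aw₁, aw₁w₂, …).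
      · rw [if_pos ⟨h', h⟩, if_pos h, List.nil_append, listEval, dif_pos (by simp [h']),
          ← hτ.1 a]
        congr 1
        funext i
        rw [List.get_eq_getElem, List.getElem_scanl]
        have : ∀ (l : List Γ) (a : Γ), l.foldl (· * ·) a = a * l.prod := by
          intro l
          induction l with
          | nil => simp
          | cons b l ih => intro a; rw [List.foldl_cons, ih, List.prod_cons, mul_assoc]
        rw [this]; rfl
      · rw [if_neg (by simp [h']), if_pos h, List.nil_append, listEval, dif_neg (by simp [h'])]
    · rw [if_neg (by simp [h]), if_neg h]
  | append_singleton p g ih =>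
    rw [List.map_append, List.prod_append, List.map_singleton, List.prod_singleton, mul_assoc,
      logForm_mul_mk, mul_sub, map_sub]
    have h1 := ih ((g⁻¹ * a) :: w) g
    have h2 := ih (a :: w) 1
    rw [List.map_cons, List.prod_cons] at h1 h2
    rw [h1, h2]
    simp only [List.prod_cons, List.scanl_cons, one_mul, ← mul_assoc,
      mul_inv_cancel]
    split_ifs with h
    -- This list starts its partial products with 1 and ends with `a * w.prod = 1`, so 1 occurs
    -- twice.
    · rw [listEval_eq_zero hτ (l := p ++ 1 :: w.scanl (· * ·) a), sub_zero]
      · simp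
      · rw [List.nodup_append]
        rintro ⟨-, h3, -⟩
        rw [List.nodup_cons] at h3
        apply h3.1
        have hl : ∀ (w : List Γ) (a : Γ), a * w.prod ∈ w.scanl (· * ·) a := by
          intro w
          induction w with
          | nil => simp
          | cons b w ih =>
            intro a
            rw [List.scanl_cons, List.prod_cons, ← mul_assoc]
            exact List.mem_cons_of_mem _ (ih _)
        rw [← h]; exact hl w a
    · rw [sub_zero]

lemma cyclicCochain_logForm {n : ℕ} {τ : (Fin (n + 1) → Γ) → ℂ} (hτ : τ ∈ altCochains Γ n)
    (p : List Γ) : cyclicCochain τ (p.map logForm).prod = listEval τ (p ++ [1]) := by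
  have h := cyclicCochain_logForm_mul hτ p [] 1
  rw [List.map_nil, List.prod_nil, ← MonoidAlgebra.one_def, ← one_def, mul_one] at h
  simpa using h

lemma cyclicCochain_logForm_ofFn {n : ℕ} {τ : (Fin (n + 1) → Γ) → ℂ} (hτ : τ ∈ altCochains Γ n)
    (g : Fin n → Γ) : cyclicCochain τ (List.ofFn fun i => logForm (g i)).prod =
      (-1) ^ n * τ (Fin.cons 1 g) := by
  have h := cyclicCochain_logForm hτ (List.ofFn g)
  rw [List.map_ofFn] at h
  rw [show (fun i => logForm (g i)) = logForm ∘ g from rfl, h, ← altCochains_snoc hτ,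
    ← listEval_ofFn (τ := τ), List.ofFn_succ']
  simp [List.concat_eq_append]

/-- The two products give values of τ that differ by a transposition of neighbours. This is what
discards the part of the curvature without a differential on M. -/
lemma cyclicCochain_logForm_swap {n : ℕ} {τ : (Fin (n + 1) → Γ) → ℂ} (hτ : τ ∈ altCochains Γ n)
    (p q : List Γ) (a b : Γ) :
    cyclicCochain τ ((p.map logForm).prod * (logForm a * logForm b + logForm b * logForm a) *
      (q.map logForm).prod) = 0 := by
  have h1 := cyclicCochain_logForm hτ (p ++ a :: b :: q)
  have h2 := cyclicCochain_logForm hτ (p ++ b :: a :: q)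
  rw [List.append_assoc, List.cons_append, List.cons_append, listEval_swap hτ] at h1
  rw [List.append_assoc, List.cons_append, List.cons_append] at h2
  rw [mul_add, add_mul, map_add]
  simp only [List.map_append, List.prod_append, List.map_cons, List.prod_cons, ← mul_assoc]
    at h1 h2 ⊢
  rw [h1, h2, neg_add_cancel]

end CyclicEvaluation

/-! ### Powers of the curvature of a rank one projection. -/

section RankOneProjection

variable {R : Type*} [Ring R] {κ : Type*} [Fintype κ]

/-- The curvature computation for the Grassmann connection of a projection `v w` of rank one, where
`d v = a` and `d w = b`. -/
lemma rankOne_mul_pow [DecidableEq κ] (v w a b : κ → R) (hwv : ∑ i, w i * v i = 1)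
    (hbv : ∑ i, b i * v i = - ∑ i, w i * a i) (k : ℕ) :
    (Matrix.of fun i j => v i * w j) * (Matrix.of fun i j => a i * w j + v i * b j) ^ (2 * k) =
    Matrix.of fun i j => v i * (∑ j, b j * a j + (∑ j, w j * a j) ^ 2) ^ k * w j := by
  set θ := ∑ j, w j * a j with hθ
  set Ω := ∑ j, b j * a j + θ ^ 2 with hΩ
  set Q : Matrix κ κ R := Matrix.of fun i j => a i * w j + v i * b j with hQ
  -- Right multiplication by `Q` sends w to θw + b and b to (∑ b a)w - θb. Applied twice to w, the
  -- terms θb cancel and Ωw remains.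
  have h1 : ∀ j, ∑ l, w l * Q l j = θ * w j + b j := fun j => by
    simp only [hQ, Matrix.of_apply, mul_add, ← mul_assoc, Finset.sum_add_distrib,
      ← Finset.sum_mul, ← hθ, hwv, one_mul]
  have h2 : ∀ j, ∑ l, b l * Q l j = (∑ j, b j * a j) * w j - θ * b j := fun j => by
    simp only [hQ, Matrix.of_apply, mul_add, ← mul_assoc, Finset.sum_add_distrib,
      ← Finset.sum_mul, hbv]
    rw [neg_mul, sub_eq_add_neg]
  induction k with
  | zero => simp
  | succ k ih =>
    rw [show 2 * (k + 1) = 2 * k + 1 + 1 by ring, pow_succ, pow_succ, ← mul_assoc, ← mul_assoc,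
      ih]
    have h3 : (Matrix.of fun i j => v i * Ω ^ k * w j) * Q =
        Matrix.of fun i j => v i * Ω ^ k * (θ * w j + b j) := by
      ext i j
      rw [Matrix.mul_apply]
      simp only [Matrix.of_apply, mul_assoc]
      simp only [← Finset.mul_sum, h1]
    rw [h3]
    ext i j
    rw [Matrix.mul_apply]
    simp only [Matrix.of_apply, mul_assoc, add_mul]
    simp only [← Finset.mul_sum, Finset.sum_add_distrib, h1, h2]
    rw [pow_succ, hΩ]
    noncomm_ring

end RankOneProjection

/-! ### The connection and curvature of P, and c_τ on powers of the curvature. -/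

section Curvature

open NCForm

variable {Γ : Type*} [Group Γ]

lemma NCForm.incl_mul (a b : MonoidAlgebra ℂ Γ) : incl a * incl b = incl (a * b) := by
  simp [incl, mul_def]

lemma NCForm.incl_one : incl (1 : MonoidAlgebra ℂ Γ) = 1 := rfl

lemma NCForm.incl_single_mul_inv (g : Γ) :
    incl (MonoidAlgebra.single g (1 : ℂ)) * incl (MonoidAlgebra.single g⁻¹ 1) = 1 := by
  rw [incl_mul, MonoidAlgebra.single_mul_single, mul_inv_cancel, one_mul,
    ← MonoidAlgebra.one_def, incl_one]

lemma NCForm.incl_inv_mul_single (g : Γ) :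
    incl (MonoidAlgebra.single g⁻¹ (1 : ℂ)) * incl (MonoidAlgebra.single g 1) = 1 := by
  rw [incl_mul, MonoidAlgebra.single_mul_single, inv_mul_cancel, one_mul,
    ← MonoidAlgebra.one_def, incl_one]

/-- Differentiate g g⁻¹ = 1 and use d1 = 0. -/
lemma NCForm.d_incl_mul_inv (g : Γ) :
    d _ (incl (MonoidAlgebra.single g (1 : ℂ))) * incl (MonoidAlgebra.single g⁻¹ 1) =
      - logForm g := by
  have h := leibniz_incl (MonoidAlgebra.single g (1 : ℂ)) (incl (MonoidAlgebra.single g⁻¹ 1))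
  rw [incl_single_mul_inv, one_def, d_mk, bar_one, zero_mul, ← mkLin_apply, map_zero] at h
  exact eq_neg_of_add_eq_zero_left h.symm

lemma NCForm.d_incl_mul_d_inv (g : Γ) :
    d _ (incl (MonoidAlgebra.single g (1 : ℂ))) * d _ (incl (MonoidAlgebra.single g⁻¹ 1)) =
      - (logForm g * logForm g) := by
  have h : d _ (incl (MonoidAlgebra.single g (1 : ℂ))) =
      - logForm g * incl (MonoidAlgebra.single g 1) := by
    rw [← d_incl_mul_inv, mul_assoc, incl_inv_mul_single, mul_one]
  rw [h, mul_assoc, ← logForm, neg_mul]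

variable {R : Type*} [Ring R] [Algebra ℂ R] {κ : Type*} [Fintype κ]
  (y : NCForm (MonoidAlgebra ℂ Γ) →ₐ[ℂ] R) (e : κ → R) (c : κ → ℂ) (g : κ → Γ)

/-- This is w dv. Its part along M is ∑ c_j e_j, half the differential of ∑ c_j² = 1, so only the
logarithmic forms survive. -/
lemma connection_eq
    (he0 : ∀ j a, y (incl a) * e j = e j * y (incl a)) (hce : ∑ j, c j • e j = 0) :
    ∑ j, (c j • y (incl (MonoidAlgebra.single (g j) 1))) *
      (e j * y (incl (MonoidAlgebra.single (g j)⁻¹ 1)) +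
        c j • y (d _ (incl (MonoidAlgebra.single (g j)⁻¹ 1)))) =
      ∑ j, c j ^ 2 • y (logForm (g j)) := by
  rw [← zero_add (∑ j, c j ^ 2 • _), ← hce, ← Finset.sum_add_distrib]
  refine Finset.sum_congr rfl fun j _ => ?_
  rw [mul_add, smul_mul_smul_comm, ← map_mul, ← logForm, ← pow_two, ← mul_assoc,
    smul_mul_assoc, he0, smul_mul_assoc, mul_assoc, ← map_mul, incl_single_mul_inv, map_one,
    mul_one]

/-- This is (dw) v, and the value agrees with (dw) v = -w dv, the derivative of w v = 1. -/
lemma connection_right_eq (hce : ∑ j, c j • e j = 0) :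
    ∑ j, (e j * y (incl (MonoidAlgebra.single (g j) 1)) +
        c j • y (d _ (incl (MonoidAlgebra.single (g j) 1)))) *
      (c j • y (incl (MonoidAlgebra.single (g j)⁻¹ 1))) =
      - ∑ j, c j ^ 2 • y (logForm (g j)) := by
  rw [← zero_add (- ∑ j, c j ^ 2 • _), ← hce, ← Finset.sum_neg_distrib, ← Finset.sum_add_distrib]
  refine Finset.sum_congr rfl fun j _ => ?_
  rw [add_mul, smul_mul_smul_comm, ← map_mul, d_incl_mul_inv, map_neg, smul_neg, ← pow_two,
    mul_smul_comm, mul_assoc, ← map_mul, incl_single_mul_inv, map_one, mul_one]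

/-- This is (dw)(dv). The square of `e j` drops out, and both mixed terms equal c_j e_j λ: the sign
from moving `e j` past dg cancels the one in (dg)g⁻¹ = -g d(g⁻¹). They add up to d(c_j²) λ. -/
lemma curvature_eq
    (he0 : ∀ j a, y (incl a) * e j = e j * y (incl a))
    (he1 : ∀ j a, y (d _ (incl a)) * e j = - (e j * y (d _ (incl a))))
    (hee : ∀ j, e j * e j = 0) :
    ∑ j, (e j * y (incl (MonoidAlgebra.single (g j) 1)) +
        c j • y (d _ (incl (MonoidAlgebra.single (g j) 1)))) *
      (e j * y (incl (MonoidAlgebra.single (g j)⁻¹ 1)) +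
        c j • y (d _ (incl (MonoidAlgebra.single (g j)⁻¹ 1)))) =
      ∑ j, ((2 * c j) • e j) * y (logForm (g j)) -
        ∑ j, c j ^ 2 • y (logForm (g j) * logForm (g j)) := by
  rw [← Finset.sum_sub_distrib]
  refine Finset.sum_congr rfl fun j _ => ?_
  have h1 : e j * y (incl (MonoidAlgebra.single (g j) 1)) *
      (e j * y (incl (MonoidAlgebra.single (g j)⁻¹ 1))) = 0 := by
    rw [mul_assoc, ← mul_assoc _ (e j), he0, ← mul_assoc, ← mul_assoc, hee, zero_mul, zero_mul]
  have h2 : y (d _ (incl (MonoidAlgebra.single (g j) 1))) *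
      (e j * y (incl (MonoidAlgebra.single (g j)⁻¹ 1))) = e j * y (logForm (g j)) := by
    rw [← mul_assoc, he1, neg_mul, mul_assoc, ← map_mul, d_incl_mul_inv, map_neg, mul_neg,
      neg_neg]
  have h3 : e j * y (incl (MonoidAlgebra.single (g j) 1)) *
      y (d _ (incl (MonoidAlgebra.single (g j)⁻¹ 1))) = e j * y (logForm (g j)) := by
    rw [mul_assoc, ← map_mul, ← logForm]
  rw [add_mul, mul_add, mul_add, h1, smul_mul_assoc, h2, smul_mul_smul_comm, ← map_mul,
    d_incl_mul_d_inv, mul_smul_comm, h3, map_neg, smul_neg, ← pow_two, smul_mul_assoc, two_mul,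
    add_smul]
  abel

lemma mul_prod_ofFn_of_anticommute {R Λ κ : Type*} [Ring R] [Algebra ℂ R] [Ring Λ] [Algebra ℂ Λ]
    (x : Λ →ₐ[ℂ] R) (ε : κ → Λ) (u : R) (h : ∀ j, u * x (ε j) = - (x (ε j) * u)) {k : ℕ}
    (J : Fin k → κ) : u * x (List.ofFn fun i => ε (J i)).prod =
      ((-1) ^ k : ℂ) • (x (List.ofFn fun i => ε (J i)).prod * u) := by
  induction k with
  | zero => simp
  | succ k ih =>
    rw [List.ofFn_succ, List.prod_cons, map_mul, ← mul_assoc, h, neg_mul, mul_assoc,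
      ih (fun i => J i.succ), mul_smul_comm, pow_succ, mul_neg_one, neg_smul, mul_assoc]

/-- The `k`-th power of `∑ⱼ εⱼ uⱼ` for anticommuting `εⱼ` and `uᵢ`. -/
lemma sum_mul_pow_of_anticommute {Λ Ω : Type*} [Ring Λ] [Algebra ℂ Λ] [Ring Ω] [Algebra ℂ Ω]
    (x : Λ →ₐ[ℂ] R) (y : Ω →ₐ[ℂ] R) (ε : κ → Λ) (u : κ → Ω)
    (h : ∀ i j, y (u i) * x (ε j) = - (x (ε j) * y (u i))) (k : ℕ) :
    (∑ j, x (ε j) * y (u j)) ^ k = ((-1) ^ (k * (k - 1) / 2) : ℂ) • ∑ J : Fin k → κ,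
      x (List.ofFn fun i => ε (J i)).prod * y (List.ofFn fun i => u (J i)).prod := by
  induction k with
  | zero => simp
  | succ k ih =>
    rw [pow_succ', ih, mul_smul_comm, Finset.sum_mul_sum,
      ← (Fin.consEquiv fun _ : Fin (k + 1) => κ).sum_comp, Fintype.sum_prod_type, Finset.smul_sum,
      Finset.smul_sum]
    refine Finset.sum_congr rfl fun j _ => ?_
    rw [Finset.smul_sum, Finset.smul_sum]
    refine Finset.sum_congr rfl fun J _ => ?_
    -- Moving the new `u j` past k factors ε costs (-1)^k, and k(k-1)/2 + k = (k+1)k/2.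
    have hk : (k + 1) * (k + 1 - 1) / 2 = k * (k - 1) / 2 + k := by
      cases k with
      | zero => rfl
      | succ k =>
        simp only [Nat.add_sub_cancel]
        rw [show (k + 1 + 1) * (k + 1) = (k + 1) * k + (k + 1) * 2 by ring,
          Nat.add_mul_div_right _ _ (by norm_num)]
    rw [hk, pow_add, mul_smul]
    congr 1
    simp only [Fin.consEquiv_apply, List.ofFn_succ, List.prod_cons, Fin.cons_zero, Fin.cons_succ,
      map_mul]
    rw [mul_assoc, ← mul_assoc (y _), mul_prod_ofFn_of_anticommute _ _ _ (h j), smul_mul_assoc, mul_smul_comm, mul_assoc, mul_assoc]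

/-- Evaluation of the cochain `c_τ` on powers of the curvature. -/
lemma cyclicCochain_curvature_pow {n : ℕ} {τ : (Fin (n + 1) → Γ) → ℂ} (hτ : τ ∈ altCochains Γ n)
    {Λ : Type*} [Ring Λ] [Algebra ℂ Λ] (x : Λ →ₐ[ℂ] R) (f : R →ₗ[ℂ] Λ)
    (hf : ∀ α β, f (x α * y β) = cyclicCochain τ β • α) (ε : κ → Λ)
    (hx : ∀ g j, y (logForm g) * x (ε j) = - (x (ε j) * y (logForm g))) (k : ℕ) :
    f ((∑ j, x (ε j) * y (logForm (g j)) - ∑ j, c j ^ 2 • y (logForm (g j) * logForm (g j)) +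
      (∑ j, c j ^ 2 • y (logForm (g j))) ^ 2) ^ k) =
    if k = n then ((-1) ^ (n * (n - 1) / 2) * (-1) ^ n : ℂ) •
      ∑ J : Fin n → κ, τ (Fin.cons 1 fun i => g (J i)) • (List.ofFn fun i => ε (J i)).prod
    else 0 := by
  set X := ∑ j, x (ε j) * y (logForm (g j)) with hX
  set Z := - ∑ j, c j ^ 2 • y (logForm (g j) * logForm (g j)) +
      (∑ j, c j ^ 2 • y (logForm (g j))) ^ 2 with hZ
  -- `N` is spanned by the terms with an anticommutator among their logarithmic factors. The scalar
  -- `s` records how `x α` passes logarithmic forms, which makes `N` stable under left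
  -- multiplication by them.
  let S : Set R := {r | ∃ (α : Λ) (s : ℂ) (p q : List Γ) (a b : Γ),
    (∀ g, y (logForm g) * x α = s • (x α * y (logForm g))) ∧
    r = x α * y ((p.map logForm).prod * (logForm a * logForm b + logForm b * logForm a) *
      (q.map logForm).prod)}
  let N : Submodule ℂ R := Submodule.span ℂ S
  have hfN : ∀ r ∈ N, f r = 0 := by
    intro r hr
    induction hr using Submodule.span_induction with
    | mem r hr =>
      obtain ⟨α, s, p, q, a, b, -, rfl⟩ := hr
      rw [hf, cyclicCochain_logForm_swap hτ, zero_smul]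
    | zero => simp
    | add r s _ _ h1 h2 => rw [map_add, h1, h2, add_zero]
    | smul z r _ h => rw [map_smul, h, smul_zero]
  have hu : ∀ g, ∀ r ∈ N, y (logForm g) * r ∈ N := by
    intro g r hr
    induction hr using Submodule.span_induction with
    | mem r hr =>
      obtain ⟨α, s, p, q, a, b, hs, rfl⟩ := hr
      rw [← mul_assoc, hs, smul_mul_assoc, mul_assoc, ← map_mul]
      refine Submodule.smul_mem _ _ (Submodule.subset_span ⟨α, s, g :: p, q, a, b, hs, ?_⟩)
      rw [List.map_cons, List.prod_cons]
      simp only [mul_assoc]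
    | zero => simp
    | add r s _ _ h1 h2 => rw [mul_add]; exact add_mem h1 h2
    | smul z r _ h => rw [mul_smul_comm]; exact Submodule.smul_mem _ _ h
  have he : ∀ j, ∀ r ∈ N, x (ε j) * r ∈ N := by
    intro j r hr
    induction hr using Submodule.span_induction with
    | mem r hr =>
      obtain ⟨α, s, p, q, a, b, hs, rfl⟩ := hr
      rw [← mul_assoc, ← map_mul]
      refine Submodule.subset_span ⟨ε j * α, -s, p, q, a, b, fun g => ?_, rfl⟩
      rw [map_mul, ← mul_assoc, hx, neg_mul, mul_assoc, hs, mul_smul_comm, neg_smul, mul_assoc]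
    | zero => simp
    | add r s _ _ h1 h2 => rw [mul_add]; exact add_mem h1 h2
    | smul z r _ h => rw [mul_smul_comm]; exact Submodule.smul_mem _ _ h
  have hXN : ∀ r ∈ N, X * r ∈ N := fun r hr => by
    rw [hX, Finset.sum_mul]
    refine sum_mem fun j _ => ?_
    rw [mul_assoc]
    exact he j _ (hu _ _ hr)
  have hZN : ∀ r ∈ N, Z * r ∈ N := fun r hr => by
    have h1 : ∀ r ∈ N, (∑ j, c j ^ 2 • y (logForm (g j))) * r ∈ N := fun r hr => by
      rw [Finset.sum_mul]
      refine sum_mem fun j _ => ?_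
      rw [smul_mul_assoc]
      exact Submodule.smul_mem _ _ (hu _ _ hr)
    rw [hZ, add_mul, neg_mul, pow_two, mul_assoc]
    refine add_mem (neg_mem ?_) (h1 _ (h1 _ hr))
    rw [Finset.sum_mul]
    refine sum_mem fun j _ => ?_
    rw [smul_mul_assoc, map_mul, mul_assoc]
    exact Submodule.smul_mem _ _ (hu _ _ (hu _ _ hr))
  have hZX : ∀ k, Z * X ^ k ∈ N := by
    intro k
    rw [hX, sum_mul_pow_of_anticommute x y ε (fun j => logForm (g j)) (fun i j => hx (g i) j),
      mul_smul_comm, Finset.mul_sum]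
    refine Submodule.smul_mem _ _ (sum_mem fun J _ => ?_)
    have hs : ∀ g, y (logForm g) * x (List.ofFn fun i => ε (J i)).prod =
        ((-1) ^ k : ℂ) • (x (List.ofFn fun i => ε (J i)).prod * y (logForm g)) :=
      fun g => mul_prod_ofFn_of_anticommute x ε _ (hx g) J
    have hab : ∀ a b, y (logForm a * logForm b + logForm b * logForm a) *
        (x (List.ofFn fun i => ε (J i)).prod * y (List.ofFn fun i => logForm (g (J i))).prod)
        ∈ N := by
      intro a b
      rw [← mul_assoc]
      have : y (logForm a * logForm b + logForm b * logForm a) *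
          x (List.ofFn fun i => ε (J i)).prod = ((-1) ^ k * (-1) ^ k : ℂ) •
          (x (List.ofFn fun i => ε (J i)).prod *
            y (logForm a * logForm b + logForm b * logForm a)) := by
        simp only [map_add, map_mul, add_mul, mul_add, mul_assoc, hs, mul_smul_comm, smul_add,
          mul_smul]
        simp only [← mul_assoc, hs, smul_mul_assoc]
      rw [this, smul_mul_assoc, mul_assoc, ← map_mul]
      refine Submodule.smul_mem _ _ (Submodule.subset_span ⟨_, _, [], List.ofFn fun i => g (J i),
        a, b, hs, ?_⟩)
      simp [List.map_ofFn, Function.comp_def]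
    -- Symmetrizing the double sum θ², and writing a square as half of its anticommutator with
    -- itself, exhibits `Z` through anticommutators only.
    have hZ' : Z = (2⁻¹ : ℂ) • (∑ i, ∑ j, (c i ^ 2 * c j ^ 2) •
        y (logForm (g i) * logForm (g j) + logForm (g j) * logForm (g i)) -
        ∑ j, c j ^ 2 • y (logForm (g j) * logForm (g j) + logForm (g j) * logForm (g j))) := by
      have h1 : ∑ i, ∑ j, (c i ^ 2 * c j ^ 2) •
          y (logForm (g i) * logForm (g j)) = (∑ j, c j ^ 2 • y (logForm (g j))) ^ 2 := by
        rw [pow_two, Finset.sum_mul_sum]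
        simp only [smul_mul_smul_comm, map_mul]
      have h2 : ∑ i, ∑ j, (c i ^ 2 * c j ^ 2) •
          y (logForm (g j) * logForm (g i)) = (∑ j, c j ^ 2 • y (logForm (g j))) ^ 2 := by
        rw [Finset.sum_comm, ← h1]
        simp only [mul_comm]
      simp only [map_add, smul_add, Finset.sum_add_distrib]
      rw [h1, h2, hZ, ← sub_eq_zero]
      module
    rw [hZ', smul_mul_assoc, sub_mul]
    refine Submodule.smul_mem _ _ (sub_mem ?_ ?_)
    · rw [Finset.sum_mul]
      refine sum_mem fun i _ => ?_
      rw [Finset.sum_mul]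
      refine sum_mem fun j _ => ?_
      rw [smul_mul_assoc]
      exact Submodule.smul_mem _ _ (hab _ _)
    · rw [Finset.sum_mul]
      refine sum_mem fun i _ => ?_
      rw [smul_mul_assoc]
      exact Submodule.smul_mem _ _ (hab _ _)
  -- In a word in `X` and `Z` that contains `Z`, the last `Z` is followed by a power of `X`; that
  -- tail lies in `N`, and `N` absorbs what stands to its left.
  have hpow : ∀ k, (X + Z) ^ k - X ^ k ∈ N := by
    intro k
    induction k with
    | zero => simp
    | succ k ih =>
      have : (X + Z) ^ (k + 1) - X ^ (k + 1) =
          X * ((X + Z) ^ k - X ^ k) + Z * ((X + Z) ^ k - X ^ k) + Z * X ^ k := by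
        rw [pow_succ', pow_succ']; noncomm_ring
      rw [this]
      exact add_mem (add_mem (hXN _ ih) (hZN _ ih)) (hZX k)
  have hsum : X - ∑ j, c j ^ 2 • y (logForm (g j) * logForm (g j)) +
      (∑ j, c j ^ 2 • y (logForm (g j))) ^ 2 = X + Z := by
    rw [hZ, ← add_assoc, sub_eq_add_neg]
  have hfX : f ((X + Z) ^ k) = f (X ^ k) := by
    rw [← sub_eq_zero, ← map_sub]; exact hfN _ (hpow k)
  rw [hsum, hfX, hX, sum_mul_pow_of_anticommute x y ε (fun j => logForm (g j))
    (fun i j => hx (g i) j), map_smul, map_sum]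
  simp only [hf]
  split_ifs with hk
  · subst hk
    simp only [cyclicCochain_logForm_ofFn hτ (fun i => g (_ : κ)), mul_smul, Finset.smul_sum]
  · rw [Finset.sum_eq_zero, smul_zero]
    intro J _
    have h := cyclicCochain_logForm hτ (List.ofFn fun i => g (J i))
    rw [List.map_ofFn, listEval, dif_neg (by simp [hk])] at h
    rw [show (fun i => logForm (g (J i))) = logForm ∘ fun i => g (J i) from rfl, h, zero_smul]

end Curvature

/-! ### Consequences of the cocycle identity for sums against ε_j with ∑ ε_j = 0. -/

section CocycleIdentities

variable {Γ : Type*}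

lemma List.eraseIdx_ofFn {α : Type*} {n : ℕ} (v : Fin (n + 1) → α) (k : Fin (n + 1)) :
    (List.ofFn v).eraseIdx k = List.ofFn fun i => v (k.succAbove i) := by
  induction n with
  | zero => obtain rfl : k = 0 := Fin.fin_one_eq_zero k; simp
  | succ n ih =>
    refine Fin.cases ?_ (fun k => ?_) k
    · rw [List.ofFn_succ]; simp
    · rw [List.ofFn_succ, Fin.val_succ, List.eraseIdx_cons_succ, ih, List.ofFn_succ (n := n)]
      simp

lemma listEval_eq_zero_of_length {n : ℕ} (τ : (Fin (n + 1) → Γ) → ℂ) {l : List Γ}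
    (h : l.length ≠ n + 1) : listEval τ l = 0 := dif_neg h

lemma listEval_mul [Group Γ] {n : ℕ} {τ : (Fin (n + 1) → Γ) → ℂ} (hτ : τ ∈ altCochains Γ n) (g : Γ)
    (l : List Γ) : listEval τ (l.map (g * ·)) = listEval τ l := by
  unfold listEval
  by_cases h : l.length = n + 1
  · rw [dif_pos h, dif_pos (by simpa using h)]
    refine (congrArg τ ?_).trans (hτ.1 g _)
    funext i
    simp
  · rw [dif_neg h, dif_neg (by simpa using h)]

lemma sum_listEval_eraseIdx {n : ℕ} {τ : (Fin (n + 1) → Γ) → ℂ} (hd : groupCoboundary τ = 0)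
    (l : List Γ) : ∑ k ∈ Finset.range l.length, (-1) ^ k * listEval τ (l.eraseIdx k) = 0 := by
  by_cases h : l.length = n + 2
  · have hl : List.ofFn (fun i : Fin (n + 2) => l.get (i.cast h.symm)) = l := by
      refine List.ext_getElem (by simp [h]) fun i h1 h2 => ?_
      rw [List.getElem_ofFn]
      rfl
    rw [← hl, List.length_ofFn, Finset.sum_range]
    refine Eq.trans (Finset.sum_congr rfl fun j _ => ?_) (congr_fun hd fun i => l.get (i.cast h.symm))
    rw [List.eraseIdx_ofFn, listEval_ofFn]
  · refine Finset.sum_eq_zero fun k hk => ?_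
    rw [Finset.mem_range] at hk
    rw [listEval_eq_zero_of_length, mul_zero]
    rw [List.length_eraseIdx_of_lt hk]
    omega

/-- The cocycle identity for a concatenation, used to trade deletions among fixed arguments for
deletions among arguments that are summed over. -/
lemma sum_listEval_eraseIdx_append {n : ℕ} {τ : (Fin (n + 1) → Γ) → ℂ}
    (hd : groupCoboundary τ = 0) (a l : List Γ) :
    ∑ k ∈ Finset.range a.length, (-1) ^ k * listEval τ (a.eraseIdx k ++ l) =
      - (-1) ^ a.length *
        ∑ k ∈ Finset.range l.length, (-1) ^ k * listEval τ (a ++ l.eraseIdx k) := by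
  have h := sum_listEval_eraseIdx hd (a ++ l)
  rw [List.length_append, Finset.sum_range_add] at h
  rw [neg_mul, eq_neg_iff_add_eq_zero, ← h, Finset.mul_sum]
  congr 1
  · refine Finset.sum_congr rfl fun k hk => ?_
    rw [List.eraseIdx_append_of_lt_length (Finset.mem_range.mp hk)]
  · refine Finset.sum_congr rfl fun k _ => ?_
    rw [List.eraseIdx_append_of_length_le (by omega), pow_add, mul_assoc, Nat.add_sub_cancel_left]

variable {κ : Type*} [Fintype κ] {W W' : Type*} [AddCommGroup W] [Module ℂ W] [AddCommGroup W']
  [Module ℂ W']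

/-- The coefficient ignores the index in position `k`, so this index can be summed first; by
multilinearity it replaces the k-th argument by ∑ ε_j = 0. -/
lemma sum_smul_multilinear_eq_zero {m : ℕ} (μ : MultilinearMap ℂ (fun _ : Fin (m + 1) => W) W')
    {ε : κ → W} (hε : ∑ j, ε j = 0) (k : Fin (m + 1)) (G : (Fin m → κ) → ℂ) :
    ∑ J : Fin (m + 1) → κ, G (fun i => J (k.succAbove i)) • μ (fun i => ε (J i)) = 0 := by
  rw [← (Fin.insertNthEquiv (fun _ => κ) k).sum_comp, Fintype.sum_prod_type_right]
  refine Finset.sum_eq_zero fun J _ => ?_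
  have h : ∀ j, (fun i => ε ((Fin.insertNth k j J : Fin (m + 1) → κ) i)) =
      Function.update (Fin.insertNth k 0 (fun i => ε (J i)) : Fin (m + 1) → W) k (ε j) := by
    intro j
    rw [Fin.update_insertNth]
    funext i
    refine Fin.succAboveCases k ?_ (fun i => ?_) i <;> simp
  simp only [Fin.insertNthEquiv_apply, Fin.insertNth_apply_succAbove, h, ← Finset.smul_sum]
  rw [← MultilinearMap.map_update_sum, hε, MultilinearMap.map_update_zero, smul_zero]

/-- In the sum over all `g₁, …, g_q` of `∑ₖ ± τ(a, g₁, …, ĝₖ, …, g_q) ε_{g₁} ⋯ ε_{g_q}` all terms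
cancel if `∑_g ε_g = 0`. -/
lemma sum_listEval_eraseIdx_smul {n : ℕ} (τ : (Fin (n + 1) → Γ) → ℂ) {q : ℕ}
    (μ : MultilinearMap ℂ (fun _ : Fin q => W) W') (g : κ → Γ)
    {ε : κ → W} (hε : ∑ j, ε j = 0) (a : List Γ) :
    ∑ J : Fin q → κ, (∑ k ∈ Finset.range q, (-1) ^ k *
      listEval τ (a ++ (List.ofFn fun i => g (J i)).eraseIdx k)) • μ (fun i => ε (J i)) = 0 := by
  cases q with
  | zero => simp
  | succ m =>
    simp only [Finset.sum_smul]
    rw [Finset.sum_comm]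
    refine Finset.sum_eq_zero fun k hk => ?_
    rw [Finset.mem_range] at hk
    have h := sum_smul_multilinear_eq_zero μ hε ⟨k, hk⟩ fun J : Fin m → κ => (-1) ^ k *
      listEval τ (a ++ List.ofFn fun i => g (J i))
    rw [← h]
    refine Finset.sum_congr rfl fun J _ => ?_
    rw [List.eraseIdx_ofFn (fun i => g (J i)) ⟨k, hk⟩]

/-- The sum `∑ τ(a, g₁, …, gₙ) ε_{g₁} ⋯ ε_{gₙ}` does not depend on `a`. -/
lemma sum_cons_smul_eq {n : ℕ} {τ : (Fin (n + 1) → Γ) → ℂ} (hd : groupCoboundary τ = 0)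
    (μ : MultilinearMap ℂ (fun _ : Fin n => W) W') (g : κ → Γ)
    {ε : κ → W} (hε : ∑ j, ε j = 0) (a b : Γ) :
    ∑ J : Fin n → κ, τ (Fin.cons a fun i => g (J i)) • μ (fun i => ε (J i)) =
      ∑ J : Fin n → κ, τ (Fin.cons b fun i => g (J i)) • μ (fun i => ε (J i)) := by
  have h := sum_listEval_eraseIdx_smul τ μ g hε [b, a]
  have hc : ∀ (c : Γ) (v : Fin n → Γ), listEval τ (c :: List.ofFn v) = τ (Fin.cons c v) := by
    intro c v
    rw [← listEval_ofFn (τ := τ), List.ofFn_succ]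
    simp
  -- Cocycle identity for (b, a, g₁, …, gₙ): deleting b or a gives the left side, and every other
  -- deletion frees one summation index.
  have key : ∀ J : Fin n → κ, τ (Fin.cons a fun i => g (J i)) - τ (Fin.cons b fun i => g (J i)) =
      - ∑ k ∈ Finset.range n, (-1) ^ k *
      listEval τ ([b, a] ++ (List.ofFn fun i => g (J i)).eraseIdx k) := by
    intro J
    have := sum_listEval_eraseIdx_append hd [b, a] (List.ofFn fun i => g (J i))
    simp only [List.length_cons, List.length_nil, List.length_ofFn] at this
    rw [Finset.sum_range_succ, Finset.sum_range_succ] at this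
    simp only [Finset.range_zero, Finset.sum_empty, List.eraseIdx_cons_zero,
      List.eraseIdx_cons_succ, List.cons_append, List.nil_append, hc] at this
    simp only [List.cons_append, List.nil_append]
    linear_combination this
  rw [← sub_eq_zero, ← Finset.sum_sub_distrib]
  simp only [← sub_smul, key, neg_smul, Finset.sum_neg_distrib]
  rw [h, neg_zero]

/-- Regrouping of a sum over a product of index sets. -/
lemma finsum_smul_multilinear_fiber {n : ℕ} {σ : Type*} [DecidableEq σ]
    (μ : MultilinearMap ℂ (fun _ : Fin n => W) W') (p : κ → σ) (ε : κ → W)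
    (G : (Fin n → σ) → ℂ) :
    ∑ᶠ J : Fin n → σ, G J • μ (fun i => ∑ j, if p j = J i then ε j else 0) =
      ∑ J : Fin n → κ, G (fun i => p (J i)) • μ (fun i => ε (J i)) := by
  classical
  have h : ∀ J : Fin n → σ, G J • μ (fun i => ∑ j, if p j = J i then ε j else 0) =
      ∑ K : Fin n → κ, if J = (fun i => p (K i)) then
        G (fun i => p (K i)) • μ (fun i => ε (K i)) else 0 := by
    intro J
    rw [MultilinearMap.map_sum, Finset.smul_sum]
    refine Finset.sum_congr rfl fun K _ => ?_
    split_ifs with hK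
    · subst hK; simp
    · obtain ⟨i, hi⟩ : ∃ i, p (K i) ≠ J i := by
        by_contra! hc; exact hK (funext hc).symm
      rw [μ.map_coord_zero i (if_neg hi), smul_zero]
  simp only [h]
  rw [finsum_sum_comm]
  · refine Finset.sum_congr rfl fun K _ => ?_
    rw [finsum_eq_single _ (fun i => p (K i))]
    · rw [if_pos rfl]
    · intro J hJ; rw [if_neg hJ]
  · intro K _
    refine (Set.finite_singleton (fun i => p (K i))).subset fun J hJ => ?_
    by_contra hne
    exact hJ (if_neg hne)

end CocycleIdentities

/-! ### The pairing of c_τ with tr P (d_tot P)^{2k} at one point. -/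

section PointwiseChern

open NCForm

variable {V : Type*} [AddCommGroup V] [Module ℝ V] [TopologicalSpace V]
  {A : Type*} [Ring A] [Algebra ℂ A]

variable (V A) in
/-- The inclusion `Λ^*(V^* ⊗ ℂ) → Λ^*(V^* ⊗ ℂ) ⊗ Ω_* A`. -/
noncomputable def VForm.left : CotangentAlg V →ₐ[ℂ] VForm V A :=
  GradedTensorProduct.includeLeft (fun i : ℕ => ⋀[ℂ]^i (V →L[ℝ] ℂ)) (NCForm.degree A)

variable (V A) in
/-- The inclusion `Ω_* A → Λ^*(V^* ⊗ ℂ) ⊗ Ω_* A`. -/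
noncomputable def VForm.right : NCForm A →ₐ[ℂ] VForm V A :=
  GradedTensorProduct.includeRight (fun i : ℕ => ⋀[ℂ]^i (V →L[ℝ] ℂ)) (NCForm.degree A)

lemma VForm.mk_eq (α : CotangentAlg V) (β : NCForm A) :
    VForm.mk α β = VForm.left V A α * VForm.right V A β :=
  (GradedTensorProduct.tmul_one_mul_one_tmul (R := ℂ) (fun i : ℕ => ⋀[ℂ]^i (V →L[ℝ] ℂ))
    (NCForm.degree A) α β).symm

lemma VForm.pair_left_mul_right (f : NCForm A →ₗ[ℂ] ℂ) (α : CotangentAlg V) (β : NCForm A) :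
    VForm.pair f (VForm.left V A α * VForm.right V A β) = f β • α := by
  rw [← VForm.mk_eq]; rfl

lemma VForm.right_mul_left {j i : ℕ} {β : NCForm A} (hβ : β ∈ NCForm.degree A j)
    {α : CotangentAlg V} (hα : α ∈ ⋀[ℂ]^i (V →L[ℝ] ℂ)) :
    VForm.right V A β * VForm.left V A α =
      ((-1) ^ (j * i) : ℂ) • (VForm.left V A α * VForm.right V A β) := by
  have h := GradedTensorProduct.tmul_coe_mul_coe_tmul (R := ℂ)
    (fun i : ℕ => ⋀[ℂ]^i (V →L[ℝ] ℂ)) (NCForm.degree A) 1 ⟨β, hβ⟩ ⟨α, hα⟩ 1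
  rw [one_mul, mul_one] at h
  rw [← VForm.mk_eq]
  refine Eq.trans h ?_
  rw [Units.smul_def, ← Int.cast_smul_eq_zsmul ℂ]
  have : (((-1 : ℤˣ) ^ (j * i) : ℤˣ) : ℤ) = (-1) ^ (j * i) := by
    push_cast; rfl
  rw [this]
  push_cast
  rfl

lemma NCForm.incl_mem (a : A) : incl a ∈ degree A 0 :=
  mk_mem_degree a (by rw [pow_zero]; exact Submodule.one_le.mp le_rfl)

lemma NCForm.d_incl_mem (a : A) : d A (incl a) ∈ degree A 1 := by
  simpa using d_mem (incl_mem a)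

lemma ι_mem_exteriorPower (e : V →L[ℝ] ℂ) :
    ExteriorAlgebra.ι ℂ e ∈ ⋀[ℂ]^1 (V →L[ℝ] ℂ) := by
  rw [ExteriorAlgebra.exteriorPower, pow_one]; exact ⟨e, rfl⟩

lemma VForm.right_mul_left_ι_zero {β : NCForm A} (hβ : β ∈ NCForm.degree A 0) (e : V →L[ℝ] ℂ) :
    VForm.right V A β * VForm.left V A (ExteriorAlgebra.ι ℂ e) =
      VForm.left V A (ExteriorAlgebra.ι ℂ e) * VForm.right V A β := by
  rw [VForm.right_mul_left hβ (ι_mem_exteriorPower e), zero_mul, pow_zero, one_smul]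

lemma VForm.right_mul_left_ι_one {β : NCForm A} (hβ : β ∈ NCForm.degree A 1) (e : V →L[ℝ] ℂ) :
    VForm.right V A β * VForm.left V A (ExteriorAlgebra.ι ℂ e) =
      - (VForm.left V A (ExteriorAlgebra.ι ℂ e) * VForm.right V A β) := by
  rw [VForm.right_mul_left hβ (ι_mem_exteriorPower e), mul_one, pow_one, neg_one_smul]

variable {Γ : Type*} {κ : Type*} [Fintype κ]

/-- The form `∑ τ(a, g_{j₁}, …, g_{jₙ}) ε_{j₁} ∧ ⋯ ∧ ε_{jₙ}`. -/
noncomputable def cochainForm {n : ℕ} (τ : (Fin (n + 1) → Γ) → ℂ) (a : Γ) (g : κ → Γ)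
    (ε : κ → V →L[ℝ] ℂ) : CotangentAlg V :=
  ∑ J : Fin n → κ, τ (Fin.cons a fun i => g (J i)) •
    ExteriorAlgebra.ιMulti ℂ n (fun i => ε (J i))

lemma cochainForm_eq {n : ℕ} {τ : (Fin (n + 1) → Γ) → ℂ} (hd : groupCoboundary τ = 0)
    (a b : Γ) (g : κ → Γ) {ε : κ → V →L[ℝ] ℂ} (hε : ∑ j, ε j = 0) :
    cochainForm τ a g ε = cochainForm τ b g ε :=
  sum_cons_smul_eq hd (ExteriorAlgebra.ιMulti ℂ n (M := V →L[ℝ] ℂ)).toMultilinearMap g hε a b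

variable [Group Γ]

lemma cochainForm_mul_left {n : ℕ} {τ : (Fin (n + 1) → Γ) → ℂ} (hτ : τ ∈ altCochains Γ n)
    (h a : Γ) (g : κ → Γ) (ε : κ → V →L[ℝ] ℂ) :
    cochainForm τ (h * a) (fun j => h * g j) ε = cochainForm τ a g ε := by
  unfold cochainForm
  refine Finset.sum_congr rfl fun J _ => ?_
  rw [← hτ.1 h (Fin.cons a fun i => g (J i))]
  congr 2
  funext i
  refine Fin.cases ?_ (fun i => ?_) i <;> simp

set_option maxHeartbeats 1000000 in
/-- The evaluation of `c_τ` on `tr P (d_tot P)²ᵏ` at a point, where `P` has the entries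
`cᵢ cⱼ gᵢ⁻¹ gⱼ` and where `ℓⱼ` is the differential of `cⱼ`. -/
theorem pair_trace_eq [DecidableEq κ] {n : ℕ} {τ : (Fin (n + 1) → Γ) → ℂ} (hτ : τ ∈ altCochains Γ n)
    (hd : groupCoboundary τ = 0) (g : κ → Γ) (c : κ → ℂ) (ℓ : κ → V →L[ℝ] ℂ)
    (hc : ∑ j, c j ^ 2 = 1) (hℓ : ∑ j, c j • ℓ j = 0) (k : ℕ) :
    VForm.pair (cyclicCochain τ) (Matrix.trace
      ((Matrix.of fun i j => (c i * c j) • VForm.mk (V := V) 1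
          (incl (MonoidAlgebra.single ((g i)⁻¹ * g j) (1 : ℂ)))) *
        (Matrix.of fun i j => VForm.mk (V := V) (ExteriorAlgebra.ι ℂ (c i • ℓ j + c j • ℓ i))
            (incl (MonoidAlgebra.single ((g i)⁻¹ * g j) (1 : ℂ))) +
          (c i * c j) • VForm.mk 1
            (d _ (incl (MonoidAlgebra.single ((g i)⁻¹ * g j) (1 : ℂ))))) ^ (2 * k))) =
    if k = n then ((-1) ^ (n * (n - 1) / 2) * (-1) ^ n : ℂ) •
      cochainForm τ 1 g (fun j => (2 * c j) • ℓ j) else 0 := by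
  set x := VForm.left V (MonoidAlgebra ℂ Γ) with hx
  set y := VForm.right V (MonoidAlgebra ℂ Γ) with hy
  -- The factors of P and their differentials depend on the family `g`, which is translated below
  -- separately for each diagonal entry of the trace.
  let v (g : κ → Γ) (i : κ) := c i • y (incl (MonoidAlgebra.single (g i)⁻¹ 1))
  let w (g : κ → Γ) (i : κ) := c i • y (incl (MonoidAlgebra.single (g i) 1))
  let e (i : κ) := x (ExteriorAlgebra.ι ℂ (ℓ i))
  let a (g : κ → Γ) (i : κ) := e i * y (incl (MonoidAlgebra.single (g i)⁻¹ 1)) +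
    c i • y (d _ (incl (MonoidAlgebra.single (g i)⁻¹ 1)))
  let b (g : κ → Γ) (i : κ) := e i * y (incl (MonoidAlgebra.single (g i) 1)) +
    c i • y (d _ (incl (MonoidAlgebra.single (g i) 1)))
  have he0 : ∀ j a, y (incl a) * e j = e j * y (incl a) := fun j a =>
    VForm.right_mul_left_ι_zero (incl_mem a) _
  have he1 : ∀ j a, y (d _ (incl a)) * e j = - (e j * y (d _ (incl a))) := fun j a =>
    VForm.right_mul_left_ι_one (d_incl_mem a) _
  have hee : ∀ j, e j * e j = 0 := fun j => by
    simp only [e]; rw [← map_mul, ExteriorAlgebra.ι_sq_zero, map_zero]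
  have hce : ∑ j, c j • e j = 0 := by
    simp only [e, ← map_smul, ← map_sum, hℓ, map_zero]
  have hmk : ∀ (g h : Γ), incl (MonoidAlgebra.single (g⁻¹ * h) (1 : ℂ)) =
      incl (MonoidAlgebra.single g⁻¹ 1) * incl (MonoidAlgebra.single h 1) := fun g h => by
    rw [incl_mul, MonoidAlgebra.single_mul_single, one_mul]
  have hP : ∀ g : κ → Γ, (Matrix.of fun i j => (c i * c j) • VForm.mk (V := V) 1
      (incl (MonoidAlgebra.single ((g i)⁻¹ * g j) (1 : ℂ)))) =
      Matrix.of fun i j => v g i * w g j := by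
    intro g
    ext i j
    simp only [Matrix.of_apply, v, w]
    rw [VForm.mk_eq, map_one, one_mul, smul_mul_smul_comm, ← map_mul, hmk]
  have hQ : ∀ g : κ → Γ, (Matrix.of fun i j =>
      VForm.mk (V := V) (ExteriorAlgebra.ι ℂ (c i • ℓ j + c j • ℓ i))
            (incl (MonoidAlgebra.single ((g i)⁻¹ * g j) (1 : ℂ))) +
          (c i * c j) • VForm.mk 1
            (d _ (incl (MonoidAlgebra.single ((g i)⁻¹ * g j) (1 : ℂ))))) =
      Matrix.of fun i j => a g i * w g j + v g i * b g j := by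
    intro g
    ext i j
    simp only [Matrix.of_apply, v, w, a, b]
    have h1 : ∀ a r, y (incl a) * (e j * r) = e j * (y (incl a) * r) := fun a r => by
      rw [← mul_assoc, he0, mul_assoc]
    rw [VForm.mk_eq, VForm.mk_eq, map_one, one_mul, hmk, leibniz_incl, map_add, map_smul,
      map_smul, map_add, map_smul, map_smul, ← hx, ← hy]
    simp only [map_mul, map_add, smul_mul_assoc, mul_smul_comm, add_mul, mul_add, smul_add,
      mul_assoc, h1, mul_smul, smul_comm (c j) (c i)]
    simp only [e]
    abel
  have hwv : ∀ g : κ → Γ, ∑ i, w g i * v g i = 1 := fun g => by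
    simp only [w, v, smul_mul_smul_comm, ← map_mul, incl_single_mul_inv, map_one,
      ← Finset.sum_smul, ← pow_two, hc, one_smul]
  have hθ : ∀ g : κ → Γ, ∑ i, w g i * a g i = ∑ j, c j ^ 2 • y (logForm (g j)) := fun g =>
    connection_eq y e c g he0 hce
  have hbv : ∀ g : κ → Γ, ∑ i, b g i * v g i = - ∑ i, w g i * a g i := fun g => by
    rw [hθ]; exact connection_right_eq y e c g hce
  have hΩ : ∀ g : κ → Γ, ∑ j, b g j * a g j + (∑ j, w g j * a g j) ^ 2 =
      ∑ j, x (ExteriorAlgebra.ι ℂ ((2 * c j) • ℓ j)) * y (logForm (g j)) -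
        ∑ j, c j ^ 2 • y (logForm (g j) * logForm (g j)) +
        (∑ j, c j ^ 2 • y (logForm (g j))) ^ 2 := by
    intro g
    rw [hθ]
    simp only [map_smul]
    rw [← curvature_eq y e c g he0 he1 hee]
  have hval : ∀ g : κ → Γ, VForm.pair (cyclicCochain τ)
      ((∑ j, b g j * a g j + (∑ j, w g j * a g j) ^ 2) ^ k) =
      if k = n then ((-1) ^ (n * (n - 1) / 2) * (-1) ^ n : ℂ) •
        cochainForm τ 1 g (fun j => (2 * c j) • ℓ j) else 0 := by
    intro g
    rw [hΩ, cyclicCochain_curvature_pow y c g hτ x _ (VForm.pair_left_mul_right _)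
      (fun j => ExteriorAlgebra.ι ℂ ((2 * c j) • ℓ j))
      (fun h j => VForm.right_mul_left_ι_one (logForm_mem h) _)]
    rfl
  have hsum : ∀ r : CotangentAlg V, r = ∑ i, c i ^ 2 • r := fun r => by
    rw [← Finset.sum_smul, hc, one_smul]
  rw [Matrix.trace, map_sum]
  refine Eq.trans ?_ (hsum _).symm
  refine Finset.sum_congr rfl fun i _ => ?_
  -- Translating the family by `(g i)⁻¹` does not change P but makes the i-th entries of v and w the
  -- scalar `c i`. The i-th diagonal entry is then `c i ^ 2` times the power of the curvature, with
  -- no group element left outside.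
  let g' : κ → Γ := fun j => (g i)⁻¹ * g j
  have hg' : ∀ i j, (g i)⁻¹ * g j = (g' i)⁻¹ * g' j := fun i j => by simp [g']
  simp only [hg']
  rw [hP g', hQ g', rankOne_mul_pow _ _ _ _ (hwv g') (hbv g'), Matrix.diag_apply, Matrix.of_apply]
  have hi : incl (MonoidAlgebra.single (g' i) (1 : ℂ)) = 1 := by
    rw [show g' i = 1 by simp [g'], ← MonoidAlgebra.one_def, incl_one]
  have hi' : incl (MonoidAlgebra.single (g' i)⁻¹ (1 : ℂ)) = 1 := by
    rw [show g' i = 1 by simp [g'], inv_one, ← MonoidAlgebra.one_def, incl_one]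
  -- The cocycle condition moves the first argument from 1 to `g i`; left invariance then translates
  -- all arguments by `(g i)⁻¹`. So all diagonal entries involve the same form, and the weights add
  -- up to 1.
  have hcoch : cochainForm τ 1 g' (fun j => (2 * c j) • ℓ j) =
      cochainForm τ 1 g (fun j => (2 * c j) • ℓ j) := by
    rw [cochainForm_eq hd 1 (g i) g, ← cochainForm_mul_left hτ (g i)⁻¹ (g i), inv_mul_cancel]
    simp only [mul_smul, ← Finset.smul_sum, hℓ, smul_zero]
  simp only [v, w]
  rw [hi, hi', map_one, smul_mul_assoc, one_mul, mul_smul_comm, mul_one, smul_smul, map_smul,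
    hval, hcoch, pow_two]

end PointwiseChern

/-! ### Sheets of the covering and the function h along orbits. -/

namespace CoverData

open MulOpposite Topology

variable {E : Type*} [NormedAddCommGroup E] [NormedSpace ℝ E]
  {M M' : Type*} [TopologicalSpace M] [ChartedSpace E M] [TopologicalSpace M']
  {π : M' → M} {κ : Type*} [Fintype κ] (D : CoverData E π κ)
  {Γ : Type*} [Group Γ] [MulAction Γᵐᵒᵖ M']

variable (Γ) in
/-- The element `g` with `y · g ∈ Vⱼ` (an arbitrary element if there is none). -/
noncomputable def sheet (y : M') (j : κ) : Γ :=
  Classical.epsilon fun g : Γ => op g • y ∈ D.V j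

lemma smul_mem_unique (hπ : IsQuotientCoveringMap π Γᵐᵒᵖ) {y : M'} {j : κ} {g g' : Γ}
    (h : op g • y ∈ D.V j) (h' : op g' • y ∈ D.V j) : g = g' := by
  have := hπ.isCancelSMul
  have h1 := (D.bijOn j).injOn h h' (by rw [hπ.map_smul, hπ.map_smul])
  exact op_injective (IsCancelSMul.right_cancel _ _ _ h1)

lemma exists_smul_mem (hπ : IsQuotientCoveringMap π Γᵐᵒᵖ) {y : M'} {j : κ}
    (h : π y ∈ D.U j) : ∃ g : Γ, op g • y ∈ D.V j := by
  obtain ⟨z, hz, hzy⟩ := (D.bijOn j).surjOn h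
  obtain ⟨g, hg⟩ := hπ.apply_eq_iff_mem_orbit.mp hzy
  exact ⟨unop g, by simpa only [op_unop, hg] using hz⟩

lemma sheet_smul_mem (hπ : IsQuotientCoveringMap π Γᵐᵒᵖ) {y : M'} {j : κ}
    (h : π y ∈ D.U j) : op (D.sheet Γ y j) • y ∈ D.V j :=
  Classical.epsilon_spec (p := fun g : Γ => op g • y ∈ D.V j) (D.exists_smul_mem hπ h)

lemma sheet_eq (hπ : IsQuotientCoveringMap π Γᵐᵒᵖ) {y : M'} {j : κ} {g : Γ}
    (h : op g • y ∈ D.V j) : D.sheet Γ y j = g :=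
  D.smul_mem_unique hπ (Classical.epsilon_spec (p := fun g : Γ => op g • y ∈ D.V j) ⟨g, h⟩) h

lemma eventually_sheet_eq (hπ : IsQuotientCoveringMap π Γᵐᵒᵖ) {y : M'} {j : κ}
    (h : π y ∈ D.U j) : ∀ᶠ z in 𝓝 y, D.sheet Γ z j = D.sheet Γ y j := by
  have := hπ.toContinuousConstSMul
  have h1 : ∀ᶠ z in 𝓝 y, op (D.sheet Γ y j) • z ∈ D.V j :=
    (continuous_const_smul _).continuousAt.eventually
      ((D.isOpen_V j).mem_nhds (D.sheet_smul_mem hπ h))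
  filter_upwards [h1] with z hz using D.sheet_eq hπ hz

/-- For each g, the points of U_i ∩ U_j over which g carries V_i into V_j form an open set. These
sets are disjoint and cover U_i ∩ U_j, so by connectedness a single g works everywhere. Hence `deck`
is determined by any one point y of the fiber, which yields the factorization of P. -/
lemma sheet_mul_deck (hπ : IsQuotientCoveringMap π Γᵐᵒᵖ) (hopen : IsOpenMap π) {y : M'} {i j : κ}
    (hi : π y ∈ D.U i) (hj : π y ∈ D.U j) :
    D.deck Γ i j = (D.sheet Γ y i)⁻¹ * D.sheet Γ y j := by
  have := hπ.toContinuousConstSMul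
  let W : Γ → Set M := fun g => π '' (D.V i ∩ (fun z => op g • z) ⁻¹' D.V j)
  have hW : ∀ g, IsOpen (W g) := fun g =>
    hopen _ ((D.isOpen_V i).inter ((D.isOpen_V j).preimage (continuous_const_smul _)))
  have hcov : ∀ x ∈ D.U i ∩ D.U j, ∃ g, x ∈ W g := by
    rintro x ⟨hxi, hxj⟩
    obtain ⟨z, hz, rfl⟩ := (D.bijOn i).surjOn hxi
    obtain ⟨g, hg⟩ := D.exists_smul_mem hπ hxj
    exact ⟨g, z, ⟨hz, hg⟩, rfl⟩
  have huniq : ∀ x g g', x ∈ W g → x ∈ W g' → g = g' := by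
    rintro x g g' ⟨z, ⟨hz, hzg⟩, rfl⟩ ⟨z', ⟨hz', hzg'⟩, h⟩
    obtain rfl := (D.bijOn i).injOn hz' hz h
    exact D.smul_mem_unique hπ hzg hzg'
  obtain ⟨g₀, hg₀⟩ := hcov _ ⟨hi, hj⟩
  have hsub : D.U i ∩ D.U j ⊆ W g₀ := by
    refine (D.isPreconnected_inter i j).subset_left_of_subset_union (hW g₀)
      (isOpen_iUnion fun g : {g // g ≠ g₀} => hW g.1) ?_ ?_ ⟨_, ⟨hi, hj⟩, hg₀⟩
    · rw [Set.disjoint_left]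
      rintro x h1 h2
      obtain ⟨⟨g, hg⟩, h3⟩ := Set.mem_iUnion.mp h2
      exact hg (huniq x _ _ h3 h1)
    · intro x hx
      obtain ⟨g, hg⟩ := hcov x hx
      by_cases h : g = g₀
      · exact Or.inl (h ▸ hg)
      · exact Or.inr (Set.mem_iUnion.mpr ⟨⟨g, h⟩, hg⟩)
  have hex : ∃ g : Γ, ∀ z ∈ D.V i, π z ∈ D.U j → op g • z ∈ D.V j := by
    refine ⟨g₀, fun z hz hzj => ?_⟩
    obtain ⟨z', ⟨hz', hzg'⟩, h⟩ := hsub ⟨(D.bijOn i).mapsTo hz, hzj⟩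
    obtain rfl := (D.bijOn i).injOn hz' hz h
    exact hzg'
  have h1 := Classical.epsilon_spec hex _ (D.sheet_smul_mem hπ hi) (by rwa [hπ.map_smul])
  rw [smul_smul, ← op_mul] at h1
  rw [D.sheet_eq hπ h1, inv_mul_cancel_left]
  rfl

/-- The function `χⱼ²`, with complex values. -/
noncomputable def sqχ (j : κ) : M → ℂ := fun x => ((D.χ j x ^ 2 : ℝ) : ℂ)

lemma contMDiff_ofReal_χ (j : κ) : ContMDiff 𝓘(ℝ, E) 𝓘(ℝ, ℂ) ∞ fun x => (D.χ j x : ℂ) :=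
  Complex.ofRealCLM.contDiff.contMDiff.comp (D.contMDiff_χ j)

lemma contMDiff_sqχ (j : κ) : ContMDiff 𝓘(ℝ, E) 𝓘(ℝ, ℂ) ∞ (D.sqχ j) := by
  have h : ContDiff ℝ ∞ fun t : ℝ => ((t ^ 2 : ℝ) : ℂ) :=
    Complex.ofRealCLM.contDiff.comp (contDiff_id.pow 2)
  exact h.contMDiff.comp (D.contMDiff_χ j)

lemma sum_sqχ (x : M) : ∑ j, D.sqχ j x = 1 := by
  simp only [sqχ]
  rw [← Complex.ofReal_sum, D.sum_sq_χ, Complex.ofReal_one]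

lemma eventually_χ_eq_zero {x : M} {j : κ} (h : x ∉ tsupport (D.χ j)) :
    ∀ᶠ z in 𝓝 x, D.χ j z = 0 := by
  filter_upwards [(isClosed_tsupport (D.χ j)).isOpen_compl.mem_nhds h] with z hz
  exact image_eq_zero_of_notMem_tsupport hz

-- Over U_j the point y·g lies in V_j exactly when g is the sheet. Elsewhere `sheet` is an arbitrary
-- element, but there χ_j vanishes.
open Classical in
lemma h_smul (hπ : IsQuotientCoveringMap π Γᵐᵒᵖ) (g : Γ) (y : M') :
    D.h (op g • y) = ∑ j, if D.sheet Γ y j = g then D.sqχ j (π y) else 0 := by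
  unfold h
  refine Finset.sum_congr rfl fun j _ => ?_
  by_cases hg : op g • y ∈ D.V j
  · rw [Set.indicator_of_mem hg, if_pos (D.sheet_eq hπ hg), hπ.map_smul, sqχ]
  · rw [Set.indicator_of_notMem hg]
    split_ifs with h1
    · have h2 : π y ∉ D.U j := fun h3 => hg (h1 ▸ D.sheet_smul_mem hπ h3)
      have h4 : D.χ j (π y) = 0 :=
        image_eq_zero_of_notMem_tsupport fun h5 => h2 (D.tsupport_χ j h5)
      rw [sqχ, h4]
    · simp

/-- If π y lies in the support of χ_j, hence in the open set U_j, the sheet is locally constant;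
otherwise χ_j vanishes near π y. The neighbourhood serves all deck transformations at once. -/
lemma eventually_sheet_eq_or (hπ : IsQuotientCoveringMap π Γᵐᵒᵖ) (y : M') :
    ∀ᶠ z in 𝓝 y, ∀ j, D.sheet Γ z j = D.sheet Γ y j ∨ D.sqχ j (π z) = 0 := by
  refine Filter.eventually_all.mpr fun j => ?_
  by_cases hj : π y ∈ tsupport (D.χ j)
  · filter_upwards [D.eventually_sheet_eq (Γ := Γ) hπ (D.tsupport_χ j hj)] with z hz
    exact Or.inl hz
  · filter_upwards [hπ.continuous.continuousAt.eventually (D.eventually_χ_eq_zero hj)] with z hz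
    right; simp [sqχ, hz]

open Classical in
lemma eventually_h_smul (hπ : IsQuotientCoveringMap π Γᵐᵒᵖ) (y : M') :
    ∀ᶠ z in 𝓝 y, ∀ g : Γ, D.h (op g • z) =
      ∑ j, if D.sheet Γ y j = g then D.sqχ j (π z) else 0 := by
  filter_upwards [D.eventually_sheet_eq_or (Γ := Γ) hπ y] with z hz g
  rw [D.h_smul hπ]
  refine Finset.sum_congr rfl fun j _ => ?_
  rcases hz j with h | h <;> simp [h]

end CoverData

/-! ### Pullback of covectors and derivatives of complex functions. -/

section Comap

variable {V W : Type*} [AddCommGroup V] [Module ℝ V] [TopologicalSpace V]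
  [AddCommGroup W] [Module ℝ W] [TopologicalSpace W]

lemma CotangentAlg.comap_ι (L : V →L[ℝ] W) (φ : W →L[ℝ] ℂ) :
    CotangentAlg.comap L (ExteriorAlgebra.ι ℂ φ) = ExteriorAlgebra.ι ℂ (φ.comp L) :=
  ExteriorAlgebra.map_apply_ι _ _

lemma CotangentAlg.comap_ιMulti (L : V →L[ℝ] W) {n : ℕ} (φ : Fin n → W →L[ℝ] ℂ) :
    CotangentAlg.comap L (ExteriorAlgebra.ιMulti ℂ n φ) =
      ExteriorAlgebra.ιMulti ℂ n fun i => (φ i).comp L :=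
  ExteriorAlgebra.map_apply_ιMulti _ _

lemma CotangentAlg.comap_comap {U : Type*} [AddCommGroup U] [Module ℝ U] [TopologicalSpace U]
    (L : V →L[ℝ] W) (K : U →L[ℝ] V) (w : CotangentAlg W) :
    CotangentAlg.comap K (CotangentAlg.comap L w) = CotangentAlg.comap (L.comp K) w := by
  have : (CotangentAlg.comap K).comp (CotangentAlg.comap L) = CotangentAlg.comap (L.comp K) := by
    refine ExteriorAlgebra.hom_ext (LinearMap.ext fun φ => ?_)
    change CotangentAlg.comap K (CotangentAlg.comap L (ExteriorAlgebra.ι ℂ φ)) =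
      CotangentAlg.comap (L.comp K) (ExteriorAlgebra.ι ℂ φ)
    rw [comap_ι, comap_ι, comap_ι]
    rfl
  exact congr($this w)

lemma CotangentAlg.comap_id (w : CotangentAlg V) :
    CotangentAlg.comap (ContinuousLinearMap.id ℝ V) w = w := by
  have : CotangentAlg.comap (ContinuousLinearMap.id ℝ V) = AlgHom.id ℂ _ := by
    refine ExteriorAlgebra.hom_ext (LinearMap.ext fun φ => ?_)
    change CotangentAlg.comap _ (ExteriorAlgebra.ι ℂ φ) = ExteriorAlgebra.ι ℂ φ
    rw [comap_ι]
    rfl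
  exact congr($this w)

lemma CotangentAlg.comap_equiv_injective (L : V ≃L[ℝ] W) :
    Function.Injective (CotangentAlg.comap (L : V →L[ℝ] W)) := by
  refine Function.LeftInverse.injective (g := CotangentAlg.comap (L.symm : W →L[ℝ] V)) fun w => ?_
  rw [comap_comap, ContinuousLinearEquiv.coe_comp_coe_symm, comap_id]

lemma comap_cochainForm {Γ κ : Type*} [Fintype κ] {n : ℕ} (τ : (Fin (n + 1) → Γ) → ℂ)
    (a : Γ) (g : κ → Γ) (ε : κ → W →L[ℝ] ℂ) (L : V →L[ℝ] W) :
    CotangentAlg.comap L (cochainForm τ a g ε) = cochainForm τ a g fun j => (ε j).comp L := by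
  simp only [cochainForm, map_sum, map_smul, CotangentAlg.comap_ιMulti]

end Comap

section ComplexValued

variable {E : Type*} [NormedAddCommGroup E] [NormedSpace ℝ E]
  {M M' : Type*} [TopologicalSpace M] [ChartedSpace E M] [TopologicalSpace M'] [ChartedSpace E M']

lemma mvfderiv_complex_comp {f : M → ℂ} {F : M' → M} (y : M')
    (hf : MDifferentiableAt 𝓘(ℝ, E) 𝓘(ℝ, ℂ) f (F y))
    (hF : MDifferentiableAt 𝓘(ℝ, E) 𝓘(ℝ, E) F y) :
    mvfderiv 𝓘(ℝ, E) (f ∘ F) y =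
      (mvfderiv 𝓘(ℝ, E) f (F y)).comp (mfderiv 𝓘(ℝ, E) 𝓘(ℝ, E) F y) :=
  mfderiv_comp y hf hF

lemma mvfderiv_congr {f g : M → ℂ} {x : M} (h : f =ᶠ[nhds x] g) :
    mvfderiv 𝓘(ℝ, E) f x = mvfderiv 𝓘(ℝ, E) g x := by
  ext v
  exact DFunLike.congr_fun h.mfderiv_eq v

lemma mvfderiv_finset_sum {κ : Type*} {F : κ → M → ℂ} {x : M}
    (hF : ∀ j, MDifferentiableAt 𝓘(ℝ, E) 𝓘(ℝ, ℂ) (F j) x) (s : Finset κ) :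
    MDifferentiableAt 𝓘(ℝ, E) 𝓘(ℝ, ℂ) (fun z => ∑ j ∈ s, F j z) x ∧
    mvfderiv 𝓘(ℝ, E) (fun z => ∑ j ∈ s, F j z) x = ∑ j ∈ s, mvfderiv 𝓘(ℝ, E) (F j) x := by
  classical
  induction s using Finset.induction_on with
  | empty => exact ⟨by simpa using mdifferentiableAt_const, by simpa using mvfderiv_const _⟩
  | insert j s hj ih =>
    have h : (fun z => ∑ j ∈ insert j s, F j z) = F j + fun z => ∑ j ∈ s, F j z := by
      funext z; simp [hj]
    rw [h]
    exact ⟨(hF j).add ih.1, by rw [mvfderiv_add (hF j) ih.1, ih.2, Finset.sum_insert hj]⟩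

end ComplexValued

/-! ### The lifted form as a pullback from M. -/

namespace CoverData

open MulOpposite Topology

variable {E : Type*} [NormedAddCommGroup E] [NormedSpace ℝ E]
  {M M' : Type*} [TopologicalSpace M] [ChartedSpace E M] [TopologicalSpace M']
  {π : M' → M} {κ : Type*} [Fintype κ] (D : CoverData E π κ)
  {Γ : Type*} [Group Γ] [MulAction Γᵐᵒᵖ M']

/-- The differential of `χⱼ²` at `x`. -/
noncomputable def dsqχ (x : M) (j : κ) : TangentSpace 𝓘(ℝ, E) x →L[ℝ] ℂ :=
  mvfderiv 𝓘(ℝ, E) (D.sqχ j) x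

lemma mdifferentiableAt_sqχ (j : κ) (x : M) :
    MDifferentiableAt 𝓘(ℝ, E) 𝓘(ℝ, ℂ) (D.sqχ j) x :=
  (D.contMDiff_sqχ j).mdifferentiableAt (by simp)

lemma sum_dsqχ (x : M) : ∑ j, D.dsqχ x j = 0 := by
  unfold dsqχ
  rw [← (mvfderiv_finset_sum (fun j => D.mdifferentiableAt_sqχ j x) Finset.univ).2]
  simp only [sum_sqχ]
  exact mvfderiv_const _

variable [ChartedSpace E M']

/-- Differentiability of the action is forced: near y it is the local inverse of π at g·y composed
with π. -/
lemma mdifferentiableAt_smul [IsManifold 𝓘(ℝ, E) ∞ M] [IsManifold 𝓘(ℝ, E) ∞ M']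
    (hπ : IsQuotientCoveringMap π Γᵐᵒᵖ)
    (hπ' : IsLocalDiffeomorph 𝓘(ℝ, E) 𝓘(ℝ, E) ∞ π) (g : Γᵐᵒᵖ) (y : M') :
    MDifferentiableAt 𝓘(ℝ, E) 𝓘(ℝ, E) (fun z : M' => g • z) y := by
  have := hπ.toContinuousConstSMul
  have h := hπ' (g • y)
  have h1 : (fun z : M' => g • z) =ᶠ[𝓝 y] h.localInverse ∘ π := by
    filter_upwards [(continuous_const_smul g).continuousAt.eventually
      h.localInverse_eventuallyEq_left] with z hz
    simp only [Function.comp_apply, hπ.map_smul, id] at hz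
    exact hz.symm
  refine MDifferentiableAt.congr_of_eventuallyEq ?_ h1
  refine MDifferentiableAt.comp y ?_ (hπ'.mdifferentiable (by simp) y)
  have h2 := h.localInverse_mdifferentiableAt (by simp)
  rwa [hπ.map_smul] at h2

open Classical in
lemma pullback_dFun_h [IsManifold 𝓘(ℝ, E) ∞ M] [IsManifold 𝓘(ℝ, E) ∞ M']
    (hπ : IsQuotientCoveringMap π Γᵐᵒᵖ)
    (hπ' : IsLocalDiffeomorph 𝓘(ℝ, E) 𝓘(ℝ, E) ∞ π) (g : Γ) (y : M') :
    MForm.pullback (fun z : M' => op g • z) (MForm.dFun E D.h) y =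
      ExteriorAlgebra.ι ℂ (∑ j, if D.sheet Γ y j = g then
        (D.dsqχ (π y) j).comp (mfderiv 𝓘(ℝ, E) 𝓘(ℝ, E) π y) else 0) := by
  have hπy := hπ'.mdifferentiable (by simp) y
  have hsum : ∀ (y : M') (g : Γ), (fun z => D.h (op g • z)) =ᶠ[𝓝 y]
      (fun x => ∑ j ∈ {j | D.sheet Γ y j = g}, D.sqχ j x) ∘ π := fun y g => by
    filter_upwards [D.eventually_h_smul hπ y] with z hz
    rw [hz, Function.comp_apply, Finset.sum_filter]
  have hs := fun y g => mvfderiv_finset_sum (fun j => D.mdifferentiableAt_sqχ j (π y))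
    {j | D.sheet Γ y j = g}
  have hh : ∀ y, MDifferentiableAt 𝓘(ℝ, E) 𝓘(ℝ, ℂ) D.h y := by
    intro y
    have h1 := hsum y 1
    simp only [op_one, one_smul] at h1
    exact ((hs y 1).1.comp y (hπ'.mdifferentiable (by simp) y)).congr_of_eventuallyEq h1
  rw [MForm.pullback, MForm.dFun, CotangentAlg.comap_ι]
  congr 1
  have h2 := mvfderiv_complex_comp y (hh (op g • y))
    (mdifferentiableAt_smul hπ hπ' (op g) y)
  rw [← h2]
  have h3 : mvfderiv 𝓘(ℝ, E) (D.h ∘ fun z => op g • z) y =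
      mvfderiv 𝓘(ℝ, E) ((fun x => ∑ j ∈ {j | D.sheet Γ y j = g}, D.sqχ j x) ∘ π) y :=
    mvfderiv_congr (hsum y g)
  rw [h3, mvfderiv_complex_comp y (hs y g).1 hπy, (hs y g).2, Finset.sum_filter]
  ext v
  simp only [ContinuousLinearMap.comp_apply, sum_apply]
  refine Finset.sum_congr rfl fun j _ => ?_
  split_ifs <;> rfl

/-- The form R_g^* dh collects the d(χ_j²) with sheet g. Expanding the products multilinearly turns
the sum over Γⁿ into a finite sum over indices of the cover. -/
lemma liftedForm_eq [IsManifold 𝓘(ℝ, E) ∞ M] [IsManifold 𝓘(ℝ, E) ∞ M']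
    (hπ : IsQuotientCoveringMap π Γᵐᵒᵖ)
    (hπ' : IsLocalDiffeomorph 𝓘(ℝ, E) 𝓘(ℝ, E) ∞ π) {n : ℕ} (τ : (Fin (n + 1) → Γ) → ℂ) (y : M') :
    D.liftedForm τ y = CotangentAlg.comap (mfderiv 𝓘(ℝ, E) 𝓘(ℝ, E) π y)
      (cochainForm τ 1 (D.sheet Γ y) (D.dsqχ (π y))) := by
  classical
  rw [comap_cochainForm, liftedForm]
  simp only [D.pullback_dFun_h hπ hπ']
  exact finsum_smul_multilinear_fiber (ExteriorAlgebra.ιMulti ℂ n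
    (M := TangentSpace 𝓘(ℝ, E) y →L[ℝ] ℂ)).toMultilinearMap (D.sheet Γ y)
    (fun j => (D.dsqχ (π y) j).comp (mfderiv 𝓘(ℝ, E) 𝓘(ℝ, E) π y)) fun J => τ (Fin.cons 1 J)

end CoverData

/-! ### Smoothness and closedness of df₁ ∧ ⋯ ∧ dfₙ. -/

section WedgeEval

lemma wedgeEval_apply {V : Type*} [AddCommGroup V] [Module ℝ V] [TopologicalSpace V] {n : ℕ}
    (φ : Fin n → V →L[ℝ] ℂ) (v : Fin n → V) :
    wedgeEval n φ v = Matrix.det (Matrix.of fun i j => φ i (v j)) := rfl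

lemma wedgeEval_comp {V W : Type*} [AddCommGroup V] [Module ℝ V] [TopologicalSpace V]
    [AddCommGroup W] [Module ℝ W] [TopologicalSpace W] {n : ℕ}
    (φ : Fin n → W →L[ℝ] ℂ) (L : V →L[ℝ] W) :
    (wedgeEval n φ).compContinuousLinearMap L = wedgeEval n fun i => (φ i).comp L := rfl

lemma CotangentAlg.alt_ιMulti {V : Type*} [AddCommGroup V] [Module ℝ V] [TopologicalSpace V]
    (p : ℕ) {n : ℕ} (φ : Fin n → V →L[ℝ] ℂ) (h : p ≠ n) :
    CotangentAlg.alt p (ExteriorAlgebra.ιMulti ℂ n φ) = 0 := by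
  rw [CotangentAlg.alt, ExteriorAlgebra.liftAlternating_apply_ιMulti, Pi.single_eq_of_ne h.symm]
  rfl

lemma CotangentAlg.alt_ιMulti_self {V : Type*} [AddCommGroup V] [Module ℝ V] [TopologicalSpace V]
    {n : ℕ} (φ : Fin n → V →L[ℝ] ℂ) :
    CotangentAlg.alt n (ExteriorAlgebra.ιMulti ℂ n φ) = wedgeEval n φ := by
  rw [CotangentAlg.alt, ExteriorAlgebra.liftAlternating_apply_ιMulti, Pi.single_eq_same]

variable {E : Type*} [NormedAddCommGroup E] [NormedSpace ℝ E]

lemma norm_wedgeEval_le (n : ℕ) (φ : Fin n → E →L[ℝ] ℂ) :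
    ‖wedgeEval n φ‖ ≤ n.factorial * ∏ i, ‖φ i‖ := by
  refine ContinuousAlternatingMap.opNorm_le_bound _ (by positivity) fun v => ?_
  rw [wedgeEval_apply, Matrix.det_apply']
  refine (norm_sum_le _ _).trans ?_
  have h : ∀ σ ∈ (Finset.univ : Finset (Equiv.Perm (Fin n))),
      ‖((Equiv.Perm.sign σ : ℤ) : ℂ) * ∏ i, Matrix.of (fun i j => φ i (v j)) (σ i) i‖ ≤
      (∏ i, ‖φ i‖) * ∏ i, ‖v i‖ := by
    intro σ _
    rw [norm_mul, norm_prod]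
    have h1 : ‖((Equiv.Perm.sign σ : ℤ) : ℂ)‖ = 1 := by
      rcases Int.units_eq_one_or (Equiv.Perm.sign σ) with h | h <;> simp [h]
    rw [h1, one_mul, ← Equiv.prod_comp σ (fun i => ‖φ i‖), ← Finset.prod_mul_distrib]
    exact Finset.prod_le_prod (fun _ _ => norm_nonneg _) fun i _ => (φ (σ i)).le_opNorm _
  refine (Finset.sum_le_sum h).trans ?_
  rw [Finset.sum_const, Finset.card_univ, Fintype.card_perm, Fintype.card_fin, nsmul_eq_mul,
    mul_assoc]

variable (E) in
/-- The map `(φ₁, …, φₙ) ↦ φ₁ ∧ ⋯ ∧ φₙ` as a continuous multilinear map. -/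
noncomputable def wedgeEvalCLM (n : ℕ) :
    ContinuousMultilinearMap ℝ (fun _ : Fin n => E →L[ℝ] ℂ) (E [⋀^Fin n]→L[ℝ] ℂ) :=
  MultilinearMap.mkContinuous
    { toFun := fun φ => wedgeEval n φ
      map_update_add' := fun φ i x y => (wedgeEval n).map_update_add φ i x y
      map_update_smul' := fun φ i c x => by
        have h := (wedgeEval n).map_update_smul φ i (c : ℂ) x
        rwa [Complex.coe_smul, Complex.coe_smul] at h }
    n.factorial fun φ => norm_wedgeEval_le n φ

/-- The form `df₁ ∧ ⋯ ∧ dfₙ` on a normed space. -/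
noncomputable def wedgeFDeriv {n : ℕ} (f : Fin n → E → ℂ) (x : E) : E [⋀^Fin n]→L[ℝ] ℂ :=
  wedgeEval n fun i => fderiv ℝ (f i) x

lemma contDiffAt_wedgeFDeriv {n : ℕ} {f : Fin n → E → ℂ} {x : E}
    (hf : ∀ i, ContDiffAt ℝ ∞ (f i) x) : ContDiffAt ℝ ∞ (wedgeFDeriv f) x := by
  have h : ContDiffAt ℝ ∞ (fun x i => fderiv ℝ (f i) x) x :=
    contDiffAt_pi.mpr fun i => (hf i).fderiv_right (by simp)
  exact (wedgeEvalCLM E n).contDiff.contDiffAt.comp x h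

lemma two_le_infty : (2 : WithTop ℕ∞) ≤ ∞ :=
  WithTop.coe_le_coe.mpr (le_top : (2 : ℕ∞) ≤ ⊤)

/-- The form is the pullback of the constant form dz₁ ∧ ⋯ ∧ dzₙ on ℂⁿ along (f₁, …, fₙ), and d
commutes with pullbacks. -/
lemma extDeriv_wedgeFDeriv {n : ℕ} {f : Fin n → E → ℂ} {x : E}
    (hf : ∀ i, ContDiffAt ℝ ∞ (f i) x) : extDeriv (wedgeFDeriv f) x = 0 := by
  have hF : ContDiffAt ℝ ∞ (fun x i => f i x) x := contDiffAt_pi.mpr hf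
  let η : (Fin n → ℂ) [⋀^Fin n]→L[ℝ] ℂ :=
    wedgeEval n fun i => (ContinuousLinearMap.proj i : (Fin n → ℂ) →L[ℝ] ℂ)
  have h0 : extDeriv (fun _ : Fin n → ℂ => η) (fun i => f i x) = 0 := by
    rw [extDeriv]
    ext v
    simp [ContinuousAlternatingMap.alternatizeUncurryFin_apply]
  have h1 : extDeriv (fun z => η.compContinuousLinearMap (fderiv ℝ (fun z i => f i z) z)) x =
      (extDeriv (fun _ : Fin n → ℂ => η) (fun i => f i x)).compContinuousLinearMap
        (fderiv ℝ (fun z i => f i z) x) :=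
    extDeriv_pullback (differentiableAt_const η) hF
      (by rw [minSmoothness_of_isRCLikeNormedField]; exact two_le_infty)
  rw [h0] at h1
  refine Eq.trans (Filter.EventuallyEq.extDeriv_eq ?_) h1
  have h2 : ∀ᶠ z in nhds x, ∀ i, ContDiffAt ℝ 1 (f i) z :=
    Filter.eventually_all.mpr fun i => ((hf i).of_le (by simp)).eventually (by simp)
  filter_upwards [h2] with z hz
  rw [wedgeEval_comp, wedgeFDeriv]
  congr 1
  funext i
  have := fderiv_pi (𝕜 := ℝ) (φ := f) (x := z) fun i => (hz i).differentiableAt (by simp)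
  change fderiv ℝ (f i) z = (ContinuousLinearMap.proj i).comp (fderiv ℝ (fun x i => f i x) z)
  rw [this]
  ext v
  rfl

end WedgeEval

/-! ### The Chern form of P on M. -/

namespace CoverData

open MulOpposite Topology

variable {E : Type*} [NormedAddCommGroup E] [NormedSpace ℝ E]
  {M M' : Type*} [TopologicalSpace M] [ChartedSpace E M] [TopologicalSpace M']
  {π : M' → M} {κ : Type*} [Fintype κ] (D : CoverData E π κ)
  {Γ : Type*} [Group Γ] [MulAction Γᵐᵒᵖ M']

lemma mvfderiv_ofReal_χ_eq_zero {x : M} {j : κ} (h : x ∉ tsupport (D.χ j)) :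
    mvfderiv 𝓘(ℝ, E) (fun x => (D.χ j x : ℂ)) x = 0 := by
  have h1 : (fun x => (D.χ j x : ℂ)) =ᶠ[𝓝 x] fun _ => 0 := by
    filter_upwards [D.eventually_χ_eq_zero h] with z hz
    rw [hz, Complex.ofReal_zero]
  rw [mvfderiv_congr h1]
  exact mvfderiv_const _

lemma mvfderiv_complex_mul {f g : M → ℂ} {x : M}
    (hf : MDifferentiableAt 𝓘(ℝ, E) 𝓘(ℝ, ℂ) f x) (hg : MDifferentiableAt 𝓘(ℝ, E) 𝓘(ℝ, ℂ) g x) :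
    mvfderiv 𝓘(ℝ, E) (fun x => f x * g x) x =
      f x • mvfderiv 𝓘(ℝ, E) g x + g x • mvfderiv 𝓘(ℝ, E) f x := by
  have h := (hf.hasMFDerivAt.mul hg.hasMFDerivAt).mfderiv
  ext v
  exact DFunLike.congr_fun h v

lemma mdifferentiableAt_ofReal_χ (j : κ) (x : M) :
    MDifferentiableAt 𝓘(ℝ, E) 𝓘(ℝ, ℂ) (fun x => (D.χ j x : ℂ)) x :=
  (D.contMDiff_ofReal_χ j).mdifferentiableAt (by simp)

lemma dsqχ_eq (x : M) (j : κ) : D.dsqχ x j =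
    (2 * (D.χ j x : ℂ)) • mvfderiv 𝓘(ℝ, E) (fun x => (D.χ j x : ℂ)) x := by
  have h : D.sqχ j = fun x => (D.χ j x : ℂ) * (D.χ j x : ℂ) := by
    funext x; simp [sqχ, pow_two]
  rw [dsqχ, h, mvfderiv_complex_mul (D.mdifferentiableAt_ofReal_χ j x)
    (D.mdifferentiableAt_ofReal_χ j x), two_mul, add_smul]

lemma dsqχ_eq_zero {x : M} {j : κ} (h : x ∉ tsupport (D.χ j)) : D.dsqχ x j = 0 := by
  rw [dsqχ_eq, D.mvfderiv_ofReal_χ_eq_zero h, smul_zero]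

lemma pairForm_chernForm [DecidableEq κ] (hπ : IsQuotientCoveringMap π Γᵐᵒᵖ) (hopen : IsOpenMap π)
    {n : ℕ} {τ : (Fin (n + 1) → Γ) → ℂ} (hτ : τ ∈ altCochains Γ n) (hd : groupCoboundary τ = 0)
    (y : M') :
    pairForm (cyclicCochain τ) (chernForm (D.proj Γ)) (π y) =
      ((-1) ^ (n * (n - 1) / 2) * ((2 * Real.pi * Complex.I) ^ n * n.factorial)⁻¹ : ℂ) •
        cochainForm τ 1 (D.sheet Γ y) (D.dsqχ (π y)) := by
  have hc : ∑ j, (D.χ j (π y) : ℂ) ^ 2 = 1 := by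
    have := D.sum_sqχ (π y)
    simpa only [sqχ, Complex.ofReal_pow] using this
  -- Half of d(∑ χ_j²) = 0.
  have hℓ : ∑ j, (D.χ j (π y) : ℂ) • mvfderiv 𝓘(ℝ, E) (fun x => (D.χ j x : ℂ)) (π y) = 0 := by
    have := D.sum_dsqχ (π y)
    simp only [dsqχ_eq, mul_smul, ← Finset.smul_sum] at this
    exact (smul_eq_zero.mp this).resolve_left two_ne_zero
  -- Outside U_j the sheet is arbitrary and need not be related to `deck`. As χ_j and its
  -- differential vanish there, the entries of P and d_tot P have the form required by
  -- `pair_trace_eq` nevertheless.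
  have hzero : ∀ j, π y ∉ D.U j → D.χ j (π y) = 0 ∧
      mvfderiv 𝓘(ℝ, E) (fun x => (D.χ j x : ℂ)) (π y) = 0 := fun j hj => by
    have hj' : π y ∉ tsupport (D.χ j) := fun h => hj (D.tsupport_χ j h)
    exact ⟨(D.eventually_χ_eq_zero hj').self_of_nhds, D.mvfderiv_ofReal_χ_eq_zero hj'⟩
  have hP : ((D.proj Γ).map inclTot).map (Pi.evalRingHom _ (π y)) =
      Matrix.of fun i j => ((D.χ i (π y) : ℂ) * (D.χ j (π y) : ℂ)) •
        VForm.mk (V := TangentSpace 𝓘(ℝ, E) (π y)) 1 (NCForm.incl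
          (MonoidAlgebra.single ((D.sheet Γ y i)⁻¹ * D.sheet Γ y j) (1 : ℂ))) := by
    ext i j
    change ((D.χ i (π y) * D.χ j (π y) : ℝ) : ℂ) • VForm.mk 1 (NCForm.incl
          (MonoidAlgebra.single (D.deck Γ i j) (1 : ℂ))) = _
    rw [Matrix.of_apply, Complex.ofReal_mul]
    by_cases hi : π y ∈ D.U i
    · by_cases hj : π y ∈ D.U j
      · rw [D.sheet_mul_deck hπ hopen hi hj]
      · simp [(hzero j hj).1]
    · simp [(hzero i hi).1]
  have hQ : ((D.proj Γ).map dTot).map (Pi.evalRingHom _ (π y)) =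
      Matrix.of fun i j => VForm.mk (V := TangentSpace 𝓘(ℝ, E) (π y)) (ExteriorAlgebra.ι ℂ
        ((D.χ i (π y) : ℂ) • mvfderiv 𝓘(ℝ, E) (fun x => (D.χ j x : ℂ)) (π y) +
          (D.χ j (π y) : ℂ) • mvfderiv 𝓘(ℝ, E) (fun x => (D.χ i x : ℂ)) (π y)))
            (NCForm.incl (MonoidAlgebra.single ((D.sheet Γ y i)⁻¹ * D.sheet Γ y j) (1 : ℂ))) +
          ((D.χ i (π y) : ℂ) * (D.χ j (π y) : ℂ)) • VForm.mk 1
            (NCForm.d _ (NCForm.incl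
              (MonoidAlgebra.single ((D.sheet Γ y i)⁻¹ * D.sheet Γ y j) (1 : ℂ)))) := by
    ext i j
    change VForm.mk (ExteriorAlgebra.ι ℂ (mvfderiv 𝓘(ℝ, E)
        (fun x => ((D.χ i x * D.χ j x : ℝ) : ℂ)) (π y)))
        (NCForm.incl (MonoidAlgebra.single (D.deck Γ i j) (1 : ℂ))) +
      ((D.χ i (π y) * D.χ j (π y) : ℝ) : ℂ) • VForm.mk 1 (NCForm.d _ (NCForm.incl
          (MonoidAlgebra.single (D.deck Γ i j) (1 : ℂ)))) = _
    simp only [Complex.ofReal_mul]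
    rw [Matrix.of_apply, mvfderiv_complex_mul (D.mdifferentiableAt_ofReal_χ i _)
      (D.mdifferentiableAt_ofReal_χ j _)]
    by_cases hi : π y ∈ D.U i
    · by_cases hj : π y ∈ D.U j
      · rw [D.sheet_mul_deck hπ hopen hi hj]
      · simp [(hzero j hj).1, (hzero j hj).2]
    · simp [(hzero i hi).1, (hzero i hi).2]
  have hk : ∀ k, VForm.pair (cyclicCochain τ) (chernForm (D.proj Γ) k (π y)) =
      if k = n then ((-1) ^ (n * (n - 1) / 2) *
        ((2 * Real.pi * Complex.I) ^ n * n.factorial)⁻¹ : ℂ) •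
        cochainForm τ 1 (D.sheet Γ y) (D.dsqχ (π y)) else 0 := by
    intro k
    have h1 : Matrix.trace ((D.proj Γ).map inclTot * ((D.proj Γ).map dTot) ^ (2 * k)) (π y) =
        Matrix.trace (((D.proj Γ).map inclTot).map (Pi.evalRingHom _ (π y)) *
          (((D.proj Γ).map dTot).map (Pi.evalRingHom _ (π y))) ^ (2 * k)) := by
      have h2 := AddMonoidHom.map_trace (Pi.evalRingHom _ (π y))
        ((D.proj Γ).map inclTot * ((D.proj Γ).map dTot) ^ (2 * k))
      refine h2.trans ?_
      rw [Matrix.map_mul, ← RingHom.mapMatrix_apply, ← RingHom.mapMatrix_apply, map_pow]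
      rfl
    rw [chernForm, Pi.smul_apply, map_smul, h1, hP, hQ,
      pair_trace_eq hτ hd (D.sheet Γ y) (fun j => (D.χ j (π y) : ℂ))
        (fun j => mvfderiv 𝓘(ℝ, E) (fun x => (D.χ j x : ℂ)) (π y)) hc hℓ]
    split_ifs with h
    · subst h
      rw [smul_smul]
      have h3 : (fun j => (2 * (D.χ j (π y) : ℂ)) •
          mvfderiv 𝓘(ℝ, E) (fun x => (D.χ j x : ℂ)) (π y)) = D.dsqχ (π y) := by
        funext j; rw [dsqχ_eq]
      rw [h3]
      congr 1
      -- The sign of the Chern character cancels the sign from moving e to the front of τ.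
      have h4 : ((-1) ^ k * (-1) ^ k : ℂ) = 1 := by
        rw [← mul_pow]; simp
      rw [div_eq_mul_inv]
      linear_combination ((-1) ^ (k * (k - 1) / 2) *
        ((2 * Real.pi * Complex.I) ^ k * k.factorial)⁻¹ : ℂ) * h4
    · rw [smul_zero]
  rw [pairForm, finsum_eq_single _ n fun k hkn => by rw [hk, if_neg hkn], hk, if_pos rfl]

end CoverData

/-! ### Degree and evaluation of the forms built from τ. -/

section CochainForm

variable {V : Type*} [AddCommGroup V] [Module ℝ V] [TopologicalSpace V]
  {Γ κ : Type*} [Fintype κ] {n : ℕ} (τ : (Fin (n + 1) → Γ) → ℂ)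

/-- A summand in which some ε vanishes is zero, so arbitrary values of `sheet` off the supports do
no harm. -/
lemma cochainForm_congr (a : Γ) {g g' : κ → Γ} {ε : κ → V →L[ℝ] ℂ}
    (h : ∀ j, g j = g' j ∨ ε j = 0) : cochainForm τ a g ε = cochainForm τ a g' ε := by
  refine Finset.sum_congr rfl fun J _ => ?_
  by_cases hJ : ∃ i, ε (J i) = 0
  · obtain ⟨i, hi⟩ := hJ
    have h0 : ExteriorAlgebra.ιMulti ℂ n (fun i => ε (J i)) = 0 :=
      (ExteriorAlgebra.ιMulti ℂ n).map_coord_zero i hi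
    rw [h0, smul_zero, smul_zero]
  · push Not at hJ
    simp only [fun i => (h (J i)).resolve_right (hJ i)]

lemma cochainForm_mem (a : Γ) (g : κ → Γ) (ε : κ → V →L[ℝ] ℂ) :
    cochainForm τ a g ε ∈ ⋀[ℂ]^n (V →L[ℝ] ℂ) :=
  sum_mem fun J _ => Submodule.smul_mem _ _
    (ExteriorAlgebra.ιMulti_range ℂ n (Set.mem_range_self fun i => ε (J i)))

lemma alt_cochainForm (a : Γ) (g : κ → Γ) (ε : κ → V →L[ℝ] ℂ) :
    CotangentAlg.alt n (cochainForm τ a g ε) =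
      ∑ J : Fin n → κ, τ (Fin.cons a fun i => g (J i)) • wedgeEval n fun i => ε (J i) := by
  simp only [cochainForm, map_sum, map_smul, CotangentAlg.alt_ιMulti_self]

lemma alt_cochainForm_apply (a : Γ) (g : κ → Γ) (ε : κ → V →L[ℝ] ℂ) (v : Fin n → V) :
    CotangentAlg.alt n (cochainForm τ a g ε) v =
      ∑ J : Fin n → κ, τ (Fin.cons a fun i => g (J i)) *
        Matrix.det (Matrix.of fun i j => ε (J i) (v j)) := by
  rw [alt_cochainForm, ContinuousAlternatingMap.sum_apply]
  rfl

lemma alt_cochainForm_of_ne {p : ℕ} (h : p ≠ n) (a : Γ) (g : κ → Γ) (ε : κ → V →L[ℝ] ℂ) :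
    CotangentAlg.alt p (cochainForm τ a g ε) = 0 := by
  simp only [cochainForm, map_sum, map_smul, CotangentAlg.alt_ιMulti p _ h]
  exact Finset.sum_eq_zero fun J _ => by ext v; exact mul_zero _

end CochainForm

/-! ### The descended form is smooth and closed. -/

namespace CoverData

open MulOpposite Topology

variable {E : Type*} [NormedAddCommGroup E] [NormedSpace ℝ E]
  {M M' : Type*} [TopologicalSpace M] [ChartedSpace E M] [TopologicalSpace M']
  {π : M' → M} {κ : Type*} [Fintype κ] (D : CoverData E π κ)
  {Γ : Type*} [Group Γ] [MulAction Γᵐᵒᵖ M']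

/-- The derivative of π is invertible, so pullback along it is injective on exterior algebras. With
surjectivity of π this gives uniqueness of the descended form. -/
lemma pullback_eq_liftedForm_iff [ChartedSpace E M'] [IsManifold 𝓘(ℝ, E) ∞ M]
    [IsManifold 𝓘(ℝ, E) ∞ M'] (hπ : IsQuotientCoveringMap π Γᵐᵒᵖ)
    (hπ' : IsLocalDiffeomorph 𝓘(ℝ, E) 𝓘(ℝ, E) ∞ π) {n : ℕ} (τ : (Fin (n + 1) → Γ) → ℂ)
    (w : MForm E M) : w.pullback π = D.liftedForm τ ↔
      ∀ y, w (π y) = cochainForm τ 1 (D.sheet Γ y) (D.dsqχ (π y)) := by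
  rw [funext_iff]
  refine forall_congr' fun y => ?_
  rw [D.liftedForm_eq hπ hπ', MForm.pullback]
  have h := CotangentAlg.comap_equiv_injective
    (hπ'.mfderivToContinuousLinearEquiv (by simp : (∞ : WithTop ℕ∞) ≠ 0) y)
  rw [IsLocalDiffeomorph.mfderivToContinuousLinearEquiv_coe] at h
  exact h.eq_iff

variable {n : ℕ} {τ : (Fin (n + 1) → Γ) → ℂ} {w : MForm E M}

/-- Near y the sheets can be frozen wherever d(χ_j²) is nonzero; openness of π transfers this
neighbourhood to M. -/
lemma eventually_form_eq (hπ : IsQuotientCoveringMap π Γᵐᵒᵖ) (hopen : IsOpenMap π)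
    (hw : ∀ y, w (π y) = cochainForm τ 1 (D.sheet Γ y) (D.dsqχ (π y))) (y : M') :
    ∀ᶠ x in 𝓝 (π y), w x = cochainForm τ 1 (D.sheet Γ y) (D.dsqχ x) := by
  refine Filter.Eventually.filter_mono (hopen.nhds_le y) (Filter.eventually_map.mpr ?_)
  have h1 : ∀ j, ∀ᶠ z in 𝓝 y, D.sheet Γ z j = D.sheet Γ y j ∨ D.dsqχ (π z) j = 0 := by
    intro j
    by_cases hj : π y ∈ tsupport (D.χ j)
    · filter_upwards [D.eventually_sheet_eq (Γ := Γ) hπ (D.tsupport_χ j hj)] with z hz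
      exact Or.inl hz
    · filter_upwards [hπ.continuous.continuousAt.eventually
        ((isClosed_tsupport (D.χ j)).isOpen_compl.mem_nhds hj)] with z hz
      exact Or.inr (D.dsqχ_eq_zero hz)
  filter_upwards [Filter.eventually_all.mpr h1] with z hz
  rw [hw]
  exact cochainForm_congr τ 1 hz

lemma form_mem (hπ : IsQuotientCoveringMap π Γᵐᵒᵖ)
    (hw : ∀ y, w (π y) = cochainForm τ 1 (D.sheet Γ y) (D.dsqχ (π y))) (x : M) :
    w x ∈ ⋀[ℂ]^n (TangentSpace 𝓘(ℝ, E) x →L[ℝ] ℂ) := by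
  obtain ⟨y, rfl⟩ := hπ.surjective x
  rw [hw]
  exact cochainForm_mem τ _ _ _

lemma contDiffAt_sqχ_symm [IsManifold 𝓘(ℝ, E) ∞ M] (j : κ) {x₀ : M} {z : E}
    (hz : z ∈ (extChartAt 𝓘(ℝ, E) x₀).target) :
    ContDiffAt ℝ ∞ (D.sqχ j ∘ (extChartAt 𝓘(ℝ, E) x₀).symm) z := by
  have h : ContMDiffAt 𝓘(ℝ, E) 𝓘(ℝ, E) ∞ (extChartAt 𝓘(ℝ, E) x₀).symm z :=
    (contMDiffOn_extChartAt_symm x₀).contMDiffAt ((isOpen_extChartAt_target x₀).mem_nhds hz)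
  exact (((D.contMDiff_sqχ j).contMDiffAt).comp z h).contDiffAt

lemma sum_smul_wedgeFDeriv_apply {ι : Type*} [Fintype ι] (c : ι → ℂ) (f : ι → Fin n → E → ℂ)
    (z : E) (v : Fin n → E) : (∑ J, c J • wedgeFDeriv (f J) z) v =
      ∑ J, c J * Matrix.det (Matrix.of fun i j => fderiv ℝ (f J i) z (v j)) := by
  rw [ContinuousAlternatingMap.sum_apply]
  rfl

lemma dsqχ_mfderiv_symm [IsManifold 𝓘(ℝ, E) ∞ M] (j : κ) {x₀ : M} {z : E}
    (hz : z ∈ (extChartAt 𝓘(ℝ, E) x₀).target) (v : E) :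
    D.dsqχ ((extChartAt 𝓘(ℝ, E) x₀).symm z) j
      (mfderiv 𝓘(ℝ, E) 𝓘(ℝ, E) (extChartAt 𝓘(ℝ, E) x₀).symm z v) =
      fderiv ℝ (D.sqχ j ∘ (extChartAt 𝓘(ℝ, E) x₀).symm) z v := by
  have hd : MDifferentiableAt 𝓘(ℝ, E) 𝓘(ℝ, E) (extChartAt 𝓘(ℝ, E) x₀).symm z :=
    ((contMDiffOn_extChartAt_symm x₀).contMDiffAt
      ((isOpen_extChartAt_target (I := 𝓘(ℝ, E)) x₀).mem_nhds hz)).mdifferentiableAt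
      (n := ∞) (by simp)
  rw [← mfderiv_eq_fderiv]
  exact (DFunLike.congr_fun (mvfderiv_complex_comp z (D.mdifferentiableAt_sqχ j _) hd) v).symm

/-- The coefficients are the values of τ at the sheets over one fixed point. That they are constant
near `z` gives both smoothness and closedness. -/
lemma inChart_eventuallyEq [IsManifold 𝓘(ℝ, E) ∞ M] (hπ : IsQuotientCoveringMap π Γᵐᵒᵖ)
    (hopen : IsOpenMap π)
    (hw : ∀ y, w (π y) = cochainForm τ 1 (D.sheet Γ y) (D.dsqχ (π y))) {x₀ : M} {z : E}
    (hz : z ∈ (extChartAt 𝓘(ℝ, E) x₀).target) :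
    ∃ c : (Fin n → κ) → ℂ, w.inChart n x₀ =ᶠ[𝓝 z] fun z => ∑ J, c J •
      wedgeFDeriv (fun i => D.sqχ (J i) ∘ (extChartAt 𝓘(ℝ, E) x₀).symm) z := by
  obtain ⟨y, hy⟩ := hπ.surjective ((extChartAt 𝓘(ℝ, E) x₀).symm z)
  have h1 := D.eventually_form_eq hπ hopen hw y
  rw [hy] at h1
  have hsm : ContMDiffOn 𝓘(ℝ, E) 𝓘(ℝ, E) ∞ (extChartAt 𝓘(ℝ, E) x₀).symm
    (extChartAt 𝓘(ℝ, E) x₀).target := contMDiffOn_extChartAt_symm x₀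
  have ht := (isOpen_extChartAt_target (I := 𝓘(ℝ, E)) x₀).mem_nhds hz
  have h2 := (hsm.contMDiffAt ht).continuousAt.eventually h1
  refine ⟨fun J => τ (Fin.cons 1 fun i => D.sheet Γ y (J i)), ?_⟩
  filter_upwards [h2, ht] with z' hz' ht'
  ext v
  have h3 : w.inChart n x₀ z' v = CotangentAlg.alt n (w ((extChartAt 𝓘(ℝ, E) x₀).symm z'))
    fun j => mfderiv 𝓘(ℝ, E) 𝓘(ℝ, E) (extChartAt 𝓘(ℝ, E) x₀).symm z' (v j) := rfl
  rw [h3, hz', alt_cochainForm_apply, sum_smul_wedgeFDeriv_apply]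
  simp only [D.dsqχ_mfderiv_symm _ ht']

lemma inChart_eventuallyEq_zero [IsManifold 𝓘(ℝ, E) ∞ M] (hπ : IsQuotientCoveringMap π Γᵐᵒᵖ)
    (hw : ∀ y, w (π y) = cochainForm τ 1 (D.sheet Γ y) (D.dsqχ (π y))) (x₀ : M) {p : ℕ}
    (hp : p ≠ n) : w.inChart p x₀ = 0 := by
  funext z
  obtain ⟨y, hy⟩ := hπ.surjective ((extChartAt 𝓘(ℝ, E) x₀).symm z)
  rw [MForm.inChart, ← hy, hw, alt_cochainForm_of_ne τ hp]
  rfl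

lemma form_isSmooth [IsManifold 𝓘(ℝ, E) ∞ M] (hπ : IsQuotientCoveringMap π Γᵐᵒᵖ)
    (hopen : IsOpenMap π)
    (hw : ∀ y, w (π y) = cochainForm τ 1 (D.sheet Γ y) (D.dsqχ (π y))) : w.IsSmooth := by
  intro p x₀ z hz
  by_cases hp : p = n
  · subst hp
    obtain ⟨c, hc⟩ := D.inChart_eventuallyEq hπ hopen hw hz
    refine (ContDiffAt.congr_of_eventuallyEq ?_ hc).contDiffWithinAt
    exact ContDiffAt.sum fun J _ => (contDiffAt_wedgeFDeriv fun i =>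
      D.contDiffAt_sqχ_symm (J i) hz).const_smul (c J)
  · rw [D.inChart_eventuallyEq_zero hπ hw x₀ hp]
    exact contDiffWithinAt_const

lemma extDeriv_complex_smul {p : ℕ} (c : ℂ) {f : E → E [⋀^Fin p]→L[ℝ] ℂ} {z : E}
    (hf : DifferentiableAt ℝ f z) : extDeriv (fun z => c • f z) z = c • extDeriv f z := by
  rw [extDeriv, extDeriv, fderiv_fun_const_smul hf]
  ext v
  simp only [ContinuousAlternatingMap.alternatizeUncurryFin_apply,
    ContinuousAlternatingMap.smul_apply, smul_apply, Finset.smul_sum]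
  exact Finset.sum_congr rfl fun i _ => smul_comm _ _ _

lemma form_isClosed [IsManifold 𝓘(ℝ, E) ∞ M] (hπ : IsQuotientCoveringMap π Γᵐᵒᵖ)
    (hopen : IsOpenMap π)
    (hw : ∀ y, w (π y) = cochainForm τ 1 (D.sheet Γ y) (D.dsqχ (π y))) : w.IsClosed := by
  intro p x₀ z hz
  have h0 : extDeriv (fun _ : E => (0 : E [⋀^Fin p]→L[ℝ] ℂ)) z = 0 := by
    rw [extDeriv]
    ext v
    simp [ContinuousAlternatingMap.alternatizeUncurryFin_apply]
  by_cases hp : p = n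
  · subst hp
    obtain ⟨c, hc⟩ := D.inChart_eventuallyEq hπ hopen hw hz
    rw [hc.extDeriv_eq]
    have hs : ∀ J : Fin p → κ, DifferentiableAt ℝ (wedgeFDeriv
        fun i => D.sqχ (J i) ∘ (extChartAt 𝓘(ℝ, E) x₀).symm) z := fun J =>
      (contDiffAt_wedgeFDeriv fun i => D.contDiffAt_sqχ_symm (J i) hz).differentiableAt (by simp)
    have key : ∀ s : Finset (Fin p → κ), extDeriv (fun z => ∑ J ∈ s, c J •
        wedgeFDeriv (fun i => D.sqχ (J i) ∘ (extChartAt 𝓘(ℝ, E) x₀).symm) z) z = 0 := by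
      classical
      intro s
      induction s using Finset.induction_on with
      | empty => simpa using h0
      | insert J s hJ ih =>
        simp only [Finset.sum_insert hJ]
        rw [extDeriv_fun_add (ω₁ := fun z => c J • wedgeFDeriv
            (fun i => D.sqχ (J i) ∘ (extChartAt 𝓘(ℝ, E) x₀).symm) z) ((hs J).const_smul (c J))
          (ω₂ := fun z => ∑ J ∈ s, c J • wedgeFDeriv
            (fun i => D.sqχ (J i) ∘ (extChartAt 𝓘(ℝ, E) x₀).symm) z)
          (DifferentiableAt.fun_sum fun J _ => (hs J).const_smul (c J)), ih, add_zero,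
          extDeriv_complex_smul (c J) (hs J),
          extDeriv_wedgeFDeriv fun i => D.contDiffAt_sqχ_symm (J i) hz, smul_zero]
    exact key Finset.univ
  · rw [D.inChart_eventuallyEq_zero hπ hw x₀ hp]
    exact h0

end CoverData

/-! ### Calculus on the corner simplex. -/

section CornerSimplex

open MeasureTheory Set

lemma convex_cornerSimplex (n : ℕ) : Convex ℝ (cornerSimplex n) := by
  rintro x ⟨hx, hx'⟩ y ⟨hy, hy'⟩ a b ha hb hab
  refine ⟨fun i => ?_, ?_⟩
  · have := mul_nonneg ha (hx i)
    have := mul_nonneg hb (hy i)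
    simp only [Pi.add_apply, Pi.smul_apply, smul_eq_mul]
    linarith
  · simp only [Pi.add_apply, Pi.smul_apply, smul_eq_mul, Finset.sum_add_distrib,
      ← Finset.mul_sum]
    nlinarith

lemma isClosed_cornerSimplex (n : ℕ) : IsClosed (cornerSimplex n) := by
  have h : cornerSimplex n = (⋂ i, {t : Fin n → ℝ | 0 ≤ t i}) ∩ {t | ∑ i, t i ≤ 1} := by
    ext t; simp [cornerSimplex]
  rw [h]
  refine (isClosed_iInter fun i => isClosed_le continuous_const (continuous_apply i)).inter
    (isClosed_le (by fun_prop) continuous_const)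

lemma isCompact_cornerSimplex (n : ℕ) : IsCompact (cornerSimplex n) := by
  refine (isCompact_Icc (a := (0 : Fin n → ℝ)) (b := 1)).of_isClosed_subset
    (isClosed_cornerSimplex n) fun t ht => ⟨fun i => ht.1 i, fun i => ?_⟩
  exact (Finset.single_le_sum (fun j _ => ht.1 j) (Finset.mem_univ i)).trans ht.2

lemma measurableSet_cornerSimplex (n : ℕ) : MeasurableSet (cornerSimplex n) :=
  (isClosed_cornerSimplex n).measurableSet

lemma nonempty_interior_cornerSimplex (n : ℕ) : (interior (cornerSimplex n)).Nonempty := by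
  have ho : IsOpen ((⋂ i, {t : Fin n → ℝ | 0 < t i}) ∩ {t | ∑ i, t i < 1}) :=
    (isOpen_iInter_of_finite fun i => isOpen_lt continuous_const (continuous_apply i)).inter
      (isOpen_lt (by fun_prop) continuous_const)
  refine ⟨fun _ => 1 / (n + 1), interior_maximal ?_ ho ?_⟩
  · rintro t ⟨h1, h2⟩
    exact ⟨fun i => (mem_iInter.mp h1 i).le, le_of_lt h2⟩
  · refine ⟨mem_iInter.mpr fun i => ?_, ?_⟩
    · change (0 : ℝ) < 1 / (n + 1)
      positivity
    · change ∑ i : Fin n, (1 : ℝ) / (n + 1) < 1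
      rw [Finset.sum_const, Finset.card_univ, Fintype.card_fin, nsmul_eq_mul, mul_one_div,
        div_lt_one (by positivity)]
      linarith

lemma uniqueDiffOn_cornerSimplex (n : ℕ) : UniqueDiffOn ℝ (cornerSimplex n) :=
  uniqueDiffOn_convex (convex_cornerSimplex n) (nonempty_interior_cornerSimplex n)

/-- Needed for d to commute with pullbacks up to the boundary. -/
lemma cornerSimplex_subset_closure_interior (n : ℕ) :
    cornerSimplex n ⊆ closure (interior (cornerSimplex n)) := by
  rw [(convex_cornerSimplex n).closure_interior_eq_closure_of_nonempty_interior
    (nonempty_interior_cornerSimplex n)]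
  exact subset_closure

lemma insertNth_mem_cornerSimplex {q : ℕ} (i : Fin (q + 1)) (x : ℝ) (t : Fin q → ℝ) :
    i.insertNth x t ∈ cornerSimplex (q + 1) ↔
      t ∈ cornerSimplex q ∧ x ∈ Icc 0 (1 - ∑ j, t j) := by
  have h : (∀ k, 0 ≤ (i.insertNth x t : Fin (q + 1) → ℝ) k) ↔ 0 ≤ x ∧ ∀ j, 0 ≤ t j := by
    rw [Fin.forall_iff_succAbove i]
    simp
  have h2 : ∑ k, (i.insertNth x t : Fin (q + 1) → ℝ) k = x + ∑ j, t j := by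
    rw [Fin.sum_univ_succAbove _ i]
    simp
  simp only [cornerSimplex, mem_ofPred_eq, h, h2, mem_Icc]
  constructor
  · rintro ⟨⟨h3, h4⟩, h5⟩
    exact ⟨⟨h4, by linarith⟩, h3, by linarith⟩
  · rintro ⟨⟨h3, h4⟩, h5, h6⟩
    exact ⟨⟨h5, h3⟩, by linarith⟩

lemma hasDerivAt_insertNth {q : ℕ} (i : Fin (q + 1)) (t : Fin q → ℝ) (x : ℝ) :
    HasDerivAt (fun x => (i.insertNth x t : Fin (q + 1) → ℝ)) (Pi.single i 1) x := by
  rw [hasDerivAt_pi, Fin.forall_iff_succAbove i]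
  refine ⟨by simpa using hasDerivAt_id' x, fun j => ?_⟩
  simpa [Pi.single_eq_of_ne (Fin.succAbove_ne i j)] using hasDerivAt_const x (t j)

/-- Fubini in the coordinate `i`, and the fundamental theorem of calculus on each segment [0, 1 - ∑
t_j]. -/
lemma setIntegral_fderivWithin_cornerSimplex {q : ℕ} (i : Fin (q + 1)) {H : (Fin (q + 1) → ℝ) → ℂ}
    (hH : ContDiffOn ℝ 1 H (cornerSimplex (q + 1))) :
    ∫ t in cornerSimplex (q + 1), fderivWithin ℝ H (cornerSimplex (q + 1)) t (Pi.single i 1) =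
      ∫ t in cornerSimplex q, (H (i.insertNth (1 - ∑ j, t j) t) - H (i.insertNth 0 t)) := by
  set g : (Fin (q + 1) → ℝ) → ℂ :=
    fun t => fderivWithin ℝ H (cornerSimplex (q + 1)) t (Pi.single i 1) with hgdef
  have hg : ContinuousOn g (cornerSimplex (q + 1)) :=
    (hH.continuousOn_fderivWithin (uniqueDiffOn_cornerSimplex _) le_rfl).clm_apply
      continuousOn_const
  have hint : Integrable ((cornerSimplex (q + 1)).indicator g) :=
    (hg.integrableOn_compact (isCompact_cornerSimplex _)).integrable_indicator
      (measurableSet_cornerSimplex _)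
  have hcont : ∀ t : Fin q → ℝ, Continuous fun x => (i.insertNth x t : Fin (q + 1) → ℝ) :=
    fun t => continuous_iff_continuousAt.mpr fun x => (hasDerivAt_insertNth i t x).continuousAt
  have e := (volume_preserving_piFinSuccAbove (fun _ : Fin (q + 1) => ℝ) i).symm
  rw [← integral_indicator (measurableSet_cornerSimplex _),
    ← integral_indicator (measurableSet_cornerSimplex _), ← e.integral_comp',
    Measure.volume_eq_prod, integral_prod_symm _ (by
      have h := (e.integrable_comp_emb (MeasurableEquiv.measurableEmbedding _)).mpr hint
      rwa [Measure.volume_eq_prod] at h)]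
  congr 1
  funext t
  by_cases ht : t ∈ cornerSimplex q
  · rw [indicator_of_mem ht]
    have h0 : (0 : ℝ) ≤ 1 - ∑ j, t j := by linarith [ht.2]
    have h1 : ∀ x, (cornerSimplex (q + 1)).indicator g
        ((MeasurableEquiv.piFinSuccAbove (fun _ : Fin (q + 1) => ℝ) i).symm (x, t)) =
        (Icc 0 (1 - ∑ j, t j)).indicator (fun x => g (i.insertNth x t)) x := by
      intro x
      change (cornerSimplex (q + 1)).indicator g (i.insertNth x t) = _
      by_cases hx : x ∈ Icc 0 (1 - ∑ j, t j)
      · rw [indicator_of_mem hx, indicator_of_mem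
          ((insertNth_mem_cornerSimplex i x t).mpr ⟨ht, hx⟩)]
      · rw [indicator_of_notMem hx, indicator_of_notMem fun h =>
          hx ((insertNth_mem_cornerSimplex i x t).mp h).2]
    have hmaps : MapsTo (fun x => (i.insertNth x t : Fin (q + 1) → ℝ)) (Icc 0 (1 - ∑ j, t j))
        (cornerSimplex (q + 1)) := fun x hx => (insertNth_mem_cornerSimplex i x t).mpr ⟨ht, hx⟩
    refine (integral_congr_ae (ae_of_all _ h1)).trans ?_
    rw [integral_indicator measurableSet_Icc, integral_Icc_eq_integral_Ioc,
      ← intervalIntegral.integral_of_le h0]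
    refine intervalIntegral.integral_eq_sub_of_hasDerivAt_of_le
      (f := fun x => H (i.insertNth x t)) h0
      (hH.continuousOn.comp (hcont t).continuousOn hmaps) (fun x hx => ?_) ?_
    · have h2 := (hH.differentiableOn one_ne_zero _
        (hmaps (Ioo_subset_Icc_self hx))).hasFDerivWithinAt.comp_hasDerivWithinAt x
        (hasDerivAt_insertNth i t x).hasDerivWithinAt hmaps
      exact h2.hasDerivAt (Icc_mem_nhds hx.1 hx.2)
    · exact (hg.comp (hcont t).continuousOn (by rwa [uIcc_of_le h0])).intervalIntegrable
  · rw [indicator_of_notMem ht]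
    have h1 : ∀ x, (cornerSimplex (q + 1)).indicator g
        ((MeasurableEquiv.piFinSuccAbove (fun _ : Fin (q + 1) => ℝ) i).symm (x, t)) = 0 := by
      intro x
      change (cornerSimplex (q + 1)).indicator g (i.insertNth x t) = _
      rw [indicator_of_notMem fun h => ht ((insertNth_mem_cornerSimplex i x t).mp h).1]
    exact (integral_congr_ae (ae_of_all _ h1)).trans (integral_zero _ _)

end CornerSimplex

/-! ### The oblique face of the corner simplex. -/

section Faces

open MeasureTheory Set

/-- Border `A` by a first row of ones and expand along it, before and after subtracting the first
column from the others. -/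
lemma Matrix.sum_det_submatrix_succAbove {R : Type*} [CommRing R] {q : ℕ}
    (A : Matrix (Fin q) (Fin (q + 1)) R) :
    ∑ k : Fin (q + 1), (-1) ^ (k : ℕ) * (A.submatrix id k.succAbove).det =
      (Matrix.of fun i j => A i j.succ - A i 0).det := by
  let B : Matrix (Fin (q + 1)) (Fin (q + 1)) R :=
    Matrix.of fun i j => Fin.cases (motive := fun _ => R) 1 (fun i => A i j) i
  let B' : Matrix (Fin (q + 1)) (Fin (q + 1)) R :=
    Matrix.of fun i j => B i j + (Fin.cases (motive := fun _ => R) 0 (fun _ => -1) j) * B i 0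
  have h1 : B'.det = B.det := by
    rw [← Matrix.det_transpose, ← Matrix.det_transpose B]
    exact Matrix.det_eq_of_forall_row_eq_smul_add_const
      (fun j => Fin.cases (motive := fun _ => R) 0 (fun _ => -1) j) 0 rfl fun i j => rfl
  rw [Matrix.det_succ_row_zero, Matrix.det_succ_row_zero] at h1
  rw [Finset.sum_eq_single 0 (fun k _ hk => by
    obtain ⟨j, rfl⟩ := Fin.exists_succ_eq.mpr hk
    simp [B', B]) (by simp)] at h1
  have h2 : B'.submatrix Fin.succ (Fin.succAbove 0) = Matrix.of fun i j => A i j.succ - A i 0 := by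
    ext i j
    simp [B', B, sub_eq_add_neg]
  rw [h2] at h1
  have h3 : B' 0 0 = 1 := by simp [B', B]
  rw [h3, Fin.val_zero, pow_zero, one_mul, one_mul] at h1
  rw [h1]
  refine Finset.sum_congr rfl fun k _ => ?_
  rw [show B 0 k = 1 from rfl, mul_one]
  rfl

/-- The linear map `t ↦ (t₁, …, ℓ(t), …, t_q)` with `ℓ(t)` at the position `i`. -/
noncomputable def insertCLM {q : ℕ} (i : Fin (q + 1)) (ℓ : (Fin q → ℝ) →L[ℝ] ℝ) :
    (Fin q → ℝ) →L[ℝ] (Fin (q + 1) → ℝ) :=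
  ContinuousLinearMap.pi (i.insertNth ℓ fun j => ContinuousLinearMap.proj j)

lemma insertCLM_apply {q : ℕ} (i : Fin (q + 1)) (ℓ : (Fin q → ℝ) →L[ℝ] ℝ) (t : Fin q → ℝ) :
    insertCLM i ℓ t = i.insertNth (ℓ t) t := by
  funext k
  revert k
  rw [Fin.forall_iff_succAbove i]
  simp [insertCLM]

/-- The affine map from `Fin q → ℝ` onto the hyperplane `∑ tᵢ = 1` which omits the coordinate `i`. -/
noncomputable def hyperplaneParam {q : ℕ} (i : Fin (q + 1)) (t : Fin q → ℝ) : Fin (q + 1) → ℝ :=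
  i.insertNth (1 - ∑ j, t j) t

lemma hyperplaneParam_eq {q : ℕ} (i : Fin (q + 1)) (t : Fin q → ℝ) :
    hyperplaneParam i t =
      insertCLM i (-∑ j, ContinuousLinearMap.proj j) t + Pi.single i 1 := by
  rw [insertCLM_apply]
  funext k
  revert k
  rw [Fin.forall_iff_succAbove i]
  simp [hyperplaneParam, Fin.succAbove_ne]
  ring

lemma hasFDerivAt_hyperplaneParam {q : ℕ} (i : Fin (q + 1)) (t : Fin q → ℝ) :
    HasFDerivAt (hyperplaneParam i) (insertCLM i (-∑ j, ContinuousLinearMap.proj j)) t := by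
  rw [funext (hyperplaneParam_eq i)]
  exact (ContinuousLinearMap.hasFDerivAt _).add_const _

lemma continuous_hyperplaneParam {q : ℕ} (i : Fin (q + 1)) :
    Continuous (hyperplaneParam i : (Fin q → ℝ) → _) :=
  continuous_iff_continuousAt.mpr fun t => (hasFDerivAt_hyperplaneParam i t).continuousAt

lemma sum_hyperplaneParam {q : ℕ} (i : Fin (q + 1)) (t : Fin q → ℝ) :
    ∑ k, hyperplaneParam i t k = 1 := by
  rw [Fin.sum_univ_succAbove _ i]
  simp [hyperplaneParam]

lemma removeNth_hyperplaneParam {q : ℕ} (i : Fin (q + 1)) (t : Fin q → ℝ) :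
    i.removeNth (hyperplaneParam i t) = t :=
  Fin.removeNth_insertNth _ _ _

lemma hyperplaneParam_removeNth {q : ℕ} (i : Fin (q + 1)) {x : Fin (q + 1) → ℝ}
    (hx : ∑ k, x k = 1) : hyperplaneParam i (i.removeNth x) = x := by
  rw [Fin.sum_univ_succAbove _ i] at hx
  have : 1 - ∑ j, i.removeNth x j = x i := by
    rw [← hx]; simp [Fin.removeNth]
  rw [hyperplaneParam, this, Fin.insertNth_self_removeNth]

lemma mapsTo_hyperplaneParam {q : ℕ} (i : Fin (q + 1)) :
    MapsTo (hyperplaneParam i) (cornerSimplex q) (cornerSimplex (q + 1)) := fun t ht =>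
  (insertNth_mem_cornerSimplex i _ t).mpr ⟨ht, by linarith [ht.2], le_rfl⟩

lemma removeNth_mem_cornerSimplex {q : ℕ} (i : Fin (q + 1)) {x : Fin (q + 1) → ℝ}
    (hx : x ∈ cornerSimplex (q + 1)) : i.removeNth x ∈ cornerSimplex q := by
  rw [← Fin.insertNth_self_removeNth i x] at hx
  exact ((insertNth_mem_cornerSimplex _ _ _).mp hx).1

/-- Two parametrizations of the oblique face differ by an affine bijection of the corner simplex
onto itself. Its volume is finite and positive, so the Jacobian factor has to be 1. -/
lemma setIntegral_hyperplaneParam {q : ℕ} (i k : Fin (q + 1)) (L : (Fin (q + 1) → ℝ) → ℂ) :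
    ∫ t in cornerSimplex q, L (hyperplaneParam i t) =
      ∫ t in cornerSimplex q, L (hyperplaneParam k t) := by
  let P : (Fin (q + 1) → ℝ) →L[ℝ] (Fin q → ℝ) :=
    ContinuousLinearMap.pi fun j => ContinuousLinearMap.proj (k.succAbove j)
  let σ : (Fin q → ℝ) → (Fin q → ℝ) := fun t => k.removeNth (hyperplaneParam i t)
  let σ' : (Fin q → ℝ) → (Fin q → ℝ) := fun t => i.removeNth (hyperplaneParam k t)
  let A := P.comp (insertCLM i (-∑ j, ContinuousLinearMap.proj j))
  have hσ : ∀ t, HasFDerivAt σ A t := fun t => P.hasFDerivAt.comp t (hasFDerivAt_hyperplaneParam i t)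
  have h1 : ∀ t, σ' (σ t) = t := fun t => by
    simp only [σ, σ', hyperplaneParam_removeNth k (sum_hyperplaneParam i t),
      removeNth_hyperplaneParam]
  have h2 : ∀ t, σ (σ' t) = t := fun t => by
    simp only [σ, σ', hyperplaneParam_removeNth i (sum_hyperplaneParam k t),
      removeNth_hyperplaneParam]
  have himage : σ '' cornerSimplex q = cornerSimplex q := by
    refine Subset.antisymm ?_ fun t ht => ?_
    · rintro _ ⟨t, ht, rfl⟩
      exact removeNth_mem_cornerSimplex k (mapsTo_hyperplaneParam i ht)
    · exact ⟨σ' t, removeNth_mem_cornerSimplex i (mapsTo_hyperplaneParam k ht), h2 t⟩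
  have hint : ∀ g : (Fin q → ℝ) → ℂ, ∫ t in cornerSimplex q, g t =
      |A.det| • ∫ t in cornerSimplex q, g (σ t) := by
    intro g
    have := integral_image_eq_integral_abs_det_fderiv_smul volume
      (measurableSet_cornerSimplex q) (fun t _ => (hσ t).hasFDerivWithinAt)
      (Function.LeftInverse.injective h1).injOn g
    rwa [himage, integral_smul] at this
  have hvol : volume.real (cornerSimplex q) ≠ 0 := by
    refine (measureReal_ne_zero_iff (isCompact_cornerSimplex q).measure_ne_top).mpr ?_
    exact (((isOpen_interior.measure_pos volume (nonempty_interior_cornerSimplex q)).trans_le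
      (measure_mono interior_subset)).ne')
  have hdet : |A.det| = 1 := by
    have h := hint fun _ => 1
    rw [setIntegral_const, smul_smul] at h
    have h' := smul_left_injective ℝ (one_ne_zero (α := ℂ)) h
    exact (mul_eq_right₀ hvol).mp h'.symm
  have h := hint fun t => L (hyperplaneParam k t)
  rw [hdet, one_smul] at h
  rw [h]
  simp only [σ, hyperplaneParam_removeNth k (sum_hyperplaneParam i _)]

end Faces

/-! ### Stokes' theorem on the corner simplex. -/

section Stokes

open MeasureTheory Set

/-- The Jacobian determinant of `F` at the point `t` of the simplex. -/
noncomputable def jacobian {q : ℕ} (F : Fin q → (Fin q → ℝ) → ℂ) (t : Fin q → ℝ) : ℂ :=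
  Matrix.det (Matrix.of fun i j => fderivWithin ℝ (F i) (cornerSimplex q) t (Pi.single j 1))

lemma ContDiffOn.matrix_det {E : Type*} [NormedAddCommGroup E] [NormedSpace ℝ E] {q : ℕ}
    {s : Set E} {k : WithTop ℕ∞} {A : E → Matrix (Fin q) (Fin q) ℂ}
    (hA : ∀ i j, ContDiffOn ℝ k (fun x => A x i j) s) : ContDiffOn ℝ k (fun x => (A x).det) s := by
  simp only [Matrix.det_apply']
  exact ContDiffOn.sum fun σ _ => contDiffOn_const.mul (contDiffOn_prod fun i _ => hA _ _)

lemma contDiffOn_fderivWithin_cornerSimplex {q : ℕ} {f : (Fin q → ℝ) → ℂ}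
    (hf : ContDiffOn ℝ ∞ f (cornerSimplex q)) (v : Fin q → ℝ) :
    ContDiffOn ℝ ∞ (fun t => fderivWithin ℝ f (cornerSimplex q) t v) (cornerSimplex q) :=
  (hf.fderivWithin (uniqueDiffOn_cornerSimplex q) (by simp)).clm_apply contDiffOn_const

lemma contDiffOn_jacobian {q : ℕ} {F : Fin q → (Fin q → ℝ) → ℂ}
    (hF : ∀ i, ContDiffOn ℝ ∞ (F i) (cornerSimplex q)) :
    ContDiffOn ℝ ∞ (jacobian F) (cornerSimplex q) :=
  ContDiffOn.matrix_det fun i _ => contDiffOn_fderivWithin_cornerSimplex (hF i) _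

/-- The coefficients of the form `F₀ dF₁ ∧ ⋯ ∧ dF_q`. -/
noncomputable def formCoeff {q : ℕ} (F : Fin (q + 1) → (Fin (q + 1) → ℝ) → ℂ) (k : Fin (q + 1))
    (t : Fin (q + 1) → ℝ) : ℂ :=
  F 0 t * Matrix.det (Matrix.of fun (i j : Fin q) =>
    fderivWithin ℝ (F i.succ) (cornerSimplex (q + 1)) t (Pi.single (k.succAbove j) 1))

lemma contDiffOn_formCoeff {q : ℕ} {F : Fin (q + 1) → (Fin (q + 1) → ℝ) → ℂ}
    (hF : ∀ i, ContDiffOn ℝ ∞ (F i) (cornerSimplex (q + 1))) (k : Fin (q + 1)) :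
    ContDiffOn ℝ ∞ (formCoeff F k) (cornerSimplex (q + 1)) :=
  (hF 0).mul (ContDiffOn.matrix_det fun i _ => contDiffOn_fderivWithin_cornerSimplex (hF i.succ) _)

/-- The identity dF₀ ∧ ⋯ ∧ dF_q = d(F₀ dF₁ ∧ ⋯ ∧ dF_q), obtained by pulling back x₀ dx₁ ∧ ⋯ ∧ dx_q
from ℂ^{q+1} along (F₀, …, F_q). -/
lemma jacobian_eq_sum {q : ℕ} {F : Fin (q + 1) → (Fin (q + 1) → ℝ) → ℂ}
    (hF : ∀ i, ContDiffOn ℝ ∞ (F i) (cornerSimplex (q + 1))) {t : Fin (q + 1) → ℝ}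
    (ht : t ∈ cornerSimplex (q + 1)) :
    jacobian F t = ∑ k : Fin (q + 1), (-1) ^ (k : ℕ) *
      fderivWithin ℝ (formCoeff F k) (cornerSimplex (q + 1)) t (Pi.single k 1) := by
  let Φ : (Fin (q + 1) → ℝ) → (Fin (q + 1) → ℂ) := fun t i => F i t
  have hΦ : ContDiffOn ℝ ∞ Φ (cornerSimplex (q + 1)) := contDiffOn_pi.mpr hF
  have hu := uniqueDiffOn_cornerSimplex (q + 1)
  have hcomp : ∀ t ∈ cornerSimplex (q + 1), ∀ v i,
      fderivWithin ℝ Φ (cornerSimplex (q + 1)) t v i =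
        fderivWithin ℝ (F i) (cornerSimplex (q + 1)) t v := by
    intro t ht v i
    rw [fderivWithin_pi (fun i => (hF i).differentiableOn (by simp) t ht) (hu t ht)]
    rfl
  let proj : Fin (q + 1) → (Fin (q + 1) → ℂ) →L[ℝ] ℂ := fun i => ContinuousLinearMap.proj i
  let η : (Fin (q + 1) → ℂ) → (Fin (q + 1) → ℂ) [⋀^Fin q]→L[ℝ] ℂ :=
    fun x => x 0 • wedgeEval q fun i => proj i.succ
  have hη : ∀ x, HasFDerivAt η ((proj 0).smulRight (wedgeEval q fun i => proj i.succ)) x :=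
    fun x => (proj 0).hasFDerivAt.smul_const (wedgeEval q fun i => proj i.succ)
  have hdη : ∀ x v, extDeriv η x v = Matrix.det (Matrix.of fun i j => v j i) := by
    intro x v
    rw [extDeriv, (hη x).fderiv, ContinuousAlternatingMap.alternatizeUncurryFin_apply,
      Matrix.det_succ_row_zero]
    refine Finset.sum_congr rfl fun k _ => ?_
    rw [mul_assoc, zsmul_eq_mul]
    push_cast
    rfl
  have h1 := extDerivWithin_pullback (𝕜 := ℝ) (r := 2) (t := univ) (x := t)
    (f := Φ) (s := cornerSimplex (q + 1))
    ((hη (Φ t)).differentiableAt.differentiableWithinAt : DifferentiableWithinAt ℝ η univ (Φ t))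
    ((hΦ t ht).of_le two_le_infty) (by rw [minSmoothness_of_isRCLikeNormedField]) hu
    (cornerSimplex_subset_closure_interior _ ht) ht (mapsTo_univ _ _)
  rw [extDerivWithin_univ] at h1
  have h2 := DFunLike.congr_fun h1 (fun k => Pi.single k (1 : ℝ))
  rw [ContinuousAlternatingMap.compContinuousLinearMap_apply, hdη] at h2
  have hdiff : DifferentiableWithinAt ℝ (fun x => (η (Φ x)).compContinuousLinearMap
      (fderivWithin ℝ Φ (cornerSimplex (q + 1)) x)) (cornerSimplex (q + 1)) t := by
    have h3 : ContDiffOn ℝ ∞ (fun x (i : Fin q) => (proj i.succ).comp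
        (fderivWithin ℝ Φ (cornerSimplex (q + 1)) x)) (cornerSimplex (q + 1)) :=
      contDiffOn_pi.mpr fun i => contDiffOn_const.clm_comp (hΦ.fderivWithin hu (by simp))
    have h4 : ContDiffOn ℝ ∞ (fun x => F 0 x • wedgeEvalCLM (Fin (q + 1) → ℝ) q fun i =>
        (proj i.succ).comp (fderivWithin ℝ Φ (cornerSimplex (q + 1)) x))
        (cornerSimplex (q + 1)) :=
      (hF 0).smul ((wedgeEvalCLM (Fin (q + 1) → ℝ) q).contDiff.comp_contDiffOn h3)
    exact h4.differentiableOn (by simp) t ht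
  rw [extDerivWithin_apply hdiff (hu t ht)] at h2
  rw [jacobian]
  refine (Eq.trans ?_ h2.symm).trans ?_
  · congr 1
    ext i j
    exact (hcomp t ht _ i).symm
  · refine Finset.sum_congr rfl fun k _ => ?_
    rw [zsmul_eq_mul]
    push_cast
    congr 1
    refine congrArg (fun L : (Fin (q + 1) → ℝ) →L[ℝ] ℂ => L (Pi.single k 1))
      (fderivWithin_congr' (fun x hx => ?_) ht)
    refine congrArg (F 0 x * ·) (congrArg Matrix.det (Matrix.ext fun i j => ?_))
    exact hcomp x hx _ i.succ

lemma insertCLM_single {q : ℕ} (k : Fin (q + 1)) (ℓ : (Fin q → ℝ) →L[ℝ] ℝ) (j : Fin q) :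
    insertCLM k ℓ (Pi.single j 1) =
      Pi.single (k.succAbove j) 1 + Pi.single k (ℓ (Pi.single j 1)) := by
  rw [insertCLM_apply]
  funext i
  revert i
  rw [Fin.forall_iff_succAbove k]
  simp [Pi.single_apply, Fin.succAbove_ne, Fin.ne_succAbove]

/-- Stokes' theorem for `F₀ dF₁ ∧ ⋯ ∧ dF_q` on a simplex. -/
theorem setIntegral_jacobian {q : ℕ} {F : Fin (q + 1) → (Fin (q + 1) → ℝ) → ℂ}
    (hF : ∀ i, ContDiffOn ℝ ∞ (F i) (cornerSimplex (q + 1))) :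
    ∫ t in cornerSimplex (q + 1), jacobian F t =
      (∫ t in cornerSimplex q, F 0 (hyperplaneParam 0 t) *
        jacobian (fun i => F i.succ ∘ hyperplaneParam 0) t) +
      ∑ k : Fin (q + 1), (-1) ^ ((k : ℕ) + 1) * ∫ t in cornerSimplex q, F 0 (insertCLM k 0 t) *
        jacobian (fun i => F i.succ ∘ insertCLM k 0) t := by
  have hmapsZ : ∀ k : Fin (q + 1), MapsTo (insertCLM k 0) (cornerSimplex q)
      (cornerSimplex (q + 1)) := fun k t ht => by
    rw [insertCLM_apply]
    exact (insertNth_mem_cornerSimplex k _ t).mpr ⟨ht, le_rfl, by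
      change (0 : ℝ) ≤ _
      linarith [ht.2]⟩
  have hint : ∀ (g : (Fin (q + 1) → ℝ) → ℂ), ContinuousOn g (cornerSimplex (q + 1)) →
      IntegrableOn g (cornerSimplex (q + 1)) := fun g hg =>
    hg.integrableOn_compact (isCompact_cornerSimplex _)
  have hint' : ∀ (g : (Fin (q + 1) → ℝ) → ℂ) (A : (Fin q → ℝ) → (Fin (q + 1) → ℝ)),
      Continuous A → MapsTo A (cornerSimplex q) (cornerSimplex (q + 1)) →
      ContinuousOn g (cornerSimplex (q + 1)) → IntegrableOn (fun t => g (A t)) (cornerSimplex q) :=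
    fun g A hA hm hg => (hg.comp hA.continuousOn hm).integrableOn_compact
      (isCompact_cornerSimplex _)
  have hc : ∀ k, ContinuousOn (formCoeff F k) (cornerSimplex (q + 1)) := fun k =>
    (contDiffOn_formCoeff hF k).continuousOn
  have h1 : ∫ t in cornerSimplex (q + 1), jacobian F t =
      ∑ k : Fin (q + 1), (-1) ^ (k : ℕ) * ∫ t in cornerSimplex (q + 1),
        fderivWithin ℝ (formCoeff F k) (cornerSimplex (q + 1)) t (Pi.single k 1) := by
    rw [setIntegral_congr_fun (measurableSet_cornerSimplex _) fun t ht => jacobian_eq_sum hF ht,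
      integral_finsetSum _ fun k _ => (hint _ (contDiffOn_fderivWithin_cornerSimplex
        (contDiffOn_formCoeff hF k) _).continuousOn).const_mul _]
    exact Finset.sum_congr rfl fun k _ => integral_const_mul _ _
  -- Integration in direction `k` parametrizes the oblique face by omitting the coordinate `k`; all
  -- these parametrizations are replaced by the one that omits the coordinate 0.
  have h2 : ∀ k : Fin (q + 1), ∫ t in cornerSimplex (q + 1),
        fderivWithin ℝ (formCoeff F k) (cornerSimplex (q + 1)) t (Pi.single k 1) =
      (∫ t in cornerSimplex q, formCoeff F k (hyperplaneParam 0 t)) -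
        ∫ t in cornerSimplex q, formCoeff F k (insertCLM k 0 t) := by
    intro k
    rw [setIntegral_fderivWithin_cornerSimplex k ((contDiffOn_formCoeff hF k).of_le (by simp)),
      ← setIntegral_hyperplaneParam k 0, ← integral_sub
        (hint' _ _ (continuous_hyperplaneParam k) (mapsTo_hyperplaneParam k) (hc k))
        (hint' _ _ (insertCLM k 0).continuous (hmapsZ k) (hc k))]
    congr 1
    funext t
    rw [insertCLM_apply]
    rfl
  have hchain : ∀ (f : (Fin (q + 1) → ℝ) → ℂ) (A : (Fin q → ℝ) → (Fin (q + 1) → ℝ))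
      (A' : (Fin q → ℝ) →L[ℝ] (Fin (q + 1) → ℝ)) (t v : Fin q → ℝ),
      ContDiffOn ℝ ∞ f (cornerSimplex (q + 1)) → HasFDerivAt A A' t →
      MapsTo A (cornerSimplex q) (cornerSimplex (q + 1)) → t ∈ cornerSimplex q →
      fderivWithin ℝ (f ∘ A) (cornerSimplex q) t v =
        fderivWithin ℝ f (cornerSimplex (q + 1)) (A t) (A' v) := by
    intro f A A' t v hf hA hm ht
    have h := (hf.differentiableOn (by simp) _ (hm ht)).hasFDerivWithinAt.comp t
      hA.hasFDerivWithinAt hm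
    rw [h.fderivWithin (uniqueDiffOn_cornerSimplex q t ht)]
    rfl
  have h3 : ∀ k : Fin (q + 1), ∫ t in cornerSimplex q, formCoeff F k (insertCLM k 0 t) =
      ∫ t in cornerSimplex q, F 0 (insertCLM k 0 t) *
        jacobian (fun i => F i.succ ∘ insertCLM k 0) t := by
    intro k
    refine setIntegral_congr_fun (measurableSet_cornerSimplex _) fun t ht => ?_
    refine congrArg (F 0 (insertCLM k 0 t) * ·) (congrArg Matrix.det (Matrix.ext fun i j => ?_))
    refine Eq.trans ?_ (hchain (F i.succ) _ _ t (Pi.single j 1) (hF _)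
      (insertCLM k 0).hasFDerivAt (hmapsZ k) ht).symm
    rw [Matrix.of_apply, insertCLM_single]
    simp
  -- On the oblique face the j-th partial derivative of `hyperplaneParam 0` is e_{j+1} - e₀, so the
  -- alternating sum of minors is the Jacobian of the restricted functions.
  have h4 : ∑ k : Fin (q + 1), (-1) ^ (k : ℕ) *
      ∫ t in cornerSimplex q, formCoeff F k (hyperplaneParam 0 t) =
      ∫ t in cornerSimplex q, F 0 (hyperplaneParam 0 t) *
        jacobian (fun i => F i.succ ∘ hyperplaneParam 0) t := by
    simp only [← integral_const_mul]
    rw [← integral_finsetSum _ fun k _ => (hint' _ _ (continuous_hyperplaneParam 0)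
      (mapsTo_hyperplaneParam 0) (hc k)).const_mul _]
    refine setIntegral_congr_fun (measurableSet_cornerSimplex _) fun t ht => ?_
    have h5 := Matrix.sum_det_submatrix_succAbove (Matrix.of fun (i : Fin q) (j : Fin (q + 1)) =>
      fderivWithin ℝ (F i.succ) (cornerSimplex (q + 1)) (hyperplaneParam 0 t) (Pi.single j 1))
    have h6 : jacobian (fun i => F i.succ ∘ hyperplaneParam 0) t = _ := Eq.trans ?_ h5.symm
    · change _ = F 0 (hyperplaneParam 0 t) * _
      rw [h6, Finset.mul_sum]
      refine Finset.sum_congr rfl fun k _ => ?_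
      rw [mul_left_comm]
      rfl
    · refine congrArg Matrix.det (Matrix.ext fun i j => ?_)
      refine (hchain (F i.succ) _ _ t (Pi.single j 1) (hF _)
        (hasFDerivAt_hyperplaneParam 0 t) (mapsTo_hyperplaneParam 0) ht).trans ?_
      rw [Matrix.of_apply, Matrix.of_apply, Matrix.of_apply, ← map_sub]
      rw [insertCLM_single]
      congr 1
      simp [sub_eq_add_neg, Pi.single_apply, ← Pi.single_neg]
  rw [h1]
  simp only [h2, mul_sub, Finset.sum_sub_distrib]
  rw [h4, sub_eq_add_neg, ← Finset.sum_neg_distrib]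
  congr 1
  refine Finset.sum_congr rfl fun k _ => ?_
  rw [h3, pow_succ]
  ring

end Stokes

/-! ### Integrals of u dF₁ ∧ ⋯ ∧ dF_q over the standard simplex. -/

section SimplexIntegral

open MeasureTheory Set

lemma map_succAbove_apply {q : ℕ} (i : Fin (q + 2)) (x : stdSimplex ℝ (Fin (q + 1))) :
    (stdSimplex.map i.succAbove x : Fin (q + 2) → ℝ) = i.insertNth 0 (x : Fin (q + 1) → ℝ) := by
  funext k
  revert k
  rw [Fin.forall_iff_succAbove i]
  simp only [stdSimplex.map_coe, FunOnFinite.linearMap_apply_apply, Fin.insertNth_apply_same,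
    Fin.insertNth_apply_succAbove]
  refine ⟨Finset.sum_eq_zero fun j hj => ?_, fun j => ?_⟩
  · exact absurd (Finset.mem_filter.mp hj).2 (Fin.succAbove_ne i j)
  · rw [Finset.sum_eq_single j]
    · intro b hb hbj
      exact absurd (Fin.succAbove_right_injective (Finset.mem_filter.mp hb).2) hbj
    · intro hj
      simp at hj

lemma coe_cornerToStd {q : ℕ} {t : Fin q → ℝ} (ht : t ∈ cornerSimplex q) :
    (cornerToStd t : Fin (q + 1) → ℝ) = Fin.cons (1 - ∑ i, t i) t := by
  rw [cornerToStd, dif_pos ht]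
  rfl

lemma insertCLM_mem_cornerSimplex {q : ℕ} (k : Fin (q + 1)) {t : Fin q → ℝ}
    (ht : t ∈ cornerSimplex q) : insertCLM k 0 t ∈ cornerSimplex (q + 1) := by
  rw [insertCLM_apply]
  exact (insertNth_mem_cornerSimplex k _ t).mpr ⟨ht, le_rfl, by
    change (0 : ℝ) ≤ _
    linarith [ht.2]⟩

/-- The vertex 0 has barycentric coordinate 1 - ∑ t_i, so the oblique face is opposite to it, and
the face t_k = 0 is opposite to the vertex k + 1. -/
lemma cornerToStd_hyperplaneParam {q : ℕ} {t : Fin q → ℝ} (ht : t ∈ cornerSimplex q) :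
    cornerToStd (hyperplaneParam 0 t) = simplexFace q 0 (cornerToStd t) := by
  apply DFunLike.coe_injective
  change _ = (stdSimplex.map (Fin.succAbove 0) (cornerToStd t) : Fin (q + 2) → ℝ)
  rw [map_succAbove_apply, coe_cornerToStd ht, coe_cornerToStd (mapsTo_hyperplaneParam 0 ht),
    sum_hyperplaneParam, sub_self, hyperplaneParam, Fin.insertNth_zero', Fin.insertNth_zero']

lemma cornerToStd_insertCLM {q : ℕ} (k : Fin (q + 1)) {t : Fin q → ℝ} (ht : t ∈ cornerSimplex q) :
    cornerToStd (insertCLM k 0 t) = simplexFace q k.succ (cornerToStd t) := by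
  apply DFunLike.coe_injective
  change _ = (stdSimplex.map k.succ.succAbove (cornerToStd t) : Fin (q + 2) → ℝ)
  rw [map_succAbove_apply, coe_cornerToStd ht, coe_cornerToStd (insertCLM_mem_cornerSimplex k ht),
    insertCLM_apply]
  funext i
  refine Fin.cases ?_ (fun i => ?_) i
  · rw [Fin.cons_zero, ← Fin.succ_succAbove_zero k, Fin.insertNth_apply_succAbove, Fin.cons_zero,
      Fin.sum_univ_succAbove _ k]
    simp
  · rw [Fin.cons_succ]
    revert i
    rw [Fin.forall_iff_succAbove k]
    refine ⟨by simp, fun j => ?_⟩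
    rw [← Fin.succ_succAbove_succ, Fin.insertNth_apply_succAbove, Fin.insertNth_apply_succAbove,
      Fin.cons_succ]

/-- The function `u` on the standard simplex is smooth (up to the boundary). -/
def SmoothOnSimplex {q : ℕ} (u : stdSimplex ℝ (Fin (q + 1)) → ℂ) : Prop :=
  ContDiffOn ℝ ∞ (u ∘ cornerToStd) (cornerSimplex q)

/-- The integral of `u dF₁ ∧ ⋯ ∧ dF_q` over the standard simplex. -/
noncomputable def simplexIntegral {q : ℕ} (u : stdSimplex ℝ (Fin (q + 1)) → ℂ)
    (F : Fin q → stdSimplex ℝ (Fin (q + 1)) → ℂ) : ℂ :=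
  ∫ t in cornerSimplex q, u (cornerToStd t) * jacobian (fun i => F i ∘ cornerToStd) t

lemma jacobian_congr {q : ℕ} {F G : Fin q → (Fin q → ℝ) → ℂ}
    (h : ∀ i, EqOn (F i) (G i) (cornerSimplex q)) {t : Fin q → ℝ} (ht : t ∈ cornerSimplex q) :
    jacobian F t = jacobian G t := by
  refine congrArg Matrix.det (Matrix.ext fun i j => ?_)
  rw [Matrix.of_apply, Matrix.of_apply, fderivWithin_congr' (h i) ht]

/-- Stokes' theorem on the standard simplex. -/
theorem simplexIntegral_one {q : ℕ} {F : Fin (q + 1) → stdSimplex ℝ (Fin (q + 2)) → ℂ}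
    (hF : ∀ i, SmoothOnSimplex (F i)) :
    simplexIntegral 1 F = ∑ i : Fin (q + 2), (-1) ^ (i : ℕ) *
      simplexIntegral (F 0 ∘ simplexFace q i) fun j => F j.succ ∘ simplexFace q i := by
  rw [simplexIntegral]
  simp only [Pi.one_apply, one_mul]
  rw [setIntegral_jacobian hF, Fin.sum_univ_succ (n := q + 1), Fin.val_zero, pow_zero, one_mul]
  congr 1
  · refine setIntegral_congr_fun (measurableSet_cornerSimplex q) fun t ht => ?_
    simp only [Function.comp_apply, cornerToStd_hyperplaneParam ht]
    congr 1
    refine jacobian_congr (fun i x hx => ?_) ht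
    simp only [Function.comp_apply, cornerToStd_hyperplaneParam hx]
  · refine Finset.sum_congr rfl fun k _ => ?_
    rw [Fin.val_succ]
    congr 1
    refine setIntegral_congr_fun (measurableSet_cornerSimplex q) fun t ht => ?_
    simp only [Function.comp_apply, cornerToStd_insertCLM k ht]
    congr 1
    refine jacobian_congr (fun i x hx => ?_) ht
    simp only [Function.comp_apply, cornerToStd_insertCLM k hx]

lemma simplexIntegral_zero_left {q : ℕ} (F : Fin q → stdSimplex ℝ (Fin (q + 1)) → ℂ) :
    simplexIntegral 0 F = 0 := by
  simp [simplexIntegral]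

lemma simplexIntegral_eq_zero_of_const {q : ℕ} (u : stdSimplex ℝ (Fin (q + 1)) → ℂ)
    {F : Fin q → stdSimplex ℝ (Fin (q + 1)) → ℂ} {i : Fin q} (c : ℂ) (hi : F i = fun _ => c) :
    simplexIntegral u F = 0 := by
  have h : ∀ t, jacobian (fun i => F i ∘ cornerToStd) t = 0 := fun t => by
    refine Matrix.det_eq_zero_of_row_eq_zero i fun j => ?_
    change fderivWithin ℝ (F i ∘ cornerToStd) (cornerSimplex q) t _ = 0
    rw [hi]
    have : (fun _ : stdSimplex ℝ (Fin (q + 1)) => c) ∘ (cornerToStd : (Fin q → ℝ) → _) =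
      fun _ => c := rfl
    rw [this, fderivWithin_fun_const]
    rfl
  simp [simplexIntegral, h]

lemma simplexIntegral_eq_zero {q : ℕ} (u : stdSimplex ℝ (Fin (q + 1)) → ℂ)
    {F : Fin q → stdSimplex ℝ (Fin (q + 1)) → ℂ} {i : Fin q} (hi : F i = 0) :
    simplexIntegral u F = 0 :=
  simplexIntegral_eq_zero_of_const u 0 hi

lemma integrableOn_simplexIntegral {q : ℕ} {u : stdSimplex ℝ (Fin (q + 1)) → ℂ}
    {F : Fin q → stdSimplex ℝ (Fin (q + 1)) → ℂ} (hu : SmoothOnSimplex u)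
    (hF : ∀ i, SmoothOnSimplex (F i)) :
    IntegrableOn (fun t => u (cornerToStd t) * jacobian (fun i => F i ∘ cornerToStd) t)
      (cornerSimplex q) :=
  (hu.mul (contDiffOn_jacobian hF)).continuousOn.integrableOn_compact (isCompact_cornerSimplex q)

lemma simplexIntegral_of_zero (F : Fin 0 → stdSimplex ℝ (Fin 1) → ℂ) : simplexIntegral 1 F = 1 := by
  have h1 : cornerSimplex 0 = univ := by
    ext t; simp [cornerSimplex]
  have h2 : ∀ t, jacobian (fun i => F i ∘ cornerToStd) t = 1 := fun t => Matrix.det_fin_zero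
  have h3 : volume.real (univ : Set (Fin 0 → ℝ)) = 1 := by
    simp [measureReal_def, volume_pi]
  simp [simplexIntegral, h1, h2, h3]

end SimplexIntegral

/-! ### Closed and primitive terms of a partition of unity indexed by Γ. -/

section Transgression

open MeasureTheory Set

lemma finsum_pi_eq_sum {Γ : Type*} {q : ℕ} (S : Finset Γ) (G : (Fin q → Γ) → ℂ)
    (hG : ∀ J i, J i ∉ S → G J = 0) : ∑ᶠ J, G J = ∑ J : Fin q → S, G fun i => J i := by
  have hinj : Function.Injective fun (J : Fin q → S) (i : Fin q) => (J i : Γ) := fun J J' h =>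
    funext fun i => Subtype.ext (congr_fun h i)
  rw [← finsum_eq_sum_of_fintype, ← finsum_mem_range (f := G) hinj, ← finsum_mem_univ]
  refine finsum_mem_inter_support_eq' _ _ _ fun J hJ => ?_
  simp only [mem_univ, true_iff]
  have h : ∀ i, J i ∈ S := fun i => by
    by_contra hi
    exact hJ (hG J i hi)
  exact ⟨fun i => ⟨J i, h i⟩, rfl⟩

/-- The functions `f_g` on the simplex are smooth, almost all of them vanish, and their
sum is `1`. -/
structure IsSmoothPartition {Γ : Type*} {q : ℕ} (f : Γ → stdSimplex ℝ (Fin (q + 1)) → ℂ) :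
    Prop where
  smooth : ∀ g, SmoothOnSimplex (f g)
  exists_sum : ∃ S : Finset Γ, (∀ g ∉ S, f g = 0) ∧ ∀ t, ∑ g ∈ S, f g t = 1

variable {Γ : Type*} {n q : ℕ} (τ : (Fin (n + 1) → Γ) → ℂ) (a : List Γ)

/-- The integral of `∑ τ(a, g₁, …, g_q) df_{g₁} ∧ ⋯ ∧ df_{g_q}`. -/
noncomputable def closedTerm (f : Γ → stdSimplex ℝ (Fin (q + 1)) → ℂ) : ℂ :=
  ∑ᶠ J : Fin q → Γ, listEval τ (a ++ List.ofFn J) * simplexIntegral 1 fun i => f (J i)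

/-- The integral of `∑ τ(a, g₀, …, g_q) f_{g₀} df_{g₁} ∧ ⋯ ∧ df_{g_q}`. -/
noncomputable def primitiveTerm (f : Γ → stdSimplex ℝ (Fin (q + 1)) → ℂ) : ℂ :=
  ∑ᶠ J : Fin (q + 1) → Γ,
    listEval τ (a ++ List.ofFn J) * simplexIntegral (f (J 0)) fun i => f (J i.succ)

variable {τ} {f : Γ → stdSimplex ℝ (Fin (q + 1)) → ℂ}

lemma closedTerm_eq_sum {S : Finset Γ} (hS : ∀ g ∉ S, f g = 0) :
    closedTerm τ a f = ∑ J : Fin q → S,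
      listEval τ (a ++ List.ofFn fun i => (J i : Γ)) * simplexIntegral 1 fun i => f (J i) :=
  finsum_pi_eq_sum S _ fun J i hi => by rw [simplexIntegral_eq_zero (i := i) _ (hS _ hi), mul_zero]

lemma primitiveTerm_eq_sum {S : Finset Γ} (hS : ∀ g ∉ S, f g = 0) :
    primitiveTerm τ a f = ∑ J : Fin (q + 1) → S,
      listEval τ (a ++ List.ofFn fun i => (J i : Γ)) *
        simplexIntegral (f (J 0)) fun i => f (J i.succ) :=
  finsum_pi_eq_sum S _ fun J i hi => by
    revert hi
    refine Fin.cases (fun hi => ?_) (fun i hi => ?_) i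
    · rw [hS _ hi, simplexIntegral_zero_left, mul_zero]
    · rw [simplexIntegral_eq_zero (i := i) _ (hS _ hi), mul_zero]

/-- Stokes' theorem for each summand f_{g_0} df_{g_1} ⋯ df_{g_q}. -/
lemma closedTerm_succ {f : Γ → stdSimplex ℝ (Fin (q + 2)) → ℂ} (hf : IsSmoothPartition f) :
    closedTerm τ a f = ∑ i : Fin (q + 2), (-1) ^ (i : ℕ) *
      primitiveTerm τ a fun g => f g ∘ simplexFace q i := by
  obtain ⟨S, hS, -⟩ := hf.exists_sum
  rw [closedTerm_eq_sum a hS]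
  have h : ∀ i : Fin (q + 2), ∀ g ∉ S, (fun g => f g ∘ simplexFace q i) g = 0 := fun i g hg => by
    simp only [hS g hg]; rfl
  simp only [fun i => primitiveTerm_eq_sum (τ := τ) a (h i), Finset.mul_sum]
  rw [Finset.sum_comm]
  refine Finset.sum_congr rfl fun J _ => ?_
  rw [simplexIntegral_one fun i => hf.smooth (J i), Finset.mul_sum]
  refine Finset.sum_congr rfl fun i _ => ?_
  rw [mul_left_comm]

/-- Stokes' theorem with the constant 1 as the first function: d1 = 0 kills the interior integral.
This makes integration of the form a cocycle. -/
lemma sum_closedTerm_face {f : Γ → stdSimplex ℝ (Fin (q + 2)) → ℂ} (hf : IsSmoothPartition f) :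
    ∑ i : Fin (q + 2), (-1) ^ (i : ℕ) * closedTerm τ a (fun g => f g ∘ simplexFace q i) = 0 := by
  obtain ⟨S, hS, -⟩ := hf.exists_sum
  have h : ∀ i : Fin (q + 2), ∀ g ∉ S, (fun g => f g ∘ simplexFace q i) g = 0 := fun i g hg => by
    simp only [hS g hg]; rfl
  simp only [fun i => closedTerm_eq_sum (τ := τ) a (h i), Finset.mul_sum]
  rw [Finset.sum_comm]
  refine Finset.sum_eq_zero fun J _ => ?_
  have h1 := simplexIntegral_one (F := Fin.cons 1 fun i : Fin q => f (J i))
    (Fin.cases contDiffOn_const fun i => hf.smooth (J i))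
  rw [simplexIntegral_eq_zero_of_const (i := 0) 1 1 rfl] at h1
  simp only [mul_left_comm _ (listEval _ _)]
  rw [← Finset.mul_sum]
  exact mul_eq_zero_of_right _ h1.symm

lemma closedTerm_of_zero {f : Γ → stdSimplex ℝ (Fin 1) → ℂ} :
    closedTerm τ a f = listEval τ a := by
  rw [closedTerm, finsum_eq_sum_of_fintype, Fintype.sum_unique, simplexIntegral_of_zero]
  simp

/-- Left invariance of τ after the substitution g_i ↦ g g_i; it will give independence of the choice
of a lift. -/
lemma primitiveTerm_mul [Group Γ] (hτ : τ ∈ altCochains Γ n) (g : Γ) :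
    primitiveTerm τ (a.map (g⁻¹ * ·)) (fun h => f (g * h)) = primitiveTerm τ a f := by
  unfold primitiveTerm
  refine Eq.trans (finsum_congr fun J => ?_)
    (finsum_comp_equiv (Equiv.piCongrRight fun _ : Fin (q + 1) => Equiv.mulLeft g))
  have h := listEval_mul hτ g (a.map (g⁻¹ * ·) ++ List.ofFn J)
  rw [← h, List.map_append, List.map_map, List.map_ofFn]
  simp [Function.comp_def]

lemma sum_fderivWithin_eq_zero (hf : IsSmoothPartition f) {S : Finset Γ}
    (hS : ∀ t, ∑ g ∈ S, f g t = 1) {t : Fin q → ℝ} (ht : t ∈ cornerSimplex q) :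
    ∑ g : S, fderivWithin ℝ (f g ∘ cornerToStd) (cornerSimplex q) t = 0 := by
  rw [← fderivWithin_fun_sum (uniqueDiffOn_cornerSimplex q t ht)
    (A := fun g : S => f g ∘ cornerToStd)
    fun g _ => (hf.smooth g).differentiableOn (by simp) t ht]
  have : (fun t : Fin q → ℝ => ∑ g : S, (f g ∘ cornerToStd) t) = fun _ => 1 := by
    funext t
    rw [← hS (cornerToStd t)]
    exact Finset.sum_coe_sort S fun g => f g (cornerToStd t)
  rw [this, fderivWithin_fun_const]
  rfl

/-- Under the integral, deleting g_k from τ leaves the index of one factor df_g free, and ∑ df_g =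
0. -/
lemma sum_eraseIdx_mul_simplexIntegral (hf : IsSmoothPartition f) {S : Finset Γ}
    (hS : ∀ t, ∑ g ∈ S, f g t = 1) {u : stdSimplex ℝ (Fin (q + 1)) → ℂ} (hu : SmoothOnSimplex u) :
    ∑ J : Fin q → S, (∑ k ∈ Finset.range q, (-1) ^ k *
      listEval τ (a ++ (List.ofFn fun i => (J i : Γ)).eraseIdx k)) *
        simplexIntegral u (fun i => f (J i)) = 0 := by
  unfold simplexIntegral
  simp only [← integral_const_mul]
  rw [← integral_finsetSum _ fun J _ => (integrableOn_simplexIntegral hu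
    fun i => hf.smooth (J i)).const_mul _]
  refine setIntegral_eq_zero_of_forall_eq_zero fun t ht => ?_
  have h := sum_listEval_eraseIdx_smul τ (wedgeEval q).toMultilinearMap (fun g : S => (g : Γ))
    (sum_fderivWithin_eq_zero hf hS ht) a
  have h' := DFunLike.congr_fun h fun j => Pi.single j (1 : ℝ)
  rw [ContinuousAlternatingMap.sum_apply] at h'
  simp only [mul_left_comm _ (u _)]
  rw [← Finset.mul_sum]
  refine mul_eq_zero_of_right _ (Eq.trans ?_ h')
  rfl

lemma sum_simplexIntegral (hf : IsSmoothPartition f) {S : Finset Γ}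
    (hS : ∀ t, ∑ g ∈ S, f g t = 1) (J : Fin q → Γ) :
    ∑ g : S, simplexIntegral (f g) (fun i => f (J i)) = simplexIntegral 1 fun i => f (J i) := by
  unfold simplexIntegral
  rw [← integral_finsetSum _ fun (g : S) _ => integrableOn_simplexIntegral (hf.smooth g)
    fun i => hf.smooth (J i)]
  congr 1
  funext t
  rw [← Finset.sum_mul, Finset.sum_coe_sort S fun g => f g (cornerToStd t), hS]
  rfl

/-- The cocycle identity trades deletions in `a` for deletions among g_0, …, g_q. Deleting g_0 lets
∑ f_{g_0} = 1 act and leaves the closed term; every other deletion contributes zero because ∑ df_g =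
0. -/
lemma sum_primitiveTerm_eraseIdx (hd : groupCoboundary τ = 0) (hf : IsSmoothPartition f) :
    ∑ k ∈ Finset.range a.length, (-1) ^ k * primitiveTerm τ (a.eraseIdx k) f =
      - (-1) ^ a.length * closedTerm τ a f := by
  obtain ⟨S, hS, hS1⟩ := hf.exists_sum
  simp only [primitiveTerm_eq_sum _ hS, closedTerm_eq_sum _ hS, Finset.mul_sum]
  rw [Finset.sum_comm]
  have h1 : ∀ J : Fin (q + 1) → S, ∑ k ∈ Finset.range a.length, (-1) ^ k *
      (listEval τ (a.eraseIdx k ++ List.ofFn fun i => (J i : Γ)) *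
        simplexIntegral (f (J 0)) fun i => f (J i.succ)) =
      - (-1) ^ a.length * (listEval τ (a ++ List.ofFn fun i : Fin q => (J i.succ : Γ)) *
        simplexIntegral (f (J 0)) fun i => f (J i.succ)) + (-1) ^ a.length *
      ((∑ k ∈ Finset.range q, (-1) ^ k * listEval τ ((a ++ [(J 0 : Γ)]) ++
        (List.ofFn fun i : Fin q => (J i.succ : Γ)).eraseIdx k)) *
          simplexIntegral (f (J 0)) fun i => f (J i.succ)) := by
    intro J
    simp only [← mul_assoc]
    rw [← Finset.sum_mul, sum_listEval_eraseIdx_append hd, List.length_ofFn,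
      Finset.sum_range_succ', List.ofFn_succ, ← add_mul]
    congr 1
    simp only [List.eraseIdx_cons_succ, List.eraseIdx_cons_zero, pow_zero, one_mul, pow_succ,
      mul_neg_one, neg_mul, Finset.sum_neg_distrib, List.append_assoc, List.singleton_append]
    ring
  simp only [h1]
  rw [Finset.sum_add_distrib, ← Finset.mul_sum, ← Finset.mul_sum,
    ← (Fin.consEquiv fun _ : Fin (q + 1) => (S : Type _)).sum_comp,
    ← (Fin.consEquiv fun _ : Fin (q + 1) => (S : Type _)).sum_comp,
    Fintype.sum_prod_type_right, Fintype.sum_prod_type]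
  simp only [Fin.consEquiv_apply, Fin.cons_zero, Fin.cons_succ]
  simp only [← Finset.mul_sum, sum_simplexIntegral hf hS1]
  simp only [fun g : S => sum_eraseIdx_mul_simplexIntegral (τ := τ) (a ++ [(g : Γ)]) hf hS1
    (hf.smooth g), Finset.sum_const_zero, mul_zero, add_zero]

end Transgression

/-! ### The zigzag between front vertices and back faces. -/

section Zigzag

open Set

/-- The map of standard simplices induced by a map of vertices. -/
noncomputable def simplexMap {p q : ℕ} (φ : Fin (p + 1) → Fin (q + 1)) :
    C(stdSimplex ℝ (Fin (p + 1)), stdSimplex ℝ (Fin (q + 1))) :=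
  ⟨stdSimplex.map φ, stdSimplex.continuous_map _⟩

lemma simplexMap_vertex {p q : ℕ} (φ : Fin (p + 1) → Fin (q + 1)) (i : Fin (p + 1)) :
    simplexMap φ (stdSimplex.vertex i) = stdSimplex.vertex (φ i) :=
  stdSimplex.map_vertex _ _

lemma simplexMap_comp {p q r : ℕ} (φ : Fin (p + 1) → Fin (q + 1)) (ψ : Fin (q + 1) → Fin (r + 1)) :
    (simplexMap ψ).comp (simplexMap φ) = simplexMap (ψ ∘ φ) := by
  ext1 x
  exact stdSimplex.map_comp_apply φ ψ x

/-- The vertices `p, …, p + q` of the standard simplex `Δᴺ`. -/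
def backVertices (p q N : ℕ) (i : Fin (q + 1)) : Fin (N + 1) := Fin.ofNat (N + 1) (p + i)

/-- Vertex numbers are natural numbers reduced modulo N + 1, so p, q and N may vary independently;
the relation p + q = N ensures that no actual reduction takes place. -/
lemma succAbove_comp_backVertices_of_le {p q N i : ℕ} (h : p + q = N) (hi : i ≤ p) :
    (Fin.ofNat (N + 2) i).succAbove ∘ backVertices p q N = backVertices (p + 1) q (N + 1) := by
  funext j
  have hj := j.2
  apply Fin.ext
  simp only [Function.comp_apply, backVertices, Fin.succAbove, Fin.lt_def, Fin.val_castSucc,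
    Fin.val_ofNat]
  rw [Nat.mod_eq_of_lt (by omega : p + (j : ℕ) < N + 1), Nat.mod_eq_of_lt (by omega : i < N + 2),
    if_neg (by omega), Fin.val_succ, Fin.val_ofNat, Nat.mod_eq_of_lt (by omega),
    Nat.mod_eq_of_lt (by omega)]
  omega

lemma succAbove_comp_backVertices_add {p q N k : ℕ} (h : p + q = N) (hk : k < q + 2) :
    (Fin.ofNat (N + 2) (p + k)).succAbove ∘ backVertices p q N =
      backVertices p (q + 1) (N + 1) ∘ (Fin.ofNat (q + 2) k).succAbove := by
  funext j
  have hj := j.2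
  apply Fin.ext
  simp only [Function.comp_apply, backVertices, Fin.succAbove, Fin.lt_def, Fin.val_castSucc,
    Fin.val_ofNat]
  rw [Nat.mod_eq_of_lt (by omega : p + (j : ℕ) < N + 1),
    Nat.mod_eq_of_lt (by omega : p + k < N + 2), Nat.mod_eq_of_lt hk]
  split_ifs with h1 h2 h2
  · rw [Fin.val_castSucc, Fin.val_ofNat, Fin.val_castSucc, Nat.mod_eq_of_lt (by omega),
      Nat.mod_eq_of_lt (by omega)]
  · omega
  · omega
  · rw [Fin.val_succ, Fin.val_ofNat, Fin.val_succ, Nat.mod_eq_of_lt (by omega),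
      Nat.mod_eq_of_lt (by omega)]
    omega

lemma backVertices_succ {p q N : ℕ} :
    backVertices p (q + 1) (N + 1) ∘ (Fin.ofNat (q + 2) 0).succAbove =
      backVertices (p + 1) q (N + 1) := by
  funext j
  have h : (Fin.ofNat (q + 2) 0).succAbove j = j.succ := Fin.zero_succAbove j
  simp only [Function.comp_apply, h, backVertices, Fin.val_succ]
  congr 1
  omega

lemma backVertices_zero (N : ℕ) : backVertices 0 N N = id := by
  funext j
  simp [backVertices]

variable {X Γ : Type*} [TopologicalSpace X] {n : ℕ} (τ : (Fin (n + 1) → Γ) → ℂ)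
  (f : Γ → X → ℂ) (r : X → Γ)

/-- The values of `r` on the first `p + 1` vertices of a simplex. -/
def frontValues (p : ℕ) {N : ℕ} (s : C(stdSimplex ℝ (Fin (N + 1)), X)) : List Γ :=
  List.ofFn fun i : Fin (p + 1) => r (s (stdSimplex.vertex (Fin.ofNat (N + 1) i)))

lemma length_frontValues (p : ℕ) {N : ℕ} (s : C(stdSimplex ℝ (Fin (N + 1)), X)) :
    (frontValues r p s).length = p + 1 := List.length_ofFn

lemma frontValues_face_of_le {p N i : ℕ} (h : p ≤ N) (hi : i ≤ p)
    (s : C(stdSimplex ℝ (Fin (N + 2)), X)) :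
    frontValues r p (s.comp (simplexFace N (Fin.ofNat (N + 2) i))) =
      (frontValues r (p + 1) s).eraseIdx i := by
  rw [frontValues, frontValues, List.eraseIdx_ofFn _ ⟨i, by omega⟩]
  congr 1
  funext j
  have hj := j.2
  rw [ContinuousMap.comp_apply]
  erw [simplexMap_vertex]
  congr 3
  apply Fin.ext
  simp only [Fin.succAbove, Fin.lt_def, Fin.val_castSucc, Fin.val_ofNat]
  rw [Nat.mod_eq_of_lt (by omega : (j : ℕ) < N + 1), Nat.mod_eq_of_lt (by omega : i < N + 2)]
  split_ifs with h1
  · rw [Fin.val_castSucc, Fin.val_ofNat, Fin.val_castSucc, Nat.mod_eq_of_lt (by omega),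
      Nat.mod_eq_of_lt (by omega)]
  · rw [Fin.val_succ, Fin.val_ofNat, Fin.val_succ, Nat.mod_eq_of_lt (by omega),
      Nat.mod_eq_of_lt (by omega)]

lemma frontValues_face_of_lt {p N i : ℕ} (hi : p < i) (hi' : i < N + 2)
    (s : C(stdSimplex ℝ (Fin (N + 2)), X)) :
    frontValues r p (s.comp (simplexFace N (Fin.ofNat (N + 2) i))) = frontValues r p s := by
  rw [frontValues, frontValues]
  congr 1
  funext j
  have hj := j.2
  rw [ContinuousMap.comp_apply]
  erw [simplexMap_vertex]
  congr 3
  apply Fin.ext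
  simp only [Fin.succAbove, Fin.lt_def, Fin.val_castSucc, Fin.val_ofNat]
  rw [Nat.mod_eq_of_lt (by omega : (j : ℕ) < N + 1), Nat.mod_eq_of_lt (by omega : i < N + 2),
    if_pos (by omega), Fin.val_castSucc, Fin.val_ofNat, Nat.mod_eq_of_lt (by omega),
    Nat.mod_eq_of_lt (by omega)]

lemma frontValues_eraseIdx {p N : ℕ} (s : C(stdSimplex ℝ (Fin (N + 1)), X)) :
    (frontValues r (p + 1) s).eraseIdx (p + 1) = frontValues r p s := by
  rw [frontValues, frontValues, List.eraseIdx_ofFn _ ⟨p + 1, by omega⟩]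
  congr 1
  funext j
  have : (⟨p + 1, by omega⟩ : Fin (p + 2)).succAbove j = j.castSucc := by
    rw [Fin.succAbove_of_castSucc_lt]
    exact Fin.lt_def.mpr j.2
  rw [this, Fin.val_castSucc]

/-- The restriction of `f` to the simplex spanned by the vertices `p, …, p + q` of `s`. -/
noncomputable def restrictBack (p q : ℕ) {N : ℕ} (s : C(stdSimplex ℝ (Fin (N + 1)), X)) (g : Γ) :
    stdSimplex ℝ (Fin (q + 1)) → ℂ :=
  f g ∘ s.comp (simplexMap (backVertices p q N))

lemma restrictBack_face_of_le {p q N i : ℕ} (h : p + q = N) (hi : i ≤ p)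
    (s : C(stdSimplex ℝ (Fin (N + 2)), X)) :
    restrictBack f p q (s.comp (simplexFace N (Fin.ofNat (N + 2) i))) =
      restrictBack f (p + 1) q s := by
  funext g
  have : (simplexFace N (Fin.ofNat (N + 2) i)).comp (simplexMap (backVertices p q N)) =
      simplexMap (backVertices (p + 1) q (N + 1)) := by
    rw [← succAbove_comp_backVertices_of_le h hi]
    exact simplexMap_comp _ _
  rw [restrictBack, ContinuousMap.comp_assoc, this]
  rfl

lemma restrictBack_face_add {p q N k : ℕ} (h : p + q = N) (hk : k < q + 2)
    (s : C(stdSimplex ℝ (Fin (N + 2)), X)) :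
    restrictBack f p q (s.comp (simplexFace N (Fin.ofNat (N + 2) (p + k)))) =
      fun g => restrictBack f p (q + 1) s g ∘ simplexFace q (Fin.ofNat (q + 2) k) := by
  funext g
  have : (simplexFace N (Fin.ofNat (N + 2) (p + k))).comp (simplexMap (backVertices p q N)) =
      (simplexMap (backVertices p (q + 1) (N + 1))).comp
        (simplexFace q (Fin.ofNat (q + 2) k)) := by
    have h1 := simplexMap_comp (backVertices p q N) (Fin.ofNat (N + 2) (p + k)).succAbove
    rw [succAbove_comp_backVertices_add h hk, ← simplexMap_comp] at h1
    exact h1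
  rw [restrictBack, ContinuousMap.comp_assoc, this]
  rfl

lemma restrictBack_face_zero {p q N : ℕ} (s : C(stdSimplex ℝ (Fin (N + 2)), X)) :
    (fun g => restrictBack f p (q + 1) s g ∘ simplexFace q (Fin.ofNat (q + 2) 0)) =
      restrictBack f (p + 1) q s := by
  funext g
  have : (simplexMap (backVertices p (q + 1) (N + 1))).comp
      (simplexFace q (Fin.ofNat (q + 2) 0)) = simplexMap (backVertices (p + 1) q (N + 1)) := by
    rw [← backVertices_succ]
    exact simplexMap_comp _ _
  rw [restrictBack, restrictBack, ← this]
  rfl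

/-- A face i ≤ p deletes a front value, to which the cocycle identity applies; a face i > p is a
face of the back simplex, to which Stokes' theorem applies. Each identity has one term in excess,
with front vertices 0, …, p and back vertices from p + 1 on, and these two cancel. -/
lemma sum_primitiveTerm_face {τ : (Fin (n + 1) → Γ) → ℂ} (hd : groupCoboundary τ = 0) {p q N : ℕ}
    (h : p + q = N) (s : C(stdSimplex ℝ (Fin (N + 2)), X))
    (hs : ∀ p q, IsSmoothPartition (restrictBack f p q s)) :
    ∑ i ∈ Finset.range (N + 2), (-1) ^ i *
      primitiveTerm τ (frontValues r p (s.comp (simplexFace N (Fin.ofNat (N + 2) i))))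
        (restrictBack f p q (s.comp (simplexFace N (Fin.ofNat (N + 2) i)))) =
      (-1) ^ p * (closedTerm τ (frontValues r p s) (restrictBack f p (q + 1) s) -
        closedTerm τ (frontValues r (p + 1) s) (restrictBack f (p + 1) q s)) := by
  have h1 := sum_primitiveTerm_eraseIdx (frontValues r (p + 1) s) hd (hs (p + 1) q)
  rw [length_frontValues, Finset.sum_range_succ, frontValues_eraseIdx] at h1
  have h2 := closedTerm_succ (τ := τ) (frontValues r p s) (hs p (q + 1))
  have h3 : ∀ g : ℕ → ℂ, ∑ i : Fin (q + 2), g i = ∑ i ∈ Finset.range (q + 2), g i :=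
    fun g => (Finset.sum_range g).symm
  have h4 := h3 fun i => (-1) ^ i * primitiveTerm τ (frontValues r p s) fun g =>
    restrictBack f p (q + 1) s g ∘ simplexFace q (Fin.ofNat (q + 2) i)
  simp only [Fin.ofNat_val_eq_self] at h4
  rw [h4, Finset.sum_range_succ', restrictBack_face_zero, pow_zero, one_mul] at h2
  have hsplit : ∀ g : ℕ → ℂ, ∑ i ∈ Finset.range (N + 2), g i =
      ∑ i ∈ Finset.range (p + 1), g i + ∑ k ∈ Finset.range (q + 1), g (p + (k + 1)) := by
    intro g
    rw [show N + 2 = (p + 1) + (q + 1) by omega, Finset.sum_range_add]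
    congr 1
    exact Finset.sum_congr rfl fun k _ => by rw [add_assoc, add_comm 1 k]
  rw [hsplit]
  have h5 : ∀ i ∈ Finset.range (p + 1), (-1) ^ i *
      primitiveTerm τ (frontValues r p (s.comp (simplexFace N (Fin.ofNat (N + 2) i))))
        (restrictBack f p q (s.comp (simplexFace N (Fin.ofNat (N + 2) i)))) =
      (-1) ^ i * primitiveTerm τ ((frontValues r (p + 1) s).eraseIdx i)
        (restrictBack f (p + 1) q s) := fun i hi => by
    have hi := Finset.mem_range.mp hi
    rw [frontValues_face_of_le r (by omega) (by omega), restrictBack_face_of_le f h (by omega)]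
  have h6 : ∀ k ∈ Finset.range (q + 1), (-1) ^ (p + (k + 1)) *
      primitiveTerm τ (frontValues r p (s.comp (simplexFace N (Fin.ofNat (N + 2) (p + (k + 1))))))
        (restrictBack f p q (s.comp (simplexFace N (Fin.ofNat (N + 2) (p + (k + 1)))))) =
      (-1) ^ p * ((-1) ^ (k + 1) * primitiveTerm τ (frontValues r p s) fun g =>
        restrictBack f p (q + 1) s g ∘ simplexFace q (Fin.ofNat (q + 2) (k + 1))) := fun k hk => by
    have hk := Finset.mem_range.mp hk
    rw [frontValues_face_of_lt r (by omega) (by omega),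
      restrictBack_face_add f h (by omega), pow_add, mul_assoc]
  rw [Finset.sum_congr rfl h5, Finset.sum_congr rfl h6, ← Finset.mul_sum]
  linear_combination h1 - (-1) ^ p * h2

/-- A cochain which relates the integral of `∑ τ(a, g₁, …, gₙ) df_{g₁} ∧ ⋯ ∧ df_{gₙ}` and
the values of `τ` at the vertices. -/
noncomputable def transgression {N : ℕ} (s : C(stdSimplex ℝ (Fin (N + 1)), X)) : ℂ :=
  ∑ p ∈ Finset.range (N + 1), (-1) ^ p *
    primitiveTerm τ (frontValues r p s) (restrictBack f p (N - p) s)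

/-- The weights (-1)^p turn the preceding identity into a telescoping sum. At p = 0 the back simplex
is all of `s`; at p = N + 1 it is a point, and only the value of τ at the vertices is left. -/
lemma sum_transgression_face {τ : (Fin (n + 1) → Γ) → ℂ} (hd : groupCoboundary τ = 0) {N : ℕ}
    (s : C(stdSimplex ℝ (Fin (N + 2)), X))
    (hs : ∀ p q, IsSmoothPartition (restrictBack f p q s)) :
    ∑ i : Fin (N + 2), (-1) ^ (i : ℕ) * transgression τ f r (s.comp (simplexFace N i)) =
      closedTerm τ [r (s (stdSimplex.vertex 0))] (fun g => f g ∘ s) -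
        listEval τ (List.ofFn fun i => r (s (stdSimplex.vertex i))) := by
  have h := Finset.sum_range (n := N + 2) fun i : ℕ => (-1 : ℂ) ^ i *
    transgression τ f r (s.comp (simplexFace N (Fin.ofNat (N + 2) i)))
  simp only [Fin.ofNat_val_eq_self] at h
  rw [← h]
  simp only [transgression, Finset.mul_sum]
  rw [Finset.sum_comm]
  have h1 : ∀ p ∈ Finset.range (N + 1), ∑ i ∈ Finset.range (N + 2), (-1) ^ i * ((-1) ^ p *
      primitiveTerm τ (frontValues r p (s.comp (simplexFace N (Fin.ofNat (N + 2) i))))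
        (restrictBack f p (N - p) (s.comp (simplexFace N (Fin.ofNat (N + 2) i))))) =
      closedTerm τ (frontValues r p s) (restrictBack f p (N + 1 - p) s) -
        closedTerm τ (frontValues r (p + 1) s) (restrictBack f (p + 1) (N + 1 - (p + 1)) s) := by
    intro p hp
    have hp := Finset.mem_range.mp hp
    simp only [mul_left_comm _ ((-1 : ℂ) ^ p)]
    rw [← Finset.mul_sum, sum_primitiveTerm_face f r hd (by omega) s hs, ← mul_assoc, ← pow_add,
      Even.neg_one_pow ⟨p, rfl⟩, one_mul, show N + 1 - p = N - p + 1 by omega,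
      show N + 1 - (p + 1) = N - p by omega]
  rw [Finset.sum_congr rfl h1, Finset.sum_range_sub' fun p =>
    closedTerm τ (frontValues r p s) (restrictBack f p (N + 1 - p) s)]
  have h2 : restrictBack f 0 (N + 1) s = fun g => f g ∘ s := by
    funext g t
    simp only [restrictBack, backVertices_zero, Function.comp_apply, ContinuousMap.comp_apply]
    congr 2
    exact stdSimplex.map_id_apply t
  have h3 : ∀ q (hq : q = 0) (f' : Γ → stdSimplex ℝ (Fin (q + 1)) → ℂ) (a : List Γ),
      closedTerm τ a f' = listEval τ a := by
    rintro q rfl f' a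
    exact closedTerm_of_zero a
  rw [h3 (N + 1 - (N + 1)) (by omega), Nat.sub_zero, h2]
  congr 2
  refine congrArg List.ofFn (funext fun i => ?_)
  rw [Fin.ofNat_val_eq_self]

/-- Lifts of one simplex differ by an element of Γ; this invariance makes the transgression a
cochain on M. -/
lemma transgression_eq [Group Γ] {τ : (Fin (n + 1) → Γ) → ℂ} (hτ : τ ∈ altCochains Γ n) {N : ℕ}
    (g : Γ) (s s' : C(stdSimplex ℝ (Fin (N + 1)), X)) (hf : ∀ t h, f h (s' t) = f (g * h) (s t))
    (hr : ∀ t, r (s' t) = g⁻¹ * r (s t)) : transgression τ f r s' = transgression τ f r s := by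
  refine Finset.sum_congr rfl fun p _ => ?_
  have h1 : frontValues r p s' = (frontValues r p s).map (g⁻¹ * ·) := by
    rw [frontValues, frontValues, List.map_ofFn]
    simp only [hr]
    rfl
  have h2 : restrictBack f p (N - p) s' = fun h => restrictBack f p (N - p) s (g * h) := by
    funext h t
    exact hf _ h
  rw [h1, h2, primitiveTerm_mul _ hτ]

end Zigzag

/-! ### Smooth simplices and closed terms as integrals of one form. -/

section SmoothSimplex

open Set

variable {E : Type*} [NormedAddCommGroup E] [NormedSpace ℝ E]
  {M : Type*} [TopologicalSpace M] [ChartedSpace E M]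

lemma IsSmoothSimplex.comp_simplexMap {p q : ℕ} {s : C(stdSimplex ℝ (Fin (q + 1)), M)}
    (hs : IsSmoothSimplex E s) (φ : Fin (p + 1) → Fin (q + 1)) :
    IsSmoothSimplex E (s.comp (simplexMap φ)) := by
  obtain ⟨W, F, hW, hsub, hF, hFs⟩ := hs
  let L : (Fin (p + 1) → ℝ) →L[ℝ] (Fin (q + 1) → ℝ) :=
    (FunOnFinite.linearMap ℝ ℝ φ).toContinuousLinearMap
  have hL : ∀ t : stdSimplex ℝ (Fin (p + 1)), L t.1 = (simplexMap φ t).1 := fun t => rfl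
  refine ⟨L ⁻¹' W, F ∘ L, hW.preimage L.continuous, fun t ht => ?_, ?_, fun t => ?_⟩
  · change L t ∈ W
    rw [show L t = (simplexMap φ ⟨t, ht⟩).1 from hL ⟨t, ht⟩]
    exact hsub (simplexMap φ ⟨t, ht⟩).2
  · exact hF.comp L.contDiff.contMDiff.contMDiffOn (fun _ h => h)
  · change F (L t.1) = s (simplexMap φ t)
    rw [hL, hFs]

/-- The multilinear map `(φ₁, …, φₙ) ↦ det (φᵢ (vⱼ))`. -/
noncomputable def wedgeAt {V : Type*} [AddCommGroup V] [Module ℝ V] [TopologicalSpace V] {n : ℕ}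
    (v : Fin n → V) : MultilinearMap ℂ (fun _ : Fin n => V →L[ℝ] ℂ) ℂ :=
  (Matrix.detRowAlternating (n := Fin n) (R := ℂ)).toMultilinearMap.compLinearMap fun _ =>
    LinearMap.pi fun j =>
      { toFun := fun f => f (v j), map_add' := fun _ _ => rfl, map_smul' := fun _ _ => rfl }

lemma continuousOn_cornerToStd (q : ℕ) :
    ContinuousOn (cornerToStd : (Fin q → ℝ) → _) (cornerSimplex q) := by
  rw [continuousOn_iff_continuous_domRestrict]
  refine Continuous.subtype_mk (f := fun t : cornerSimplex q => (Fin.cons (1 - ∑ i, t.1 i) t.1 :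
    Fin (q + 1) → ℝ)) ?_ (fun t => ?_) |>.congr fun t => ?_
  · refine continuous_pi fun i => Fin.cases ?_ (fun j => ?_) i
    · simp only [Fin.cons_zero]
      fun_prop
    · simp only [Fin.cons_succ]
      exact (continuous_apply j).comp continuous_subtype_val
  · rw [← coe_cornerToStd t.2]
    exact (cornerToStd t.1).2
  · apply DFunLike.coe_injective
    exact (coe_cornerToStd t.2).symm

lemma IsSmoothSimplex.contMDiffOn {q : ℕ} {s : C(stdSimplex ℝ (Fin (q + 1)), M)}
    (hs : IsSmoothSimplex E s) :
    ContMDiffOn 𝓘(ℝ, Fin q → ℝ) 𝓘(ℝ, E) ∞ (fun t => s (cornerToStd t)) (cornerSimplex q) := by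
  obtain ⟨W, F, -, hsub, hF, hFs⟩ := hs
  let A : (Fin q → ℝ) → (Fin (q + 1) → ℝ) := fun t => Fin.cons (1 - ∑ i, t i) t
  have hA : ContDiff ℝ ∞ A := by
    refine contDiff_pi.mpr fun i => Fin.cases ?_ (fun j => ?_) i
    · simp only [A, Fin.cons_zero]
      fun_prop
    · simp only [A, Fin.cons_succ]
      fun_prop
  have hAt : ∀ t ∈ cornerSimplex q, A t = (cornerToStd t).1 := fun t ht =>
    (coe_cornerToStd ht).symm
  refine (hF.comp hA.contMDiff.contMDiffOn fun t ht => ?_).congr fun t ht => ?_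
  · change A t ∈ W
    rw [hAt t ht]
    exact hsub (cornerToStd t).2
  · rw [Function.comp_apply, hAt t ht, hFs]

/-- By `sum_cons_smul_eq` at each point of the simplex, `a` may be replaced by 1. The transgression
produces for `a` the value of r at the first vertex, the form on M has 1. -/
lemma closedTerm_eq_setIntegral {Γ : Type*} {q : ℕ} {τ : (Fin (q + 1) → Γ) → ℂ} [One Γ]
    (hd : groupCoboundary τ = 0) (a : Γ) {f : Γ → stdSimplex ℝ (Fin (q + 1)) → ℂ}
    (hf : IsSmoothPartition f) : closedTerm τ [a] f = ∫ t in cornerSimplex q,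
      ∑ᶠ J : Fin q → Γ, τ (Fin.cons 1 J) •
        wedgeAt (fun j : Fin q => (Pi.single j (1 : ℝ) : Fin q → ℝ)) fun i =>
          fderivWithin ℝ (f (J i) ∘ cornerToStd) (cornerSimplex q) t := by
  obtain ⟨S, hS, hS1⟩ := hf.exists_sum
  rw [closedTerm_eq_sum [a] hS]
  simp only [simplexIntegral, ← MeasureTheory.integral_const_mul]
  rw [← MeasureTheory.integral_finsetSum _ fun (J : Fin q → S) _ => (integrableOn_simplexIntegral
    (u := 1) contDiffOn_const fun i => hf.smooth (J i)).const_mul _]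
  refine MeasureTheory.setIntegral_congr_fun (measurableSet_cornerSimplex q) fun t ht => ?_
  have h1 := sum_cons_smul_eq hd
    (wedgeAt fun j : Fin q => (Pi.single j (1 : ℝ) : Fin q → ℝ)) (fun g : S => (g : Γ))
    (sum_fderivWithin_eq_zero hf hS1 ht) a 1
  have h4 := finsum_pi_eq_sum S (fun J : Fin q → Γ => τ (Fin.cons 1 J) •
    wedgeAt (fun j : Fin q => (Pi.single j (1 : ℝ) : Fin q → ℝ)) fun i =>
      fderivWithin ℝ (f (J i) ∘ cornerToStd) (cornerSimplex q) t) fun J i hi => by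
    have h0 : fderivWithin ℝ (f (J i) ∘ cornerToStd) (cornerSimplex q) t = 0 := by
      have hz : (0 : stdSimplex ℝ (Fin (q + 1)) → ℂ) ∘ (cornerToStd : (Fin q → ℝ) → _) =
        fun _ => 0 := rfl
      rw [hS _ hi, hz, fderivWithin_fun_const]
      rfl
    rw [MultilinearMap.map_coord_zero _ i h0, smul_zero]
  refine Eq.trans ?_ (h1.trans h4.symm)
  refine Finset.sum_congr rfl fun J _ => ?_
  have h5 : listEval τ ([a] ++ List.ofFn fun i => (J i : Γ)) =
      τ (Fin.cons a fun i => (J i : Γ)) := by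
    rw [← listEval_ofFn (τ := τ), List.ofFn_succ]
    simp
  rw [h5, Pi.one_apply, one_mul]
  rfl

end SmoothSimplex

/-! ### Integrals of the descended form over smooth simplices. -/

namespace CoverData

open MulOpposite Topology Set

variable {E : Type*} [NormedAddCommGroup E] [NormedSpace ℝ E]
  {M M' : Type*} [TopologicalSpace M] [ChartedSpace E M] [TopologicalSpace M']
  {π : M' → M} {κ : Type*} [Fintype κ] (D : CoverData E π κ)
  {Γ : Type*} [Group Γ] [MulAction Γᵐᵒᵖ M'] {q : ℕ} {s : C(stdSimplex ℝ (Fin (q + 1)), M)}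
  {s' : C(stdSimplex ℝ (Fin (q + 1)), M')}

lemma contDiffOn_sqχ_simplex (hs : IsSmoothSimplex E s) (j : κ) :
    ContDiffOn ℝ ∞ (fun t => D.sqχ j (s (cornerToStd t))) (cornerSimplex q) :=
  ((D.contMDiff_sqχ j).comp_contMDiffOn hs.contMDiffOn).contDiffOn

open Classical in
lemma eventually_h_smul_simplex (hπ : IsQuotientCoveringMap π Γᵐᵒᵖ)
    (hs' : ∀ t, π (s' t) = s t) {t : Fin q → ℝ} (ht : t ∈ cornerSimplex q) (g : Γ) :
    (fun t => D.h (op g • s' (cornerToStd t))) =ᶠ[𝓝[cornerSimplex q] t] fun u =>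
      ∑ j, if D.sheet Γ (s' (cornerToStd t)) j = g then D.sqχ j (s (cornerToStd u)) else 0 := by
  have h1 : ContinuousWithinAt (fun t => s' (cornerToStd t)) (cornerSimplex q) t :=
    s'.continuous.continuousAt.comp_continuousWithinAt (continuousOn_cornerToStd q t ht)
  filter_upwards [h1.eventually (D.eventually_h_smul (Γ := Γ) hπ (s' (cornerToStd t)))] with u hu
  rw [hu g, hs']

lemma isSmoothPartition_h (hπ : IsQuotientCoveringMap π Γᵐᵒᵖ) (hs : IsSmoothSimplex E s)
    (hs' : ∀ t, π (s' t) = s t) :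
    IsSmoothPartition fun (g : Γ) t => D.h (op g • s' t) := by
  classical
  refine ⟨fun g t ht => ?_, ?_⟩
  · refine ContDiffWithinAt.congr_of_eventuallyEq_of_mem ?_
      (D.eventually_h_smul_simplex hπ hs' ht g) ht
    refine ContDiffWithinAt.sum fun j _ => ?_
    split_ifs
    · exact D.contDiffOn_sqχ_simplex hs j t ht
    · exact contDiffWithinAt_const
  · have h1 : ∀ t₀, {t | ∀ j, D.sheet Γ (s' t) j = D.sheet Γ (s' t₀) j ∨
        D.sqχ j (π (s' t)) = 0} ∈ 𝓝 t₀ := fun t₀ =>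
      s'.continuous.continuousAt.eventually (D.eventually_sheet_eq_or (Γ := Γ) hπ (s' t₀))
    obtain ⟨T, hT⟩ := CompactSpace.elim_nhds_subcover _ h1
    -- Near each point only the sheets at that point contribute; compactness of the simplex leaves
    -- finitely many elements of Γ.
    let S : Finset Γ := T.biUnion fun t₀ => Finset.univ.image (D.sheet Γ (s' t₀))
    have hS : ∀ t j, D.sheet Γ (s' t) j ∈ S ∨ D.sqχ j (π (s' t)) = 0 := by
      intro t j
      have ht : t ∈ (⊤ : Set (stdSimplex ℝ (Fin (q + 1)))) := mem_univ t
      rw [← hT] at ht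
      simp only [mem_iUnion] at ht
      obtain ⟨t₀, ht₀, ht⟩ := ht
      refine (ht j).imp_left fun h => ?_
      rw [h]
      exact Finset.mem_biUnion.mpr ⟨t₀, ht₀, Finset.mem_image_of_mem _ (Finset.mem_univ j)⟩
    refine ⟨S, fun g hg => funext fun t => ?_, fun t => ?_⟩
    · rw [D.h_smul hπ]
      refine Finset.sum_eq_zero fun j _ => ?_
      split_ifs with h
      · exact (hS t j).resolve_left fun h' => hg (h ▸ h')
      · rfl
    · simp only [D.h_smul hπ]
      rw [Finset.sum_comm, ← D.sum_sqχ (π (s' t))]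
      refine Finset.sum_congr rfl fun j _ => ?_
      rw [Finset.sum_ite_eq]
      split_ifs with h
      · rfl
      · exact ((hS t j).resolve_left h).symm

lemma dsqχ_mfderivWithin_simplex [IsManifold 𝓘(ℝ, E) ∞ M] (hs : IsSmoothSimplex E s)
    {t : Fin q → ℝ} (ht : t ∈ cornerSimplex q) (j : κ) (v : Fin q → ℝ) :
    D.dsqχ (s (cornerToStd t)) j (mfderivWithin 𝓘(ℝ, Fin q → ℝ) 𝓘(ℝ, E)
      (fun u => s (cornerToStd u)) (cornerSimplex q) t v) =
      fderivWithin ℝ (fun u => D.sqχ j (s (cornerToStd u))) (cornerSimplex q) t v := by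
  have h := mfderiv_comp_mfderivWithin t (D.mdifferentiableAt_sqχ j (s (cornerToStd t)))
    (hs.contMDiffOn.mdifferentiableOn (by simp) t ht)
    (uniqueDiffOn_cornerSimplex q t ht).uniqueMDiffWithinAt
  rw [← mfderivWithin_eq_fderivWithin]
  exact (DFunLike.congr_fun h v).symm

open Classical in
lemma fderivWithin_h_smul_simplex (hπ : IsQuotientCoveringMap π Γᵐᵒᵖ) (hs : IsSmoothSimplex E s)
    (hs' : ∀ t, π (s' t) = s t) {t : Fin q → ℝ} (ht : t ∈ cornerSimplex q) (g : Γ) :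
    fderivWithin ℝ ((fun t => D.h (op g • s' t)) ∘ cornerToStd) (cornerSimplex q) t =
      ∑ j, if D.sheet Γ (s' (cornerToStd t)) j = g then
        fderivWithin ℝ (fun u => D.sqχ j (s (cornerToStd u))) (cornerSimplex q) t else 0 := by
  have h := D.eventually_h_smul_simplex hπ hs' ht g
  refine (h.fderivWithin_eq_of_mem ht).trans ?_
  rw [fderivWithin_fun_sum (uniqueDiffOn_cornerSimplex q t ht)]
  · refine Finset.sum_congr rfl fun j _ => ?_
    split_ifs
    · rfl
    · rw [fderivWithin_fun_const]; rfl
  · intro j _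
    split_ifs
    · exact (D.contDiffOn_sqχ_simplex hs j).differentiableOn (by simp) t ht
    · exact differentiableWithinAt_const _

lemma alt_form_simplex [IsManifold 𝓘(ℝ, E) ∞ M]
    {τ : (Fin (q + 1) → Γ) → ℂ} {w : MForm E M}
    (hw : ∀ y, w (π y) = cochainForm τ 1 (D.sheet Γ y) (D.dsqχ (π y)))
    (hs : IsSmoothSimplex E s) (hs' : ∀ t, π (s' t) = s t) {t : Fin q → ℝ}
    (ht : t ∈ cornerSimplex q) :
    (CotangentAlg.alt q (w (s (cornerToStd t))) fun j =>
      mfderivWithin 𝓘(ℝ, Fin q → ℝ) 𝓘(ℝ, E) (fun u => s (cornerToStd u)) (cornerSimplex q) t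
        (Pi.single j (1 : ℝ) : Fin q → ℝ)) =
      ∑ J : Fin q → κ, τ (Fin.cons 1 fun i => D.sheet Γ (s' (cornerToStd t)) (J i)) •
        wedgeAt (fun j : Fin q => (Pi.single j (1 : ℝ) : Fin q → ℝ)) fun i =>
          fderivWithin ℝ (fun u => D.sqχ (J i) (s (cornerToStd u))) (cornerSimplex q) t := by
  have hw' : w (s (cornerToStd t)) = cochainForm τ 1 (D.sheet Γ (s' (cornerToStd t)))
      (D.dsqχ (s (cornerToStd t))) := by
    have := hw (s' (cornerToStd t))
    rwa [hs'] at this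
  rw [hw', alt_cochainForm_apply]
  simp only [D.dsqχ_mfderivWithin_simplex hs ht]
  rfl

/-- Along the lift, the differentials of the χ_j² with sheet g add up to that of h(s'·g), as for
`liftedForm_eq`. The freedom in `a` is used when comparing with the transgression. -/
lemma integral_form [IsManifold 𝓘(ℝ, E) ∞ M] (hπ : IsQuotientCoveringMap π Γᵐᵒᵖ)
    {τ : (Fin (q + 1) → Γ) → ℂ} (hd : groupCoboundary τ = 0) {w : MForm E M}
    (hw : ∀ y, w (π y) = cochainForm τ 1 (D.sheet Γ y) (D.dsqχ (π y)))
    (hs : IsSmoothSimplex E s) (hs' : ∀ t, π (s' t) = s t) (a : Γ) :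
    w.integral s = closedTerm τ [a] fun g t => D.h (op g • s' t) := by
  classical
  rw [closedTerm_eq_setIntegral hd a (D.isSmoothPartition_h hπ hs hs')]
  refine MeasureTheory.setIntegral_congr_fun (measurableSet_cornerSimplex q) fun t ht => ?_
  refine (D.alt_form_simplex hw hs hs' ht).trans ?_
  simp only [D.fderivWithin_h_smul_simplex hπ hs hs' ht]
  exact (finsum_smul_multilinear_fiber _ (D.sheet Γ (s' (cornerToStd t)))
    (fun j => fderivWithin ℝ (fun u => D.sqχ j (s (cornerToStd u))) (cornerSimplex q) t)
    fun J => τ (Fin.cons 1 J)).symm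

end CoverData

/-! ### Scalar multiples of closed forms and their classes. -/

section ConstSMul

variable {E : Type*} [NormedAddCommGroup E] [NormedSpace ℝ E]
  {M : Type*} [TopologicalSpace M] [ChartedSpace E M]

lemma MForm.inChart_const_smul (c : ℂ) (w : MForm E M) (n : ℕ) (x₀ : M) :
    (c • w).inChart n x₀ = fun z => c • w.inChart n x₀ z := by
  funext z
  rw [MForm.inChart, Pi.smul_apply, map_smul]
  rfl

lemma MForm.IsSmooth.const_smul {w : MForm E M} (hw : w.IsSmooth) (c : ℂ) :
    (c • w).IsSmooth := fun n x₀ => by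
  rw [MForm.inChart_const_smul]
  exact (hw n x₀).const_smul c

lemma MForm.IsClosed.const_smul {w : MForm E M} (hw : w.IsClosed) (hw' : w.IsSmooth) (c : ℂ) :
    (c • w).IsClosed := fun n x₀ z hz => by
  have hd : DifferentiableAt ℝ (w.inChart n x₀) z :=
    ((hw' n x₀).contDiffAt ((isOpen_extChartAt_target x₀).mem_nhds hz)).differentiableAt (by simp)
  rw [MForm.inChart_const_smul, CoverData.extDeriv_complex_smul c hd, hw n x₀ z hz, smul_zero]

lemma MForm.integralCochain_const_smul (c : ℂ) (w : MForm E M) (n : ℕ) :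
    (c • w).integralCochain n = c • w.integralCochain n := by
  funext s
  rw [Pi.smul_apply, MForm.integralCochain, MForm.integralCochain, MForm.integral, MForm.integral,
    smul_eq_mul, ← MeasureTheory.integral_const_mul]
  congr 1
  funext t
  rw [Pi.smul_apply, map_smul]
  rfl

lemma MForm.HasClass.const_smul {w : MForm E M} {n : ℕ} {ξ : SingularCohomology M n}
    (hw : w.HasClass ξ) (c : ℂ) : (c • w).HasClass (c • ξ) := by
  obtain ⟨h1, h2, h3, h4, h5⟩ := hw
  refine ⟨h1.const_smul c, h2.const_smul h1 c, fun x => Submodule.smul_mem _ c (h3 x), ?_⟩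
  rw [MForm.integralCochain_const_smul]
  refine ⟨Submodule.smul_mem _ c h4, ?_⟩
  rw [map_smul, ← h5]
  rfl

end ConstSMul

/-- Match the lifts at one vertex; uniqueness of lifts on a connected simplex does the rest. -/
lemma IsQuotientCoveringMap.exists_smul_eq_of_lift {T B Γ : Type*} [Group Γ] [TopologicalSpace T]
    [TopologicalSpace B] [MulAction Γᵐᵒᵖ T] {p : T → B} (hp : IsQuotientCoveringMap p Γᵐᵒᵖ) {n : ℕ}
    {s : C(stdSimplex ℝ (Fin (n + 1)), B)} {s₁ s₂ : C(stdSimplex ℝ (Fin (n + 1)), T)}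
    (h₁ : ∀ t, p (s₁ t) = s t) (h₂ : ∀ t, p (s₂ t) = s t) :
    ∃ g : Γ, ∀ t, s₂ t = MulOpposite.op g • s₁ t := by
  have := hp.toContinuousConstSMul
  obtain ⟨g, hg⟩ := hp.apply_eq_iff_mem_orbit.mp
    ((h₂ (stdSimplex.vertex 0)).trans (h₁ (stdSimplex.vertex 0)).symm)
  refine ⟨MulOpposite.unop g, congr_fun (hp.isCoveringMap.eq_of_comp_eq s₂.continuous
      (s₁.continuous.const_smul g) ?_ (stdSimplex.vertex 0) hg.symm)⟩
  funext t
  simp only [Function.comp_apply, hp.map_smul, h₁, h₂]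

/-! ### The cohomology class of the descended form. -/

namespace CoverData

open MulOpposite Topology Set

variable {E : Type*} [NormedAddCommGroup E] [NormedSpace ℝ E]
  {M M' : Type*} [TopologicalSpace M] [ChartedSpace E M] [TopologicalSpace M']
  {π : M' → M} {κ : Type*} [Fintype κ] (D : CoverData E π κ)
  {Γ : Type*} [Group Γ] [MulAction Γᵐᵒᵖ M']

lemma integralCochain_mem_cocycles [IsManifold 𝓘(ℝ, E) ∞ M] (hπ : IsQuotientCoveringMap π Γᵐᵒᵖ)
    {n : ℕ} {τ : (Fin (n + 1) → Γ) → ℂ} (hd : groupCoboundary τ = 0) {w : MForm E M}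
    (hw : ∀ y, w (π y) = cochainForm τ 1 (D.sheet Γ y) (D.dsqχ (π y))) :
    w.integralCochain n ∈ (smoothSimplices E M).cocycles n := by
  change (smoothSimplices E M).coboundary n _ = 0
  funext s
  have hl := liftSimplex_spec hπ s.1
  have h : ∀ i : Fin (n + 2), w.integral (s.1.comp (simplexFace n i)) =
      closedTerm τ [1] fun g => (fun t => D.h (op g • liftSimplex hπ s.1 t)) ∘ simplexFace n i :=
    fun i => D.integral_form hπ hd hw (s.2.face i)
      (s' := (liftSimplex hπ s.1).comp (simplexFace n i)) (fun t => hl _) 1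
  change ∑ i : Fin (n + 2), (-1) ^ (i : ℕ) * w.integral (s.1.comp (simplexFace n i)) = 0
  simp only [h]
  exact sum_closedTerm_face [1] (D.isSmoothPartition_h (Γ := Γ) hπ s.2 hl)

theorem hasClass_form [IsManifold 𝓘(ℝ, E) ∞ M] (hπ : IsQuotientCoveringMap π Γᵐᵒᵖ)
    (hopen : IsOpenMap π) {n : ℕ} (hn : 1 ≤ n) {τ : (Fin (n + 1) → Γ) → ℂ}
    (hτ : τ ∈ altCochains Γ n) (hd : groupCoboundary τ = 0) {w : MForm E M}
    (hw : ∀ y, w (π y) = cochainForm τ 1 (D.sheet Γ y) (D.dsqχ (π y)))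
    {T B : Type*} [TopologicalSpace T] [TopologicalSpace B] [MulAction Γᵐᵒᵖ T] {p : T → B}
    (hp : IsQuotientCoveringMap p Γᵐᵒᵖ) {ν : C(M, B)} (hν : IsClassifyingMap (Γ := Γ) π p ν) :
    w.HasClass (SingularCohomology.map ν n (groupClass hp hτ hd)) := by
  refine ⟨D.form_isSmooth hπ hopen hw, D.form_isClosed hπ hopen hw, D.form_mem hπ hw,
    D.integralCochain_mem_cocycles hπ hd hw, ?_⟩
  obtain ⟨F, hF, hFp⟩ := hν
  -- In positive degree the coboundaries are the image of the cochains of degree N = n - 1, where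
  -- the transgression lives.
  obtain ⟨N, rfl⟩ : ∃ N, n = N + 1 := ⟨n - 1, by omega⟩
  refine (Submodule.Quotient.eq _).mpr ?_
  let f : Γ → M' → ℂ := fun g y => D.h (op g • y)
  -- Equivariance of `F` gives r(y·g) = g⁻¹ r(y), as `transgression_eq` requires, and makes τ at the
  -- vertices the pullback of the group cochain on `B`.
  let r : M' → Γ := fun y => orbitCoord hp (F y)
  refine ⟨fun s => transgression τ f r (liftSimplex hπ s.1), funext fun s => ?_⟩
  have hl := liftSimplex_spec hπ s.1
  -- The chosen lift of a face need not be the face of the chosen lift; both give the same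
  -- transgression.
  have h1 : ∀ i : Fin (N + 2),
      transgression τ f r (liftSimplex hπ (s.1.comp (simplexFace N i))) =
        transgression τ f r ((liftSimplex hπ s.1).comp (simplexFace N i)) := by
    intro i
    obtain ⟨g, hg⟩ := hπ.exists_smul_eq_of_lift
      (s₁ := (liftSimplex hπ s.1).comp (simplexFace N i)) (s := s.1.comp (simplexFace N i))
      (fun t => hl _) (liftSimplex_spec hπ _)
    refine transgression_eq f r hτ g _ _ (fun t h => ?_) fun t => ?_
    · simp only [f, hg, smul_smul, ← op_mul]
    · simp only [r, hg, hF, orbitCoord_smul]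
  have h2 : ∀ p q, IsSmoothPartition (restrictBack f p q (liftSimplex hπ s.1)) := fun p q =>
    D.isSmoothPartition_h hπ (s.2.comp_simplexMap (backVertices p q (N + 1))) fun t => hl _
  change ∑ i : Fin (N + 2), (-1) ^ (i : ℕ) *
    transgression τ f r (liftSimplex hπ (s.1.comp (simplexFace N i))) = _
  simp only [h1]
  rw [sum_transgression_face f r hd _ h2, listEval_ofFn]
  have h3 := D.integral_form hπ hd hw s.2 hl (r (liftSimplex hπ s.1 (stdSimplex.vertex 0)))
  have h4 := groupToSingular_eq hp hτ (ν.comp s.1) (F.comp (liftSimplex hπ s.1)) fun t => by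
    rw [ContinuousMap.comp_apply, ContinuousMap.comp_apply, hFp, hl]
  exact (congrArg₂ (· - ·) h3 h4).symm

end CoverData

/-! ### Conclusion. -/

theorem mainTheorem5 {m : ℕ}
    {M : Type*} [TopologicalSpace M] [ChartedSpace (EuclideanSpace ℝ (Fin m)) M]
    [IsManifold (𝓡 m) ∞ M] [T2Space M] [CompactSpace M] [ConnectedSpace M]
    {M' : Type*} [TopologicalSpace M'] [ChartedSpace (EuclideanSpace ℝ (Fin m)) M']
    [IsManifold (𝓡 m) ∞ M'] [SimplyConnectedSpace M']
    {Γ : Type*} [Group Γ] [MulAction Γᵐᵒᵖ M'] (π : M' → M)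
    (hπ : IsQuotientCoveringMap π Γᵐᵒᵖ) (hπ' : IsLocalDiffeomorph (𝓡 m) (𝓡 m) ∞ π)
    {κ : Type*} [Fintype κ] [DecidableEq κ] (D : CoverData (EuclideanSpace ℝ (Fin m)) π κ)
    (n : ℕ) (hn : 1 ≤ n) (τ : (Fin (n + 1) → Γ) → ℂ) (hτ : τ ∈ altCochains Γ n)
    (hd : groupCoboundary τ = 0) :
    (∃! w : MForm (EuclideanSpace ℝ (Fin m)) M, w.pullback π = D.liftedForm τ) ∧
    (∀ w : MForm (EuclideanSpace ℝ (Fin m)) M, w.pullback π = D.liftedForm τ →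
      w.IsSmooth ∧ w.IsClosed ∧
      pairForm (cyclicCochain τ) (chernForm (D.proj Γ)) =
        ((-1) ^ (n * (n - 1) / 2) * ((2 * Real.pi * Complex.I) ^ n * n.factorial)⁻¹ : ℂ) • w) ∧
    (∀ (T B : Type*) [TopologicalSpace T] [TopologicalSpace B] [ContractibleSpace T]
      [MulAction Γᵐᵒᵖ T] (p : T → B) (hp : IsQuotientCoveringMap p Γᵐᵒᵖ) (ν : C(M, B)),
      IsClassifyingMap (Γ := Γ) π p ν →
      (pairForm (cyclicCochain τ) (chernForm (D.proj Γ))).HasClass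
        (((-1) ^ (n * (n - 1) / 2) * ((2 * Real.pi * Complex.I) ^ n * n.factorial)⁻¹ : ℂ) •
          SingularCohomology.map ν n (groupClass hp hτ hd))) := by
  have hopen : IsOpenMap π := hπ'.isOpenMap
  set C : ℂ := (-1) ^ (n * (n - 1) / 2) * ((2 * Real.pi * Complex.I) ^ n * n.factorial)⁻¹ with hC
  have hC0 : C ≠ 0 := by
    have h1 : (n.factorial : ℂ) ≠ 0 := Nat.cast_ne_zero.mpr n.factorial_ne_zero
    have h2 : (2 * Real.pi * Complex.I : ℂ) ≠ 0 := Complex.two_pi_I_ne_zero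
    exact mul_ne_zero (pow_ne_zero _ (by simp)) (inv_ne_zero (mul_ne_zero (pow_ne_zero _ h2) h1))
  have hpair := D.pairForm_chernForm hπ hopen hτ hd
  have hiff := D.pullback_eq_liftedForm_iff hπ hπ' τ
  -- The paired Chern form already lives on M, so dividing it by the constant gives existence
  -- without a descent argument.
  have hw₀ : ∀ y, (C⁻¹ • pairForm (cyclicCochain τ) (chernForm (D.proj Γ))) (π y) =
      cochainForm τ 1 (D.sheet Γ y) (D.dsqχ (π y)) := fun y => by
    rw [Pi.smul_apply, hpair, smul_smul, inv_mul_cancel₀ hC0, one_smul]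
  have heq : ∀ w : MForm (EuclideanSpace ℝ (Fin m)) M, w.pullback π = D.liftedForm τ →
      pairForm (cyclicCochain τ) (chernForm (D.proj Γ)) = C • w := fun w hw => by
    funext x
    obtain ⟨y, rfl⟩ := hπ.surjective x
    rw [Pi.smul_apply, hpair, (hiff w).mp hw y]
  refine ⟨⟨_, (hiff _).mpr hw₀, fun w hw => ?_⟩, fun w hw => ?_, ?_⟩
  · rw [heq w hw, smul_smul, inv_mul_cancel₀ hC0, one_smul]
  · have hw' := (hiff w).mp hw
    exact ⟨D.form_isSmooth hπ hopen hw', D.form_isClosed hπ hopen hw', heq w hw⟩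
  · intro T B _ _ _ _ p hp ν hν
    rw [heq _ ((hiff _).mpr hw₀)]
    exact (D.hasClass_form hπ hopen hn hτ hd hw₀ hp hν).const_smul C
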